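/- Let $A=(a_{ij})$, $B=(b_{ij})$ be $m\times n$ matrices ($m,n\ge 1$) with entries in $\mathbb{Z}\cup\{-\infty\}$, without $-\infty$ rows and without common $-\infty$ columns. Let $M\ge 1$ be an integer that bounds the absolute values of the finite entries, and let $\kappa=\min(2m,n)$. Write $(Ax)_i=\max_j(a_{ij}+x_j)$ and $(A^\sharp y)_j=\min_{i:\,a_{ij}\neq-\infty}(-a_{ij}+y_i)$. Let $\operatorname{spec}(A,B)$ be the set of $\lambda\in\mathbb{R}$ for which there is $x\in(\mathbb{R}\cup\{-\infty\})^n$, $x\not\equiv-\infty$, with $Ax=\lambda+Bx$. To identify $\operatorname{spec}(A,B)$ means to output, in increasing order, the (rational or infinite) ends of finitely many nonempty pairwise disjoint closed intervals, possibly points, whose union is $\operatorname{spec}(A,B)$. A mean payoff game with $p$ nodes of Max and $q$ nodes of Min is a pair $(E,F)$ of $p\times q$ matrices over $\mathbb{Z}\cup\{-\infty\}$ such that $E$ has no $-\infty$ column and $F$ has no $-\infty$ row; its (greatest) value is $r(E^\sharp F)$, the greatest $\lambda$ such that $E^\sharp Fx=\lambda+x$ for some $x\in(\mathbb{R}\cup\{-\infty\})^q$,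 $x\not\equiv-\infty$. A mean-payoff game oracle returns for each such game an integer that is nonnegative if and only if the value of the game is nonnegative (in particular, an oracle that computes the value will do). $\operatorname{MPG}(p,q,W)$ denotes the worst-case execution time of the oracle on the games with $p$ nodes of Max, $q$ nodes of Min and finite entries of absolute value at most $W$. Algorithms are programs of a random access machine whose arithmetic operations, addition, subtraction and comparison of integers, take unit time; the constants below and the programs depend neither on $m,n,A,B,M$ nor on the oracle. 1. There are an algorithm and constants $C,d$ such that the algorithm always identifies $\operatorname{spec}(A,B)$ with at most $C\,M\kappa^3$ calls to the oracle, each on a game with $2m$ nodes of Max, $n$ nodes of Min and entries of absolute value at most $2\kappa(M+2M\kappa)$, hence of execution time at most $\operatorname{MPG}(2m,n,2\kappa(M+2M\kappa))$, and with at most $C\,M\,(m+n)^d$ further steps. In particular $\operatorname{spec}(A,B)$ can be identified in pseudo-polynomial time: there are an algorithm that does not call the oracle and constants $C,d$ such that the algorithm identifies $\operatorname{spec}(A,B)$ in at most $C(m+n+M)^d$ steps. 2. Let $\ell=\max\bigl(0,\ \max_i(B^\sharp A0)_i+\max_i(A^\sharp B0)_i\bigr)$, where $0$ is the zero vector. There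 are an algorithm and constants $C,d$ such that, whenever neither $A$ nor $B$ has a $-\infty$ column, the algorithm identifies $\operatorname{spec}(A,B)$ with at most $C\,\ell\,\kappa^2+1$ calls to the oracle, each on a game with $2m$ nodes of Max, $n$ nodes of Min and entries of absolute value at most $6M\kappa$, hence of execution time at most $\operatorname{MPG}(2m,n,6M\kappa)$, and with at most $C(\ell+1)(m+n)^d$ further steps. -/

import Mathlib

noncomputable section

namespace MaxPlus

/-! ### Max-plus algebra

Matrices with integer or `-∞` entries have type `Matrix (Fin m) (Fin n) (WithBot ℤ)`, with `⊥`
for `-∞`. Vectors over `ℝ ∪ {-∞}` are vectors over `EReal` none of whose entries is `⊤`. -/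

/-- An integer or `-∞`, as an extended real. -/
def ent : WithBot ℤ → EReal
  | ⊥ => ⊥
  | (z : ℤ) => ((z : ℝ) : EReal)

/-- The max-plus product `(A x)_i = max_j (a_ij + x_j)`. -/
def mulVec {m n : ℕ} (A : Matrix (Fin m) (Fin n) (WithBot ℤ)) (x : Fin n → EReal) :
    Fin m → EReal :=
  fun i => ⨆ j, (ent (A i j) + x j)

/-- The residuated operator `(A♯ y)_j = min_i (- a_ij + y_i)`. An index `i` with `a_ij = -∞`
contributes `+∞` to the minimum, so it is left out. -/
def resid {m n : ℕ} (A : Matrix (Fin m) (Fin n) (WithBot ℤ)) (y : Fin m → EReal) :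
    Fin n → EReal :=
  fun j => ⨅ i, ⨅ _ : A i j ≠ ⊥, (y i - ent (A i j))

/-- `x` is a vector over `ℝ ∪ {-∞}` that is not identically `-∞`. -/
def IsNontrivial {n : ℕ} (x : Fin n → EReal) : Prop :=
  (∀ j, x j ≠ ⊤) ∧ ∃ j, x j ≠ ⊥

/-- The (finite) spectrum of the two-sided eigenproblem `A x = lam + B x`. -/
def spec {m n : ℕ} (A B : Matrix (Fin m) (Fin n) (WithBot ℤ)) : Set ℝ :=
  {lam | ∃ x : Fin n → EReal, IsNontrivial x ∧
    ∀ i, mulVec A x i = (lam : EReal) + mulVec B x i}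

/-- The spectral radius `r(f)`: the greatest eigenvalue of a self-map of `(ℝ ∪ {-∞})^n`
(`⊥` if there is no finite eigenvalue). -/
def specRad {n : ℕ} (f : (Fin n → EReal) → (Fin n → EReal)) : EReal :=
  sSup {r | ∃ lam : ℝ, r = (lam : EReal) ∧ ∃ x : Fin n → EReal, IsNontrivial x ∧
    ∀ j, f x j = (lam : EReal) + x j}

def NoBotRow {m n : ℕ} (A : Matrix (Fin m) (Fin n) (WithBot ℤ)) : Prop :=
  ∀ i, ∃ j, A i j ≠ ⊥

def NoBotCol {m n : ℕ} (A : Matrix (Fin m) (Fin n) (WithBot ℤ)) : Prop :=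
  ∀ j, ∃ i, A i j ≠ ⊥

def NoCommonBotCol {m n : ℕ} (A B : Matrix (Fin m) (Fin n) (WithBot ℤ)) : Prop :=
  ∀ j, ∃ i, A i j ≠ ⊥ ∨ B i j ≠ ⊥

/-- Every finite entry has absolute value at most `M`. -/
def EntriesBounded {m n : ℕ} (A : Matrix (Fin m) (Fin n) (WithBot ℤ)) (M : ℕ) : Prop :=
  ∀ i j, ∀ z : ℤ, A i j = (z : WithBot ℤ) → |z| ≤ (M : ℤ)

/-- Pairs of nonempty matrices without `-∞` rows and without common `-∞` columns. -/
def Admissible {m n : ℕ} (A B : Matrix (Fin m) (Fin n) (WithBot ℤ)) : Prop :=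
  0 < m ∧ 0 < n ∧ NoBotRow A ∧ NoBotRow B ∧ NoCommonBotCol A B

/-- `max_i (B♯ A 0)_i + max_i (A♯ B 0)_i`, where `0` is the zero vector. Both maxima are finite if
`A` and `B` have neither `-∞` rows nor `-∞` columns (and `0 < n`). -/
def width {m n : ℕ} (A B : Matrix (Fin m) (Fin n) (WithBot ℤ)) : ℝ :=
  (⨆ i, resid B (mulVec A 0) i).toReal + (⨆ i, resid A (mulVec B 0) i).toReal

/-- `κ = min (2m, n)`. -/
def kap (m n : ℕ) : ℕ := min (2 * m) n

/-! ### Mean payoff games and oracles -/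

/-- The data of a mean payoff game: Min moves from a column `j` to a row `i` with `a_ij ≠ -∞`
and pays `-a_ij`; Max then moves from `i` to a column `k` with `b_ik ≠ -∞` and receives `b_ik`. -/
structure Game where
  rows : ℕ
  cols : ℕ
  A : Matrix (Fin rows) (Fin cols) (WithBot ℤ)
  B : Matrix (Fin rows) (Fin cols) (WithBot ℤ)

/-- Each player always has a move. -/
def Game.Valid (G : Game) : Prop := NoBotCol G.A ∧ NoBotRow G.B

/-- `r(A♯B)`, the greatest value of the game over all initial nodes of Min. -/
def Game.value (G : Game) : EReal := specRad (fun x => resid G.A (mulVec G.B x))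

/-- Games with `m` nodes of Max, `n` nodes of Min and integer payments of modulus at most `W`. -/
def gameClass (m n W : ℕ) : Set Game :=
  {G | G.rows = m ∧ G.cols = n ∧ G.Valid ∧ EntriesBounded G.A W ∧ EntriesBounded G.B W}

/-- A device that returns an integer for each game, after a certain execution time. -/
structure GameOracle where
  answer : Game → ℤ
  time : Game → ℕ

/-- The answer has the right sign: it is nonnegative exactly when the value of the game is.
An oracle that returns the value (say, the numerator of the value as a fraction with positive
denominator) is in particular correct. -/
def GameOracle.Correct (orc : GameOracle) : Prop :=
  ∀ G : Game, G.Valid → (0 ≤ orc.answer G ↔ 0 ≤ G.value)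

/-- The worst-case execution time of the oracle on the games of a given size. -/
def MPG (orc : GameOracle) (m n W : ℕ) : ℕ∞ :=
  ⨆ G ∈ gameClass m n W, (orc.time G : ℕ∞)

/-! ### Random access machines with an oracle

A structured programming language over the integers. The memory consists of scalar variables and
of doubly indexed arrays. The only arithmetic operations are addition and subtraction; every
elementary instruction and every evaluation of a guard takes one step. -/

inductive Expr where
  | const (c : ℤ)
  | var (x : ℕ)
  | get (a : ℕ) (i j : Expr)
  | add (e f : Expr)
  | sub (e f : Expr)

inductive Prog where
  | skip
  | assign (x : ℕ) (e : Expr)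
  | put (a : ℕ) (i j : Expr) (e : Expr)
  | emit (e : Expr)
  | query (x : ℕ) (rows cols : Expr) (valA maskA valB maskB : ℕ)
  | seq (P Q : Prog)
  | ifle (e f : Expr) (P Q : Prog)
  | whilele (e f : Expr) (P : Prog)

/-- The memory, the list of the integers written to the output so far, the list of the games
that were submitted to the oracle so far, and the number of steps so far. -/
structure State where
  vars : ℕ → ℤ
  arr : ℕ → ℕ → ℕ → ℤ
  out : List ℤ
  calls : List Game
  steps : ℕ

/-- Evaluation of an expression; a negative array index is read as `0`. -/
def Expr.eval (s : State) : Expr → ℤ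
  | .const c => c
  | .var x => s.vars x
  | .get a i j => s.arr a (i.eval s).toNat (j.eval s).toNat
  | .add e f => e.eval s + f.eval s
  | .sub e f => e.eval s - f.eval s

namespace State

def tick (s : State) : State := { s with steps := s.steps + 1 }

def setVar (s : State) (x : ℕ) (v : ℤ) : State :=
  { s with vars := Function.update s.vars x v }

def setArr (s : State) (a i j : ℕ) (v : ℤ) : State :=
  { s with arr := fun a' i' j' => if a' = a ∧ i' = i ∧ j' = j then v else s.arr a' i' j' }

def write (s : State) (v : ℤ) : State := { s with out := s.out ++ [v] }

/-- A matrix is stored in two arrays: an entry is finite if and only if its mask is nonzero,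
and the other array then holds its value. -/
def readMatrix (s : State) (val mask : ℕ) (r c : ℕ) : Matrix (Fin r) (Fin c) (WithBot ℤ) :=
  fun i j => if s.arr mask i j = 0 then ⊥ else ((s.arr val i j : ℤ) : WithBot ℤ)

def readGame (s : State) (rows cols : Expr) (valA maskA valB maskB : ℕ) : Game where
  rows := (rows.eval s).toNat
  cols := (cols.eval s).toNat
  A := s.readMatrix valA maskA _ _
  B := s.readMatrix valB maskB _ _

/-- Submit the game `G` to the oracle and put the answer into the variable `x`. -/
def ask (s : State) (orc : GameOracle) (x : ℕ) (G : Game) : State :=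
  { s.setVar x (orc.answer G) with calls := s.calls ++ [G] }

end State

/-- `Exec orc P s t`: started in `s`, the program `P` halts in `t`. -/
inductive Exec (orc : GameOracle) : Prog → State → State → Prop where
  | skip (s : State) : Exec orc .skip s s.tick
  | assign (s : State) (x : ℕ) (e : Expr) :
      Exec orc (.assign x e) s (s.setVar x (e.eval s)).tick
  | put (s : State) (a : ℕ) (i j e : Expr) :
      Exec orc (.put a i j e) s
        (s.setArr a (i.eval s).toNat (j.eval s).toNat (e.eval s)).tick
  | emit (s : State) (e : Expr) : Exec orc (.emit e) s (s.write (e.eval s)).tick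
  | query (s : State) (x : ℕ) (rows cols : Expr) (valA maskA valB maskB : ℕ) :
      Exec orc (.query x rows cols valA maskA valB maskB) s
        (s.ask orc x (s.readGame rows cols valA maskA valB maskB)).tick
  | seq {P Q : Prog} {s t u : State} (hP : Exec orc P s t) (hQ : Exec orc Q t u) :
      Exec orc (.seq P Q) s u
  | ifle_true {e f : Expr} {P Q : Prog} {s t : State} (h : e.eval s ≤ f.eval s)
      (hP : Exec orc P s.tick t) : Exec orc (.ifle e f P Q) s t
  | ifle_false {e f : Expr} {P Q : Prog} {s t : State} (h : ¬ e.eval s ≤ f.eval s)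
      (hQ : Exec orc Q s.tick t) : Exec orc (.ifle e f P Q) s t
  | while_true {e f : Expr} {P : Prog} {s t u : State} (h : e.eval s ≤ f.eval s)
      (hP : Exec orc P s.tick t) (hW : Exec orc (.whilele e f P) t u) :
      Exec orc (.whilele e f P) s u
  | while_false {e f : Expr} {P : Prog} {s : State} (h : ¬ e.eval s ≤ f.eval s) :
      Exec orc (.whilele e f P) s s.tick

/-- One of the two arrays (value and mask) that hold a matrix, with `0` outside of it. -/
def store {m n : ℕ} (A : Matrix (Fin m) (Fin n) (WithBot ℤ)) (g : WithBot ℤ → ℤ) :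
    ℕ → ℕ → ℤ :=
  fun i j => if h : i < m ∧ j < n then g (A ⟨i, h.1⟩ ⟨j, h.2⟩) else 0

/-- The value array of a matrix (`0` at `-∞` entries). -/
def valArray {m n : ℕ} (A : Matrix (Fin m) (Fin n) (WithBot ℤ)) : ℕ → ℕ → ℤ :=
  store A (fun a => a.unbotD 0)

/-- The mask array of a matrix (`1` at finite entries, `0` at `-∞` entries). -/
def maskArray {m n : ℕ} (A : Matrix (Fin m) (Fin n) (WithBot ℤ)) : ℕ → ℕ → ℤ :=
  store A (fun a => if a = ⊥ then 0 else 1)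

/-- The initial state: `m` and `n` are in the variables `0` and `1`, the matrix `A` is in the
arrays `0` (values) and `1` (mask), the matrix `B` is in the arrays `2` and `3`. -/
def input {m n : ℕ} (A B : Matrix (Fin m) (Fin n) (WithBot ℤ)) : State where
  vars := fun x => match x with
    | 0 => (m : ℤ)
    | 1 => (n : ℤ)
    | _ => 0
  arr := fun a => match a with
    | 0 => valArray A
    | 1 => maskArray A
    | 2 => valArray B
    | 3 => maskArray B
    | _ => fun _ _ => 0
  out := []
  calls := []
  steps := 0

/-! ### Output format -/

/-- A closed interval with rational or infinite ends, given by four integers: the ends are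
`loNum / loDen` and `hiNum / hiDen`, and a denominator `0` stands for an infinite end. -/
structure Interval where
  loNum : ℤ
  loDen : ℤ
  hiNum : ℤ
  hiDen : ℤ

def Interval.code (I : Interval) : List ℤ := [I.loNum, I.loDen, I.hiNum, I.hiDen]

def Interval.toSet (I : Interval) : Set ℝ :=
  {x | (I.loNum : ℝ) ≤ I.loDen * x ∧ (I.hiDen : ℝ) * x ≤ I.hiNum}

/-- The integers `out` list, from left to right, finitely many nonempty pairwise disjoint closed
intervals whose union is `S`. -/
def Identifies (out : List ℤ) (S : Set ℝ) : Prop :=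
  ∃ L : List Interval, out = L.flatMap Interval.code ∧
    (∀ I ∈ L, 0 ≤ I.loDen ∧ 0 ≤ I.hiDen ∧ I.toSet.Nonempty) ∧
    L.Pairwise (fun I J => ∀ x ∈ I.toSet, ∀ y ∈ J.toSet, x < y) ∧
    S = {x | ∃ I ∈ L, x ∈ I.toSet}

end MaxPlus

end

/-! The equation `A x = λ + B x` is the pair of inequalities `A x ≤ λ + B x` and `B x ≤ -λ + A x`,
that is, a system `C x ≤ θ + D x` with `2m` rows, where `θ` is `λ` on the upper half and `-λ` on the
lower half. Everything rests on one fact about such systems (`Solv.transfer`). Given a solution,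
choose for each row an index that attains the maximum of `D x` on the support. This leaves a system
of difference constraints, which is solvable as soon as its elementary cycles have nonnegative
weight. An elementary cycle uses each row at most once, so its weight is an integer `a` plus the sum
of `θ` over at most `κ` distinct rows. Hence a solution for `θ` yields one for `θ'` whenever all
these inequalities survive the change.

Two consequences follow. For the spectrum, the inequalities read `a + k λ ≥ 0` with `|k| ≤ κ` and
`|a| ≤ 2Mκ` (`spec_transfer`). Membership of `λ` can thus change only at fractions of denominator at
most `κ` in `[-2Mκ, 2Mκ]`: between two consecutive Farey fractions, or beyond `±2Mκ`, the spectrum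
contains everything or nothing (`spec_between`, `spec_above`, `spec_below`), and it contains the
finite ends of every such piece that it meets. For games, `r(C♯D) ≥ 0` if and only if `C x ≤ D x`
has a nontrivial solution (`specRad_nonneg_iff`). One direction uses the integrality of `a`; the
other takes the limit of discounted values as the discount vanishes. Clearing the denominator of `λ
= p/q` makes each membership question one game with `2m` and `n` nodes (`solv_pairGame_iff`).

The algorithm walks through the Farey fractions from left to right and tests each fraction and the
mediant with its successor. Consecutive fractions differ by at least `1/κ²`, so an interval of
length `N` costs at most `2Nκ² + 1` tests. In general `N = 4Mκ` and two more tests settle the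
unbounded rays. Without `-∞` columns the spectrum lies in an interval of length `ℓ` given by the
maxima of `B♯A0` and `A♯B0` (`IsResidMax.le_of_mem_spec`), and no ray has to be tested. Without an
oracle, each game is decided by the alternating method, which lowers an integer vector from `0`
until it is stable or reaches a pseudo-polynomial depth (`alternate_runs`).

The programs are verified in a small Hoare logic for total correctness with step counts (`Runs`),
combined with a syntactic frame rule (`Exec.frame`). -/

noncomputable section

namespace MaxPlus

/-! ### Systems of difference constraints -/

section Potential

variable {J ι : Type*}

open Classical in
/-- One step of the Bellman-Ford iteration for the constraints `x j ≤ w i j + x (σ i)`. -/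
def relax (σ : ι → J) (E : ι → J → Prop) (w : ι → J → ℝ) (x : J → ℝ) (j : J) : ℝ :=
  ⨅ o : Option ι, o.elim (x j) (fun i => if E i j then w i j + x (σ i) else x j)

variable [Finite ι] {σ : ι → J} {E : ι → J → Prop} {w : ι → J → ℝ}

theorem relax_le_self (x : J → ℝ) (j : J) : relax σ E w x j ≤ x j :=
  ciInf_le (Set.finite_range _).bddBelow (none : Option ι)

theorem relax_le_edge (x : J → ℝ) {i : ι} {j : J} (h : E i j) :
    relax σ E w x j ≤ w i j + x (σ i) := by
  refine (ciInf_le (Set.finite_range _).bddBelow (some i)).trans ?_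
  simp [h]

theorem exists_edge_of_relax_lt {x : J → ℝ} {j : J} (h : relax σ E w x j < x j) :
    ∃ i, E i j ∧ relax σ E w x j = w i j + x (σ i) := by
  classical
  obtain ⟨o, ho⟩ := exists_eq_ciInf_of_finite
    (f := fun o : Option ι => o.elim (x j) (fun i => if E i j then w i j + x (σ i) else x j))
  change _ = relax σ E w x j at ho
  cases o with
  | none => simp only [Option.elim] at ho; exact absurd ho.symm h.ne
  | some i =>
    by_cases hE : E i j
    · exact ⟨i, hE, by simpa [hE] using ho.symm⟩
    · simp only [Option.elim, hE, if_false] at ho; exact absurd ho.symm h.ne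

/-- A strict decrease in one round must come from a strict decrease of the successor vertex in the
round before, since otherwise the same edge would already have forced the smaller value. Unrolling
this gives a walk along which every vertex decreases strictly. -/
theorem exists_chain (z : ℕ → J → ℝ) (hz : ∀ k, z (k + 1) = relax σ E w (z k)) (K : ℕ) :
    ∀ j, z (K + 1) j < z K j → ∃ (js : ℕ → J) (is : ℕ → ι), js 0 = j ∧ ∀ t ≤ K,
      E (is t) (js t) ∧ js (t + 1) = σ (is t) ∧
      z (K + 1 - t) (js t) = w (is t) (js t) + z (K - t) (js (t + 1)) ∧
      z (K + 1 - t) (js t) < z (K - t) (js t) := by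
  induction K with
  | zero =>
    intro j hj
    obtain ⟨i, hE, hi⟩ := exists_edge_of_relax_lt (σ := σ) (E := E) (w := w) (x := z 0) (j := j)
      (by rwa [hz 0] at hj)
    refine ⟨fun t => Nat.casesOn t j (fun _ => σ i), fun _ => i, rfl, ?_⟩
    intro t ht
    obtain rfl : t = 0 := by omega
    exact ⟨hE, rfl, by simpa [hz 0] using hi, by simpa using hj⟩
  | succ K ih =>
    intro j hj
    obtain ⟨i, hE, hi⟩ := exists_edge_of_relax_lt (σ := σ) (E := E) (w := w) (x := z (K + 1))
      (j := j) (by rwa [hz (K + 1)] at hj)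
    rw [← hz (K + 1)] at hi
    have hlt : z (K + 1) (σ i) < z K (σ i) := by
      by_contra hcon
      have h1 : z (K + 1) j ≤ w i j + z K (σ i) := by
        rw [hz K]; exact relax_le_edge _ hE
      rw [not_lt] at hcon
      linarith
    obtain ⟨js, is, h0, hch⟩ := ih _ hlt
    refine ⟨fun t => Nat.casesOn t j js, fun t => Nat.casesOn t i is, rfl, ?_⟩
    intro t ht
    cases t with
    | zero => exact ⟨hE, h0, by simpa [h0] using hi, by simpa using hj⟩
    | succ t =>
      have h := hch t (by omega)
      have e1 : K + 1 + 1 - (t + 1) = K + 1 - t := by omega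
      have e2 : K + 1 - (t + 1) = K - t := by omega
      simp only [e1, e2]
      exact h

/-- A system of difference constraints is solvable if its elementary cycles are nonnegative. -/
theorem exists_potential [Fintype J] (σ : ι → J) (E : ι → J → Prop) (w : ι → J → ℝ)
    (h : ∀ (L : ℕ) (js : ℕ → J) (is : ℕ → ι), 0 < L → L ≤ Fintype.card J →
      (∀ t < L, E (is t) (js t)) → (∀ t < L, js (t + 1) = σ (is t)) → js L = js 0 →
      Set.InjOn is (Set.Iio L) → 0 ≤ ∑ t ∈ Finset.range L, w (is t) (js t)) :
    ∃ y : J → ℝ, ∀ i j, E i j → y j ≤ w i j + y (σ i) := by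
  classical
  let z : ℕ → J → ℝ := fun k => (relax σ E w)^[k] 0
  have hz : ∀ k, z (k + 1) = relax σ E w (z k) := fun k => Function.iterate_succ_apply' _ _ _
  have hanti : ∀ j, Antitone fun k => z k j := fun j =>
    antitone_nat_of_succ_le fun k => by rw [hz k]; exact relax_le_self _ _
  set N := Fintype.card J with hN
  by_cases hst : ∀ j, z N j ≤ z (N + 1) j
  · refine ⟨z N, fun i j hE => (hst j).trans ?_⟩
    rw [hz N]; exact relax_le_edge _ hE
  -- If round `N + 1` still changes something, the chain of decreases visits `N + 1` vertices, so it
  -- closes a cycle. A shortest one is shown to have negative weight.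
  exfalso
  push Not at hst
  obtain ⟨j, hj⟩ := hst
  obtain ⟨js, is, -, hch⟩ := exists_chain z hz N j hj
  have hex : ∃ L, 0 < L ∧ ∃ a, a + L ≤ N ∧ js (a + L) = js a := by
    obtain ⟨a, b, hab, he⟩ := Fintype.exists_ne_map_eq_of_card_lt
      (fun t : Fin (N + 1) => js t) (by simp [hN])
    rcases lt_or_gt_of_ne hab with hlt | hlt
    · refine ⟨b - a, by omega, a, by omega, ?_⟩
      have e : (a : ℕ) + (b - a) = b := by omega
      rw [e]; exact he.symm
    · refine ⟨a - b, by omega, b, by omega, ?_⟩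
      have e : (b : ℕ) + (a - b) = a := by omega
      rw [e]; exact he
  obtain ⟨hL, a, haL, hcyc⟩ := Nat.find_spec hex
  have hmin : ∀ L' < Nat.find hex, ¬ (0 < L' ∧ ∃ a, a + L' ≤ N ∧ js (a + L') = js a) :=
    fun L' hL' => Nat.find_min hex hL'
  set L := Nat.find hex
  -- The label of an edge determines its target through `σ`, so a repeated label would give a
  -- repeated vertex and a shorter cycle.
  have hinj : ∀ s t, s < t → t < L → is (a + s) ≠ is (a + t) := by
    intro s t hs ht he
    refine hmin (t - s) (by omega) ⟨by omega, a + s + 1, by omega, ?_⟩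
    have e : a + s + 1 + (t - s) = a + t + 1 := by omega
    rw [e, (hch (a + t) (by omega)).2.1, (hch (a + s) (by omega)).2.1, he]
  have hw := h L (fun t => js (a + t)) (fun t => is (a + t)) hL (by omega)
    (fun t ht => (hch (a + t) (by omega)).1) (fun t ht => (hch (a + t) (by omega)).2.1)
    (by simpa using hcyc) (by
      intro s hs t ht he
      rcases lt_trichotomy s t with hlt | heq | hlt
      · exact absurd he (hinj s t hlt ht)
      · exact heq
      · exact absurd he.symm (hinj t s hlt hs))
  have hsum : ∀ l ≤ L, ∑ t ∈ Finset.range l, w (is (a + t)) (js (a + t)) =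
      z (N + 1 - a) (js a) - z (N + 1 - (a + l)) (js (a + l)) := by
    intro l hl
    induction l with
    | zero => simp
    | succ l ih =>
      rw [Finset.sum_range_succ, ih (by omega)]
      have h3 := (hch (a + l) (by omega)).2.2.1
      have e : N + 1 - (a + (l + 1)) = N - (a + l) := by omega
      rw [e, ← add_assoc a l 1]
      linarith
  rw [hsum L le_rfl, hcyc] at hw
  -- The telescoped weight is the difference of two iterates at the same vertex, and it is negative:
  -- the later iterate has strictly decreased.
  have h4 := (hch a (by omega)).2.2.2
  have h5 : z (N - a) (js a) ≤ z (N + 1 - (a + L)) (js a) := hanti (js a) (by omega)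
  linarith

end Potential

/-! ### Solvability of two-sided systems -/

section Solv

variable {ι J : Type*}

/-- The system `C x ≤ θ + D x` has a solution over `ℝ ∪ {-∞}` that is not identically `-∞`; `S` is
the support of the solution. -/
def Solv (C D : Matrix ι J (WithBot ℤ)) (θ : ι → ℝ) : Prop :=
  ∃ (S : Set J) (x : J → ℝ), S.Nonempty ∧ ∀ i, ∀ j ∈ S, ∀ c : ℤ, C i j = c →
    ∃ k ∈ S, ∃ d : ℤ, D i k = d ∧ (c : ℝ) + x j ≤ d + θ i + x k

/-- Fixing a maximizing index `σ i` in each row turns the system into difference constraints on the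
same support. By `exists_potential` only cycles with distinct row labels matter; the set `I` of
labels of such a cycle and the sum `a` of its integer weights are the data in the hypothesis. -/
theorem Solv.transfer [Fintype ι] [Fintype J] {C D : Matrix ι J (WithBot ℤ)} {θ θ' : ι → ℝ}
    (hs : Solv C D θ)
    (h : ∀ (I : Finset ι) (a : ℤ), I.Nonempty → I.card ≤ Fintype.card J →
      (∀ W : ℤ, (∀ i j k c d, C i j = (c : ℤ) → D i k = (d : ℤ) → |d - c| ≤ W) →
        |a| ≤ W * I.card) →
      0 ≤ a + ∑ i ∈ I, θ i → 0 ≤ a + ∑ i ∈ I, θ' i) :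
    Solv C D θ' := by
  classical
  obtain ⟨S, x, hS, hx⟩ := hs
  have hσ : ∀ i, ∃ k, ∀ j ∈ S, ∀ c : ℤ, C i j = c →
      k ∈ S ∧ ∃ d : ℤ, D i k = d ∧ (c : ℝ) + x j ≤ d + θ i + x k := by
    intro i
    by_cases hi : ∃ k ∈ S, D i k ≠ ⊥
    · obtain ⟨k, ⟨hkS, hk⟩, hmax⟩ := Set.exists_max_image {k | k ∈ S ∧ D i k ≠ ⊥}
        (fun k => (((D i k).unbotD 0 : ℤ) : ℝ) + x k) (Set.toFinite _) hi
      refine ⟨k, fun j hj c hc => ⟨hkS, ?_⟩⟩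
      obtain ⟨d, hd⟩ := WithBot.ne_bot_iff_exists.1 hk
      refine ⟨d, hd.symm, ?_⟩
      obtain ⟨k', hk', d', hd', hle⟩ := hx i j hj c hc
      have := hmax k' ⟨hk', by simp [hd']⟩
      simp only [hd', ← hd, WithBot.unbotD_coe] at this
      linarith
    -- With no finite entry of `D` on the support, the row has no finite entry of `C` there either,
    -- so the choice is immaterial.
    · refine ⟨hS.some, fun j hj c hc => ?_⟩
      obtain ⟨k', hk', d', hd', -⟩ := hx i j hj c hc
      exact absurd ⟨k', hk', by simp [hd']⟩ hi
  choose σ hσ using hσ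
  have hW : ∀ i j c, j ∈ S → C i j = (c : ℤ) → ∃ d : ℤ, D i (σ i) = d := by
    intro i j c hj hc
    obtain ⟨-, d, hd, -⟩ := hσ i j hj c hc
    exact ⟨d, hd⟩
  obtain ⟨y, hy⟩ := exists_potential σ (fun i j => j ∈ S ∧ C i j ≠ ⊥)
    (fun i j => (((D i (σ i)).unbotD 0 : ℤ) : ℝ) + θ' i - (((C i j).unbotD 0 : ℤ) : ℝ)) (by
      intro L js is hL hLJ hE hsucc hcyc hinj
      have hinj' : Set.InjOn is (Finset.range L : Set ℕ) := by
        intro s hs t ht; exact hinj (by simpa using hs) (by simpa using ht)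
      have hcard : ((Finset.range L).image is).card = L := by
        rw [Finset.card_image_of_injOn hinj', Finset.card_range]
      have hsplit : ∀ ϑ : ι → ℝ, ∑ t ∈ Finset.range L,
          ((((D (is t) (σ (is t))).unbotD 0 : ℤ) : ℝ) + ϑ (is t) -
            (((C (is t) (js t)).unbotD 0 : ℤ) : ℝ)) =
          ((∑ t ∈ Finset.range L,
            ((D (is t) (σ (is t))).unbotD 0 - (C (is t) (js t)).unbotD 0) : ℤ) : ℝ) +
          ∑ i ∈ (Finset.range L).image is, ϑ i := by
        intro ϑ
        rw [Finset.sum_image hinj']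
        push_cast
        rw [← Finset.sum_add_distrib]
        exact Finset.sum_congr rfl fun t _ => by ring
      rw [hsplit]
      refine h _ _ ?_ (by rw [hcard]; exact hLJ) ?_ ?_
      · exact (Finset.nonempty_range_iff.2 hL.ne').image _
      · intro W hW'
        rw [hcard]
        refine (Finset.abs_sum_le_sum_abs _ _).trans ?_
        have : ∀ t ∈ Finset.range L,
            |(D (is t) (σ (is t))).unbotD 0 - (C (is t) (js t)).unbotD 0| ≤ W := by
          intro t ht
          obtain ⟨hjS, hC⟩ := hE t (by simpa using ht)
          obtain ⟨c, hc⟩ := WithBot.ne_bot_iff_exists.1 hC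
          obtain ⟨d, hd⟩ := hW _ _ c hjS hc.symm
          rw [hd, ← hc]
          exact hW' _ _ _ _ _ hc.symm hd
        refine (Finset.sum_le_card_nsmul _ _ _ this).trans ?_
        simp [mul_comm]
      · rw [← hsplit]
        -- The old solution `x` is a potential for `θ`; its differences cancel around the cycle, so
        -- the weight for `θ` is nonnegative.
        have hle : ∀ t ∈ Finset.range L, x (js t) - x (js (t + 1)) ≤
            (((D (is t) (σ (is t))).unbotD 0 : ℤ) : ℝ) + θ (is t) -
              (((C (is t) (js t)).unbotD 0 : ℤ) : ℝ) := by
          intro t ht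
          have ht' : t < L := by simpa using ht
          obtain ⟨hjS, hC⟩ := hE t ht'
          obtain ⟨c, hc⟩ := WithBot.ne_bot_iff_exists.1 hC
          obtain ⟨-, d, hd, hle⟩ := hσ _ _ hjS c hc.symm
          rw [hd, ← hc, hsucc t ht']
          simp only [WithBot.unbotD_coe]
          linarith
        refine le_trans ?_ (Finset.sum_le_sum hle)
        rw [Finset.sum_range_sub', hcyc, sub_self])
  refine ⟨S, y, hS, fun i j hj c hc => ?_⟩
  obtain ⟨hk, d, hd, -⟩ := hσ i j hj c hc
  refine ⟨σ i, hk, d, hd, ?_⟩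
  have := hy i j ⟨hj, by simp [hc]⟩
  simp only [hc, hd, WithBot.unbotD_coe] at this
  linarith

end Solv

section

open Filter Topology

/-! ### The value of a mean payoff game -/

theorem ent_coe (c : ℤ) : ent (c : WithBot ℤ) = ((c : ℝ) : EReal) := rfl

theorem ereal_eq_of_forall_coe_le {a b : EReal} (h : ∀ r : ℝ, (r : EReal) ≤ a ↔ (r : EReal) ≤ b) :
    a = b := by
  refine le_antisymm ?_ ?_
  · refine le_of_not_gt fun hlt => ?_
    obtain ⟨r, h1, h2⟩ := EReal.lt_iff_exists_real_btwn.1 hlt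
    exact absurd ((h r).1 h2.le) (not_le.2 h1)
  · refine le_of_not_gt fun hlt => ?_
    obtain ⟨r, h1, h2⟩ := EReal.lt_iff_exists_real_btwn.1 hlt
    exact absurd ((h r).2 h2.le) (not_le.2 h1)

section Operators

variable {p q : ℕ} {C D : Matrix (Fin p) (Fin q) (WithBot ℤ)}

/-- Comparing with real thresholds replaces the maximum by an existential over finite entries (and,
for the residual, the minimum by a universal), so that later arguments never compute with infinite
values. -/
theorem coe_le_mulVec_iff [Nonempty (Fin q)] (x : Fin q → EReal) (i : Fin p) (r : ℝ) :
    (r : EReal) ≤ mulVec D x i ↔ ∃ k, ∃ d : ℤ, D i k = d ∧ ((r - d : ℝ) : EReal) ≤ x k := by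
  have key : ∀ (d : ℤ) (y : EReal),
      (r : EReal) ≤ ((d : ℝ) : EReal) + y ↔ ((r - d : ℝ) : EReal) ≤ y := by
    intro d y
    rw [EReal.coe_sub, EReal.sub_le_iff_le_add (Or.inl (EReal.coe_ne_bot _))
      (Or.inl (EReal.coe_ne_top _)), add_comm]
  constructor
  · intro h
    obtain ⟨k, hk⟩ := exists_eq_ciSup_of_finite (f := fun k => ent (D i k) + x k)
    have h' : (r : EReal) ≤ ent (D i k) + x k := by rw [hk]; exact h
    rcases hd : D i k with _ | d
    · rw [hd] at h'
      change (r : EReal) ≤ ⊥ + x k at h'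
      rw [EReal.bot_add] at h'
      exact absurd h' (by simp)
    · refine ⟨k, d, hd, ?_⟩
      rw [hd] at h'
      exact (key d _).1 h'
  · rintro ⟨k, d, hd, h⟩
    refine le_trans ?_ (le_iSup (fun k => ent (D i k) + x k) k)
    simp only [hd, ent_coe]
    exact (key d _).2 h

theorem coe_le_resid_iff (y : Fin p → EReal) (j : Fin q) (r : ℝ) :
    (r : EReal) ≤ resid C y j ↔ ∀ i, ∀ c : ℤ, C i j = c → ((c + r : ℝ) : EReal) ≤ y i := by
  have key : ∀ (c : ℤ) (y : EReal),
      (r : EReal) ≤ y - ((c : ℝ) : EReal) ↔ ((c + r : ℝ) : EReal) ≤ y := by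
    intro c y
    rw [EReal.le_sub_iff_add_le (Or.inl (EReal.coe_ne_bot _)) (Or.inl (EReal.coe_ne_top _)),
      ← EReal.coe_add, add_comm]
  simp only [resid, le_iInf_iff]
  constructor
  · intro h i c hc
    have := h i (by simp [hc])
    rw [hc, ent_coe] at this
    exact (key c _).1 this
  · intro h i hi
    obtain ⟨c, hc⟩ := WithBot.ne_bot_iff_exists.1 hi
    rw [← hc, ent_coe]
    exact (key c _).2 (h i c hc.symm)

theorem coe_le_resid_mulVec_iff (x : Fin q → EReal) (j : Fin q) (r : ℝ) :
    (r : EReal) ≤ resid C (mulVec D x) j ↔ ∀ i, ∀ c : ℤ, C i j = c →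
      ∃ k, ∃ d : ℤ, D i k = d ∧ ((c + r - d : ℝ) : EReal) ≤ x k := by
  have : Nonempty (Fin q) := ⟨j⟩
  simp only [coe_le_resid_iff, coe_le_mulVec_iff]

theorem mulVec_mono : Monotone (mulVec D) := fun _ _ h _ =>
  iSup_mono fun j => add_le_add le_rfl (h j)

theorem resid_mono : Monotone (resid C) := fun _ _ h _ =>
  iInf_mono fun i => iInf_mono fun _ => EReal.sub_le_sub (h i) le_rfl

/-- Addition on `EReal` fails to be continuous only where opposite infinities meet. Finite entries
of `D` avoid this, and an entry `⊥` contributes the constant `⊥`. -/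
theorem tendsto_mulVec {α : Type*} {l : Filter α} {u : α → Fin q → EReal} {x : Fin q → EReal}
    (h : ∀ k, Tendsto (fun a => u a k) l (𝓝 (x k))) (i : Fin p) :
    Tendsto (fun a => mulVec D (u a) i) l (𝓝 (mulVec D x i)) := by
  simp only [mulVec, ← Finset.sup_univ_eq_iSup]
  refine Filter.Tendsto.finset_sup_nhds_apply fun k _ => ?_
  rcases D i k with _ | d
  · change Tendsto (fun a => ⊥ + u a k) l (𝓝 (⊥ + x k))
    simp only [EReal.bot_add]
    exact tendsto_const_nhds
  · change Tendsto (fun a => ((d : ℝ) : EReal) + u a k) l (𝓝 (((d : ℝ) : EReal) + x k))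
    exact (EReal.continuousAt_add (p := (((d : ℝ) : EReal), x k)) (Or.inl (EReal.coe_ne_top _))
      (Or.inl (EReal.coe_ne_bot _))).tendsto.comp (tendsto_const_nhds.prodMk_nhds (h k))

theorem tendsto_resid {α : Type*} {l : Filter α} {u : α → Fin p → EReal} {y : Fin p → EReal}
    (h : ∀ i, Tendsto (fun a => u a i) l (𝓝 (y i))) (j : Fin q) :
    Tendsto (fun a => resid C (u a) j) l (𝓝 (resid C y j)) := by
  simp only [resid, ← Finset.inf_univ_eq_iInf]
  refine Filter.Tendsto.finset_inf_nhds_apply fun i _ => ?_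
  by_cases hi : C i j = ⊥
  · simp only [hi, ne_eq, not_true_eq_false, iInf_false]
    exact tendsto_const_nhds
  · obtain ⟨c, hc⟩ := WithBot.ne_bot_iff_exists.1 hi
    simp only [ne_eq, hi, not_false_eq_true, iInf_true]
    simp only [← hc, ent_coe, sub_eq_add_neg, ← EReal.coe_neg]
    exact (EReal.continuousAt_add (p := (y i, ((-c : ℝ) : EReal))) (Or.inr (EReal.coe_ne_bot _))
      (Or.inr (EReal.coe_ne_top _))).tendsto.comp ((h i).prodMk_nhds tendsto_const_nhds)

/-! ### Nonnegative eigenvalues by vanishing discount -/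

theorem exists_entriesBounded (A : Matrix (Fin p) (Fin q) (WithBot ℤ)) :
    ∃ W : ℕ, EntriesBounded A W := by
  refine ⟨Finset.univ.sup fun i => Finset.univ.sup fun j => ((A i j).unbotD 0).natAbs, ?_⟩
  intro i j z hz
  have h1 : ((A i j).unbotD 0).natAbs ≤
      Finset.univ.sup fun j => ((A i j).unbotD 0).natAbs :=
    Finset.le_sup (f := fun j => ((A i j).unbotD 0).natAbs) (Finset.mem_univ j)
  have h2 := h1.trans (Finset.le_sup
    (f := fun i => Finset.univ.sup fun j => ((A i j).unbotD 0).natAbs) (Finset.mem_univ i))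
  rw [hz, WithBot.unbotD_coe] at h2
  rw [Int.abs_eq_natAbs]
  exact_mod_cast h2

/-- The discounted operator, truncated to `[-R, R]`, is monotone on a complete lattice and has a
least fixed point by Knaster–Tarski. The radius satisfies `α R + 2 W = R`, so the operator maps
vectors with values in `[-R, R]` to such vectors and the truncation is inactive. -/
theorem exists_discounted (hC : NoBotCol C) (hD : NoBotRow D) {W : ℕ} (hCW : EntriesBounded C W)
    (hDW : EntriesBounded D W) {α : ℝ} (h0 : 0 ≤ α) (h1 : α < 1) :
    ∃ v : Fin q → ℝ, (∀ k, |v k| ≤ 2 * W / (1 - α)) ∧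
      ∀ j, resid C (mulVec D (fun k => ((α * v k : ℝ) : EReal))) j = (v j : EReal) := by
  set R : ℝ := 2 * W / (1 - α) with hR
  have h1' : 0 < 1 - α := by linarith
  have hRW : R - α * R = 2 * W := by rw [hR]; field_simp
  have hR0 : 0 ≤ R := by positivity
  have hα : (0 : EReal) ≤ (α : EReal) := by exact_mod_cast h0
  let H : (Fin q → EReal) →o (Fin q → EReal) :=
    { toFun := fun x j => max ((-R : ℝ) : EReal)
        (min (R : EReal) (resid C (mulVec D (fun k => (α : EReal) * x k)) j))
      monotone' := fun x y hxy j => max_le_max le_rfl (min_le_min le_rfl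
        (resid_mono (mulVec_mono fun k => mul_le_mul_of_nonneg_left (hxy k) hα) j)) }
  set u := H.lfp with hu
  have hfix : ∀ j, u j = max ((-R : ℝ) : EReal)
      (min (R : EReal) (resid C (mulVec D (fun k => (α : EReal) * u k)) j)) := fun j =>
    (congrFun H.map_lfp j).symm
  have hlo : ∀ j, ((-R : ℝ) : EReal) ≤ u j := fun j => by rw [hfix j]; exact le_max_left _ _
  have hhi : ∀ j, u j ≤ (R : EReal) := fun j => by
    rw [hfix j]
    refine max_le ?_ (min_le_left _ _)
    exact_mod_cast (by linarith : -R ≤ R)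
  have hreal : ∀ j, ∃ r : ℝ, u j = (r : EReal) := fun j => by
    refine ⟨(u j).toReal, (EReal.coe_toReal ?_ ?_).symm⟩
    · exact ((hhi j).trans_lt (EReal.coe_lt_top R)).ne
    · exact ((EReal.bot_lt_coe _).trans_le (hlo j)).ne'
  choose v hv using hreal
  have hvlo : ∀ j, -R ≤ v j := fun j => by have := hlo j; rw [hv j] at this; exact_mod_cast this
  have hvhi : ∀ j, v j ≤ R := fun j => by have := hhi j; rw [hv j] at this; exact_mod_cast this
  have hbd : ∀ {i j k} {c d : ℤ}, C i j = c → D i k = d → |(d : ℝ) - c| ≤ 2 * W := by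
    intro i j k c d hc hd
    have e1 := hCW i j c hc
    have e2 := hDW i k d hd
    have e3 : |d - c| ≤ 2 * (W : ℤ) := (abs_sub _ _).trans (by linarith)
    exact_mod_cast e3
  refine ⟨v, fun k => abs_le.2 ⟨hvlo k, hvhi k⟩, fun j => ?_⟩
  have hfun : (fun k => (α : EReal) * u k) = fun k => ((α * v k : ℝ) : EReal) := by
    funext k; rw [hv k, EReal.coe_mul]
  have hj := hfix j
  rw [hfun, hv j] at hj
  rw [hj]
  have hge : ((-R : ℝ) : EReal) ≤ resid C (mulVec D (fun k => ((α * v k : ℝ) : EReal))) j := by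
    rw [coe_le_resid_mulVec_iff]
    intro i c hc
    obtain ⟨k, hk⟩ := hD i
    obtain ⟨d, hd⟩ := WithBot.ne_bot_iff_exists.1 hk
    refine ⟨k, d, hd.symm, ?_⟩
    have e := abs_le.1 (hbd hc hd.symm)
    have e2 := mul_le_mul_of_nonneg_left (hvlo k) h0
    exact_mod_cast (by linarith : (c : ℝ) + -R - d ≤ α * v k)
  have hle : resid C (mulVec D (fun k => ((α * v k : ℝ) : EReal))) j ≤ (R : EReal) := by
    refine le_of_not_gt fun hlt => ?_
    obtain ⟨r, hr1, hr2⟩ := EReal.lt_iff_exists_real_btwn.1 hlt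
    obtain ⟨i, hi⟩ := hC j
    obtain ⟨c, hc⟩ := WithBot.ne_bot_iff_exists.1 hi
    obtain ⟨k, d, hd, hle⟩ := (coe_le_resid_mulVec_iff _ _ _).1 hr2.le i c hc.symm
    have e := abs_le.1 (hbd hc.symm hd)
    have e2 := mul_le_mul_of_nonneg_left (hvhi k) h0
    have e3 : (c : ℝ) + r - d ≤ α * v k := by exact_mod_cast hle
    have e4 : R < r := by exact_mod_cast hr1
    linarith
  rw [min_eq_right hle, max_eq_right hge]

/-- A comparison principle: let `h` be the maximal excess over `v` of the solution, normalized to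
have maximum `0` on its support. Applying the discounted operator gives `h ≤ α h`, hence `h ≤ 0`,
and at the maximizing index this reads `0 ≤ v j₀`. -/
theorem Solv.le_discounted (hs : Solv C D 0) {α : ℝ} (h0 : 0 ≤ α) (h1 : α < 1) {v : Fin q → ℝ}
    (hv : ∀ j, resid C (mulVec D (fun k => ((α * v k : ℝ) : EReal))) j = (v j : EReal)) :
    ∃ j, 0 ≤ v j := by
  obtain ⟨S, x, hS, hx⟩ := hs
  obtain ⟨j₀, hj₀, hmax⟩ := Set.exists_max_image S x (Set.toFinite S) hS
  obtain ⟨j, hj, hjmax⟩ := Set.exists_max_image S (fun j => x j - x j₀ - v j) (Set.toFinite S) hS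
  set h := x j - x j₀ - v j with hh
  refine ⟨j₀, ?_⟩
  have h2 : h ≤ 0 := by
    have : ((x j - x j₀ - α * h : ℝ) : EReal) ≤ v j := by
      rw [← hv j, coe_le_resid_mulVec_iff]
      intro i c hc
      obtain ⟨k, hk, d, hd, hle⟩ := hx i j hj c hc
      refine ⟨k, d, hd, ?_⟩
      have e1 : x k - x j₀ - v k ≤ h := hjmax k hk
      have e2 := mul_le_mul_of_nonneg_left e1 h0
      have e3 : (x k - x j₀) * (1 - α) ≤ 0 :=
        mul_nonpos_of_nonpos_of_nonneg (by linarith [hmax k hk]) (by linarith)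
      simp only [Pi.zero_apply] at hle
      exact_mod_cast (by nlinarith : (c : ℝ) + (x j - x j₀ - α * h) - d ≤ α * v k)
    have e : x j - x j₀ - α * h ≤ v j := by exact_mod_cast this
    by_contra hcon
    nlinarith
  have : x j₀ - x j₀ - v j₀ ≤ h := hjmax j₀ hj₀
  linarith

/-- Let `v` be the discounted fixed point for `α = 1 - 1/(N+1)` and `m` its largest entry. As `N`
grows, limits of `v - m` and of `m/(N+1)` give an eigenvector up to translation and its eigenvalue,
which is nonnegative because `m ≥ 0` by the comparison with the given solution. -/
theorem Solv.exists_eigenvector (hC : NoBotCol C) (hD : NoBotRow D) (hs : Solv C D 0) :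
    ∃ lam : ℝ, 0 ≤ lam ∧ ∃ x : Fin q → EReal, IsNontrivial x ∧
      ∀ j, resid C (mulVec D x) j = (lam : EReal) + x j := by
  obtain ⟨W₁, hW₁⟩ := exists_entriesBounded C
  obtain ⟨W₂, hW₂⟩ := exists_entriesBounded D
  have hq : Nonempty (Fin q) := by
    obtain ⟨S, x, ⟨j, -⟩, -⟩ := hs
    exact ⟨j⟩
  set W := max W₁ W₂
  have hCW : EntriesBounded C W := fun i j z hz =>
    (hW₁ i j z hz).trans (by exact_mod_cast le_max_left _ _)
  have hDW : EntriesBounded D W := fun i j z hz =>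
    (hW₂ i j z hz).trans (by exact_mod_cast le_max_right _ _)
  have hα0 : ∀ N : ℕ, (0 : ℝ) ≤ 1 - 1 / (N + 1) := fun N => by
    have : (1 : ℝ) / (N + 1) ≤ 1 := by
      rw [div_le_one (by positivity)]; linarith [Nat.cast_nonneg (α := ℝ) N]
    linarith
  have hα1 : ∀ N : ℕ, (1 : ℝ) - 1 / (N + 1) < 1 := fun N => by
    have : (0 : ℝ) < 1 / (N + 1) := by positivity
    linarith
  choose v hvR hv using fun N : ℕ => exists_discounted hC hD hCW hDW (hα0 N) (hα1 N)
  have hvR' : ∀ N k, |v N k| ≤ 2 * W * (N + 1) := fun N k => by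
    have := hvR N k
    have e : (1 : ℝ) - (1 - 1 / (N + 1)) = 1 / (N + 1) := by ring
    rwa [e, div_div_eq_mul_div, div_one] at this
  choose top htop using fun N => Finite.exists_max (v N)
  set m : ℕ → ℝ := fun N => v N (top N) with hm
  have hm0 : ∀ N, 0 ≤ m N := fun N => by
    obtain ⟨j, hj⟩ := hs.le_discounted (hα0 N) (hα1 N) (hv N)
    exact hj.trans (htop N j)
  -- Every function into a compact space converges along an ultrafilter, so all the limits exist
  -- simultaneously without extracting subsequences.
  set l : Ultrafilter ℕ := hyperfilter ℕ with hl
  have hlat : (l : Filter ℕ) ≤ atTop := by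
    rw [← Nat.cofinite_eq_atTop]; exact hyperfilter_le_cofinite
  -- limits of the normalized vectors and of the normalized maximum
  have hUex : ∀ k, ∃ y : EReal, Tendsto (fun N => ((v N k - m N : ℝ) : EReal)) l (𝓝 y) :=
    fun k => ⟨_, (l.map fun N => ((v N k - m N : ℝ) : EReal)).le_nhds_lim⟩
  choose U hU using hUex
  obtain ⟨lam, hlam⟩ : ∃ lam : ℝ, Tendsto (fun N : ℕ => m N / (N + 1)) l (𝓝 lam) := by
    obtain ⟨lam, -, h⟩ := (isCompact_Icc (a := (0 : ℝ)) (b := 2 * W)).ultrafilter_le_nhds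
      (l.map fun N : ℕ => m N / (N + 1)) (by
        rw [le_principal_iff]
        refine Filter.Eventually.of_forall (f := (l : Filter ℕ)) fun N : ℕ => ?_
        have hN : (0 : ℝ) < N + 1 := by positivity
        exact ⟨div_nonneg (hm0 N) hN.le, (div_le_iff₀ hN).2 ((le_abs_self _).trans (hvR' N _))⟩)
    exact ⟨lam, h⟩
  have hlam0 : 0 ≤ lam := ge_of_tendsto hlam
    (Filter.Eventually.of_forall fun N => div_nonneg (hm0 N) (by positivity))
  have hU0 : ∀ k, U k ≤ 0 := fun k => le_of_tendsto (hU k)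
    (Filter.Eventually.of_forall fun N => by
      exact_mod_cast (by linarith [htop N k] : v N k - m N ≤ 0))
  have hcase : ∀ k, U k = ⊥ ∨ ∃ r : ℝ, U k = (r : EReal) := fun k => by
    by_cases h : U k = ⊥
    · exact Or.inl h
    · exact Or.inr ⟨_, (EReal.coe_toReal ((hU0 k).trans_lt (by simp)).ne h).symm⟩
  -- The correction `v k/(N+1)` tends to the limit of `m/(N+1)` where `U k` is finite. Where `U k =
  -- ⊥` it is only known to be bounded below by `-2W`, which suffices.
  have hlim : ∀ k, Tendsto (fun N : ℕ => ((v N k - m N - v N k / (N + 1) : ℝ) : EReal)) l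
      (𝓝 (U k - lam)) := by
    intro k
    have hUk' := hU k
    rcases hcase k with hUk | ⟨r, hUk⟩ <;> rw [hUk] at hUk' ⊢
    · have hUb := hUk'
      rw [sub_eq_add_neg, EReal.bot_add]
      rw [EReal.tendsto_nhds_bot_iff_real] at hUb ⊢
      intro b
      filter_upwards [hUb (b - 2 * W)] with N hN
      have e1 : v N k - m N < b - 2 * W := by exact_mod_cast hN
      have e2 : -(2 * (W : ℝ)) ≤ v N k / (N + 1) := by
        rw [le_div_iff₀ (by positivity)]
        have := (abs_le.1 (hvR' N k)).1
        linarith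
      exact_mod_cast (by linarith : v N k - m N - v N k / (N + 1) < b)
    · have hUr := hUk'
      rw [EReal.tendsto_coe] at hUr
      rw [← EReal.coe_sub, EReal.tendsto_coe]
      have hinv : Tendsto (fun N : ℕ => 1 / ((N : ℝ) + 1)) l (𝓝 0) :=
        tendsto_one_div_add_atTop_nhds_zero_nat.mono_left hlat
      have h3 := (hUr.sub (hUr.mul hinv)).sub hlam
      rw [mul_zero, sub_zero] at h3
      refine h3.congr fun N => ?_
      have : ((N : ℝ) + 1) ≠ 0 := by positivity
      field_simp
      ring
  -- The fixed point equation translated by `m`, with `α v` written as `v - v/(N+1)`.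
  have heq : ∀ N j, resid C (mulVec D
      (fun k => ((v N k - m N - v N k / (N + 1) : ℝ) : EReal))) j =
        ((v N j - m N : ℝ) : EReal) := by
    intro N j
    refine ereal_eq_of_forall_coe_le fun r => ?_
    have h3 := coe_le_resid_mulVec_iff (C := C) (D := D)
      (fun k => (((1 - 1 / ((N : ℝ) + 1)) * v N k : ℝ) : EReal)) j (r + m N)
    rw [hv N j] at h3
    have h4 : (r : EReal) ≤ ((v N j - m N : ℝ) : EReal) ↔
        ((r + m N : ℝ) : EReal) ≤ (v N j : EReal) := by
      rw [EReal.coe_le_coe_iff, EReal.coe_le_coe_iff, le_sub_iff_add_le]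
    rw [h4, h3, coe_le_resid_mulVec_iff]
    refine forall_congr' fun i => forall_congr' fun c => forall_congr' fun hc =>
      exists_congr fun k => exists_congr fun d => and_congr_right fun hd => ?_
    rw [EReal.coe_le_coe_iff, EReal.coe_le_coe_iff]
    have : (1 - 1 / ((N : ℝ) + 1)) * v N k = v N k - v N k / (N + 1) := by ring
    rw [this]
    constructor <;> intro h <;> linarith
  refine ⟨lam, hlam0, fun k => U k - lam, ⟨fun k => ?_, ?_⟩, fun j => ?_⟩
  · have : U k ≠ ⊤ := ((hU0 k).trans_lt (by simp)).ne
    change U k - (lam : EReal) ≠ ⊤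
    rw [sub_eq_add_neg, ← EReal.coe_neg]
    exact EReal.add_ne_top this (EReal.coe_ne_top _)
  · by_contra hcon
    push Not at hcon
    have hbot : ∀ k, U k = ⊥ := fun k => by
      have := hcon k
      rw [sub_eq_add_neg, ← EReal.coe_neg, EReal.add_eq_bot_iff] at this
      exact this.resolve_right (EReal.coe_ne_bot _)
    -- The largest entry of `v - m` is exactly `0` for each `N`, so not all entries can tend to `⊥`.
    have hev : ∀ᶠ N in (l : Filter ℕ), ∀ k, ((v N k - m N : ℝ) : EReal) < 0 := by
      rw [eventually_all]
      intro k
      exact (hU k).eventually_lt_const (by rw [hbot k]; simp)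
    obtain ⟨N, hN⟩ := hev.exists
    have := hN (top N)
    simp [hm] at this
  · have h3 := tendsto_resid (C := C) (fun i => tendsto_mulVec (D := D) hlim i) j
    have h4 := hU j
    simp only [heq] at h3
    rw [tendsto_nhds_unique h3 h4]
    change U j = (lam : EReal) + (U j - (lam : EReal))
    rcases hcase j with hUj | ⟨r, hUj⟩ <;> rw [hUj]
    · rw [sub_eq_add_neg, EReal.bot_add, EReal.add_bot]
    · rw [← EReal.coe_sub, ← EReal.coe_add]
      congr 1
      ring

theorem solv_of_eigenvector {lam : ℝ} {x : Fin q → EReal} (hx : IsNontrivial x)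
    (h : ∀ j, resid C (mulVec D x) j = (lam : EReal) + x j) : Solv C D (fun _ => -lam) := by
  refine ⟨{j | x j ≠ ⊥}, fun j => (x j).toReal, hx.2, fun i j hj c hc => ?_⟩
  have hxj : ((x j).toReal : EReal) = x j := EReal.coe_toReal (hx.1 j) hj
  have h1 : ((lam + (x j).toReal : ℝ) : EReal) ≤ resid C (mulVec D x) j := by
    rw [h j, EReal.coe_add, hxj]
  obtain ⟨k, d, hd, hle⟩ := (coe_le_resid_mulVec_iff _ _ _).1 h1 i c hc
  have hk : x k ≠ ⊥ := ((EReal.bot_lt_coe _).trans_le hle).ne'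
  refine ⟨k, hk, d, hd, ?_⟩
  rw [← EReal.coe_toReal (hx.1 k) hk] at hle
  have : (c : ℝ) + (lam + (x j).toReal) - d ≤ (x k).toReal := by exact_mod_cast hle
  linarith

/-- The supremum need not be known to be attained: an eigenvalue slightly below `0` already gives a
solution for `θ = 0`, because the cycle weights are integers. -/
theorem specRad_nonneg_iff (hC : NoBotCol C) (hD : NoBotRow D) :
    0 ≤ specRad (fun x => resid C (mulVec D x)) ↔ Solv C D 0 := by
  constructor
  · intro h
    -- With at most `q` rows on a cycle and `lam > -1/(q+1)`, the inequality `a ≥ |I| lam` forces `a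
    -- > -1`, hence `a ≥ 0`.
    have hε : (0 : ℝ) < 1 / (q + 1) := by positivity
    have hlt : ((-(1 / ((q : ℝ) + 1)) : ℝ) : EReal) <
        specRad (fun x => resid C (mulVec D x)) :=
      lt_of_lt_of_le (by exact_mod_cast (by linarith : -(1 / ((q : ℝ) + 1)) < 0)) h
    obtain ⟨r, ⟨lam, rfl, x, hx, hf⟩, hlam⟩ := lt_sSup_iff.1 hlt
    have hlam' : -(1 / ((q : ℝ) + 1)) < lam := by exact_mod_cast hlam
    refine (solv_of_eigenvector hx hf).transfer ?_
    intro I a hI hcard _ h0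
    rw [Finset.sum_const, nsmul_eq_mul] at h0
    rw [Fintype.card_fin] at hcard
    have h1 : (I.card : ℝ) ≤ q := by exact_mod_cast hcard
    have hI0 : (0 : ℝ) < I.card := by exact_mod_cast hI.card_pos
    have h2 : (-1 : ℝ) < a := by
      have e1 : (I.card : ℝ) * (1 / (q + 1)) < 1 := by
        rw [mul_one_div, div_lt_one (by positivity)]; linarith
      nlinarith
    have h3 : (-1 : ℤ) < a := by exact_mod_cast h2
    have h4 : (0 : ℤ) ≤ a := by omega
    simpa using h4
  · intro h
    obtain ⟨lam, h0, x, hx, hf⟩ := h.exists_eigenvector hC hD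
    exact le_trans (by exact_mod_cast h0) (le_sSup ⟨lam, rfl, x, hx, hf⟩)

end Operators

theorem Game.value_nonneg_iff {G : Game} (hG : G.Valid) : 0 ≤ G.value ↔ Solv G.A G.B 0 :=
  specRad_nonneg_iff hG.1 hG.2

end

/-! ### The spectrum and two-sided systems -/

section Spectrum

variable {m n : ℕ} {A B : Matrix (Fin m) (Fin n) (WithBot ℤ)}

/-- The vector `(t, …, t, -t, …, -t)`. -/
def plusMinus {R : Type*} [Neg R] (m : ℕ) (t : R) : Fin (m + m) → R :=
  Fin.append (fun _ => t) (fun _ => -t)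

/-- The matrix with the rows of `X` on top of the rows of `Y`. -/
def stack {p q : ℕ} {J R : Type*} (X : Matrix (Fin p) J R) (Y : Matrix (Fin q) J R) :
    Matrix (Fin (p + q)) J R :=
  fun i j => Fin.addCases (fun i => X i j) (fun i => Y i j) i

theorem stack_castAdd {p q : ℕ} {J R : Type*} (X : Matrix (Fin p) J R) (Y : Matrix (Fin q) J R)
    (i : Fin p) (j : J) : stack X Y (Fin.castAdd q i) j = X i j := by
  simp only [stack, Fin.addCases_left]

theorem stack_natAdd {p q : ℕ} {J R : Type*} (X : Matrix (Fin p) J R) (Y : Matrix (Fin q) J R)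
    (i : Fin q) (j : J) : stack X Y (Fin.natAdd p i) j = Y i j := by
  simp only [stack, Fin.addCases_right]

theorem solv_stack_iff {p q : ℕ} {J : Type*} {C₁ D₁ : Matrix (Fin p) J (WithBot ℤ)}
    {C₂ D₂ : Matrix (Fin q) J (WithBot ℤ)} {θ₁ : Fin p → ℝ} {θ₂ : Fin q → ℝ} :
    Solv (stack C₁ C₂) (stack D₁ D₂) (Fin.append θ₁ θ₂) ↔
      ∃ (S : Set J) (x : J → ℝ), S.Nonempty ∧
        (∀ i, ∀ j ∈ S, ∀ c : ℤ, C₁ i j = c →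
          ∃ k ∈ S, ∃ d : ℤ, D₁ i k = d ∧ (c : ℝ) + x j ≤ d + θ₁ i + x k) ∧
        (∀ i, ∀ j ∈ S, ∀ c : ℤ, C₂ i j = c →
          ∃ k ∈ S, ∃ d : ℤ, D₂ i k = d ∧ (c : ℝ) + x j ≤ d + θ₂ i + x k) := by
  refine exists_congr fun S => exists_congr fun x => and_congr_right fun _ => ?_
  constructor
  · intro h
    refine ⟨fun i => ?_, fun i => ?_⟩
    · simpa only [stack_castAdd, Fin.append_left] using h (Fin.castAdd q i)
    · simpa only [stack_natAdd, Fin.append_right] using h (Fin.natAdd p i)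
  · rintro ⟨h₁, h₂⟩ i
    refine Fin.addCases (fun i => ?_) (fun i => ?_) i
    · simpa only [stack_castAdd, Fin.append_left] using h₁ i
    · simpa only [stack_natAdd, Fin.append_right] using h₂ i

theorem coe_le_coe_add_iff (r t : ℝ) (y : EReal) :
    (r : EReal) ≤ (t : EReal) + y ↔ ((r - t : ℝ) : EReal) ≤ y := by
  rw [EReal.coe_sub, EReal.sub_le_iff_le_add (Or.inl (EReal.coe_ne_bot _))
    (Or.inl (EReal.coe_ne_top _)), add_comm]

/-- An equality of vectors is two opposite inequalities; moving `lam` to the other side in the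
second one produces the sign change in `plusMinus`. The set `S` is the set of indices where `x` is
finite. -/
theorem mem_spec_iff {lam : ℝ} : lam ∈ spec A B ↔
    Solv (stack A B) (stack B A) (plusMinus m lam) := by
  classical
  rw [plusMinus, solv_stack_iff]
  constructor
  · rintro ⟨x, hx, h⟩
    have : Nonempty (Fin n) := ⟨hx.2.choose⟩
    refine ⟨{j | x j ≠ ⊥}, fun j => (x j).toReal, hx.2, fun i j hj c hc => ?_,
      fun i j hj c hc => ?_⟩
    · have h1 : ((c + (x j).toReal : ℝ) : EReal) ≤ mulVec A x i := by
        rw [coe_le_mulVec_iff]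
        refine ⟨j, c, hc, ?_⟩
        rw [add_sub_cancel_left, EReal.coe_toReal (hx.1 j) hj]
      rw [h i, coe_le_coe_add_iff, coe_le_mulVec_iff] at h1
      obtain ⟨k, d, hd, hle⟩ := h1
      have hk : x k ≠ ⊥ := ((EReal.bot_lt_coe _).trans_le hle).ne'
      refine ⟨k, hk, d, hd, ?_⟩
      rw [← EReal.coe_toReal (hx.1 k) hk, EReal.coe_le_coe_iff] at hle
      linarith
    · have h1 : ((lam + (c + (x j).toReal) : ℝ) : EReal) ≤ mulVec A x i := by
        rw [h i, coe_le_coe_add_iff, coe_le_mulVec_iff]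
        refine ⟨j, c, hc, ?_⟩
        rw [add_sub_cancel_left, add_sub_cancel_left, EReal.coe_toReal (hx.1 j) hj]
      rw [coe_le_mulVec_iff] at h1
      obtain ⟨k, d, hd, hle⟩ := h1
      have hk : x k ≠ ⊥ := ((EReal.bot_lt_coe _).trans_le hle).ne'
      refine ⟨k, hk, d, hd, ?_⟩
      rw [← EReal.coe_toReal (hx.1 k) hk, EReal.coe_le_coe_iff] at hle
      linarith
  · rintro ⟨S, x, hS, h₁, h₂⟩
    have : Nonempty (Fin n) := ⟨hS.choose⟩
    let X : Fin n → EReal := fun j => if j ∈ S then (x j : EReal) else ⊥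
    have hX : ∀ (j : Fin n) (r : ℝ), (r : EReal) ≤ X j ↔ j ∈ S ∧ r ≤ x j := by
      intro j r
      by_cases hj : j ∈ S <;> simp [X, hj]
    refine ⟨X, ⟨fun j => ?_, hS.choose, ?_⟩, fun i => ereal_eq_of_forall_coe_le fun r => ?_⟩
    · by_cases hj : j ∈ S <;> simp [X, hj]
    · simp [X, hS.choose_spec]
    · rw [coe_le_coe_add_iff, coe_le_mulVec_iff, coe_le_mulVec_iff]
      simp only [hX]
      constructor
      · rintro ⟨j, c, hc, hj, hle⟩
        obtain ⟨k, hk, d, hd, hle'⟩ := h₁ i j hj c hc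
        exact ⟨k, d, hd, hk, by linarith⟩
      · rintro ⟨j, c, hc, hj, hle⟩
        obtain ⟨k, hk, d, hd, hle'⟩ := h₂ i j hj c hc
        exact ⟨k, d, hd, hk, by linarith⟩

/-! ### Rational points of the spectrum as games with integer payments -/

/-- The matrix with the entries `q a + p`. -/
def affine (q p : ℤ) (A : Matrix (Fin m) (Fin n) (WithBot ℤ)) :
    Matrix (Fin m) (Fin n) (WithBot ℤ) :=
  fun i j => (A i j).map fun a => q * a + p

theorem affine_eq_coe {q p : ℤ} {i : Fin m} {j : Fin n} {c : ℤ} :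
    affine q p A i j = c ↔ ∃ a : ℤ, A i j = a ∧ q * a + p = c := by
  unfold affine
  cases A i j with
  | bot => simp
  | coe a => simp only [WithBot.map_coe, WithBot.coe_inj, exists_eq_left']

theorem affine_ne_bot {q p : ℤ} {i : Fin m} {j : Fin n} : affine q p A i j ≠ ⊥ ↔ A i j ≠ ⊥ := by
  unfold affine
  cases A i j with
  | bot => simp
  | coe a => simp only [WithBot.map_coe, ne_eq, WithBot.coe_ne_bot, not_false_eq_true]

/-- The mean payoff game whose value is nonnegative if and only if `p / q` is in the spectrum. -/
def pairGame (A B : Matrix (Fin m) (Fin n) (WithBot ℤ)) (p q : ℤ) : Game where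
  rows := m + m
  cols := n
  A := stack (affine q 0 A) (affine q p B)
  B := stack (affine q p B) (affine q 0 A)

theorem pairGame_valid (h : Admissible A B) (p q : ℤ) : (pairGame A B p q).Valid := by
  obtain ⟨-, -, hA, hB, hAB⟩ := h
  constructor
  · intro (j : Fin n)
    obtain ⟨i, hi | hi⟩ := hAB j
    · exact ⟨Fin.castAdd m i, by simpa only [pairGame, stack_castAdd] using affine_ne_bot.2 hi⟩
    · exact ⟨Fin.natAdd m i, by simpa only [pairGame, stack_natAdd] using affine_ne_bot.2 hi⟩
  · intro (i : Fin (m + m))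
    refine Fin.addCases (fun i => ?_) (fun i => ?_) i
    · obtain ⟨j, hj⟩ := hB i
      exact ⟨j, by simpa only [pairGame, stack_castAdd] using affine_ne_bot.2 hj⟩
    · obtain ⟨j, hj⟩ := hA i
      exact ⟨j, by simpa only [pairGame, stack_natAdd] using affine_ne_bot.2 hj⟩

theorem EntriesBounded.affine {M W : ℕ} (hA : EntriesBounded A M) {p q : ℤ} (hq : 0 ≤ q)
    (hW : q * M + |p| ≤ W) : EntriesBounded (affine q p A) W := by
  intro i j c hc
  obtain ⟨a, ha, rfl⟩ := affine_eq_coe.1 hc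
  refine (abs_add_le _ _).trans (le_trans ?_ hW)
  rw [abs_mul, abs_of_nonneg hq]
  have := mul_le_mul_of_nonneg_left (hA i j a ha) hq
  linarith

theorem EntriesBounded.stack {p q : ℕ} {X : Matrix (Fin p) (Fin n) (WithBot ℤ)}
    {Y : Matrix (Fin q) (Fin n) (WithBot ℤ)} {W : ℕ} (hX : EntriesBounded X W)
    (hY : EntriesBounded Y W) :
    EntriesBounded (stack X Y) W := by
  intro i
  refine Fin.addCases (fun i => ?_) (fun i => ?_) i
  · simpa only [stack_castAdd] using hX i
  · simpa only [stack_natAdd] using hY i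

theorem pairGame_mem_gameClass (h : Admissible A B) {M W : ℕ} (hA : EntriesBounded A M)
    (hB : EntriesBounded B M) {p q : ℤ} (hq : 0 ≤ q) (hW : q * M + |p| ≤ W) :
    pairGame A B p q ∈ gameClass (2 * m) n W := by
  have h1 : EntriesBounded (affine q 0 A) W :=
    hA.affine hq (by rw [abs_zero]; linarith [abs_nonneg p])
  have h2 : EntriesBounded (affine q p B) W := hB.affine hq hW
  exact ⟨(two_mul m).symm, rfl, pairGame_valid h p q, h1.stack h2, h2.stack h1⟩

/-- Scaling a solution by `q > 0` clears the denominator; in the lower block, `-p/q` is moved back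
to the other side so that both blocks use the same entries `q b + p` and `q a`. -/
theorem solv_pairGame_iff {p q : ℤ} (hq : 0 < q) :
    Solv (pairGame A B p q).A (pairGame A B p q).B 0 ↔ (p / q : ℝ) ∈ spec A B := by
  have h0 : (0 : Fin (m + m) → ℝ) = Fin.append (fun _ => 0) (fun _ => 0) := by
    funext i
    refine Fin.addCases (fun i => ?_) (fun i => ?_) i <;>
      simp only [Fin.append_left, Fin.append_right, Pi.zero_apply]
  have hqR : (0 : ℝ) < q := by exact_mod_cast hq
  rw [mem_spec_iff, plusMinus, solv_stack_iff]
  change Solv (stack (affine q 0 A) (affine q p B)) (stack (affine q p B)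
    (affine q 0 A)) (0 : Fin (m + m) → ℝ) ↔ _
  rw [h0, solv_stack_iff]
  have key₁ : ∀ (a b : ℤ) (s t : ℝ), (a : ℝ) + s ≤ b + p / q + t ↔
      ((q * a + 0 : ℤ) : ℝ) + q * s ≤ ((q * b + p : ℤ) : ℝ) + 0 + q * t := by
    intro a b s t
    rw [← mul_le_mul_iff_right₀ hqR]
    have : (q : ℝ) * (b + p / q + t) = q * b + p + q * t := by field_simp
    rw [this]
    push_cast
    constructor <;> intro h <;> linarith
  have key₂ : ∀ (a b : ℤ) (s t : ℝ), (b : ℝ) + s ≤ a + -(p / q) + t ↔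
      ((q * b + p : ℤ) : ℝ) + q * s ≤ ((q * a + 0 : ℤ) : ℝ) + 0 + q * t := by
    intro a b s t
    rw [← mul_le_mul_iff_right₀ hqR]
    have : (q : ℝ) * (a + -(p / q) + t) = q * a - p + q * t := by field_simp; ring
    rw [this]
    push_cast
    constructor <;> intro h <;> linarith
  constructor
  · rintro ⟨S, x, hS, h₁, h₂⟩
    have hx : ∀ j, (q : ℝ) * (x j / q) = x j := fun j => by field_simp
    refine ⟨S, fun j => x j / q, hS, fun i j hj c hc => ?_, fun i j hj c hc => ?_⟩
    · obtain ⟨k, hk, d, hd, hle⟩ := h₁ i j hj _ (affine_eq_coe.2 ⟨c, hc, rfl⟩)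
      obtain ⟨b, hb, rfl⟩ := affine_eq_coe.1 hd
      exact ⟨k, hk, b, hb, (key₁ _ _ _ _).2 (by rwa [hx, hx])⟩
    · obtain ⟨k, hk, d, hd, hle⟩ := h₂ i j hj _ (affine_eq_coe.2 ⟨c, hc, rfl⟩)
      obtain ⟨b, hb, rfl⟩ := affine_eq_coe.1 hd
      exact ⟨k, hk, b, hb, (key₂ _ _ _ _).2 (by rwa [hx, hx])⟩
  · rintro ⟨S, x, hS, h₁, h₂⟩
    refine ⟨S, fun j => q * x j, hS, fun i j hj c hc => ?_, fun i j hj c hc => ?_⟩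
    · obtain ⟨a, ha, rfl⟩ := affine_eq_coe.1 hc
      obtain ⟨k, hk, d, hd, hle⟩ := h₁ i j hj a ha
      exact ⟨k, hk, _, affine_eq_coe.2 ⟨d, hd, rfl⟩, (key₁ _ _ _ _).1 hle⟩
    · obtain ⟨a, ha, rfl⟩ := affine_eq_coe.1 hc
      obtain ⟨k, hk, d, hd, hle⟩ := h₂ i j hj a ha
      exact ⟨k, hk, _, affine_eq_coe.2 ⟨d, hd, rfl⟩, (key₂ _ _ _ _).1 hle⟩

/-- The cycle inequalities of the stacked system are affine in `lam`: the slope `k` is the number of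
upper rows minus the number of lower rows on the cycle. Their finitely many zeros `-a/k` are the
only places where membership can change. -/
theorem spec_transfer {M : ℕ} (hA : EntriesBounded A M) (hB : EntriesBounded B M) {lam lam' : ℝ}
    (hlam : lam ∈ spec A B)
    (h : ∀ a k : ℤ, |a| ≤ 2 * M * kap m n → |k| ≤ kap m n →
      0 ≤ (a : ℝ) + k * lam → 0 ≤ (a : ℝ) + k * lam') : lam' ∈ spec A B := by
  rw [mem_spec_iff] at hlam ⊢
  refine hlam.transfer fun I a _ hcard ha => ?_
  -- A cycle has at most `n` columns, and its distinct rows are among `2m`.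
  have hI : I.card ≤ kap m n := by
    refine le_min ?_ (by simpa using hcard)
    have := Finset.card_le_univ I
    rw [Fintype.card_fin] at this
    omega
  have hsum : ∀ t : ℝ, ∑ i ∈ I, plusMinus m t i =
      ((∑ i ∈ I, plusMinus m (1 : ℤ) i : ℤ) : ℝ) * t := by
    intro t
    push_cast
    rw [Finset.sum_mul]
    refine Finset.sum_congr rfl fun i _ => ?_
    refine Fin.addCases (fun i => ?_) (fun i => ?_) i <;>
      simp only [plusMinus, Fin.append_left, Fin.append_right] <;> simp
  rw [hsum, hsum]
  refine h a _ ?_ ?_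
  · have h1 := ha (2 * M) (by
      intro i j k c d hc hd
      have e1 : |c| ≤ (M : ℤ) := hA.stack hB i j c hc
      have e2 : |d| ≤ (M : ℤ) := hB.stack hA i k d hd
      exact (abs_sub _ _).trans (by linarith))
    refine h1.trans ?_
    have : (I.card : ℤ) ≤ kap m n := by exact_mod_cast hI
    exact mul_le_mul_of_nonneg_left this (by positivity)
  · refine (Finset.abs_sum_le_sum_abs _ _).trans ?_
    have h1 : ∀ i ∈ I, |plusMinus m (1 : ℤ) i| ≤ 1 := by
      intro i _
      refine Fin.addCases (fun i => ?_) (fun i => ?_) i <;>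
      simp only [plusMinus, Fin.append_left, Fin.append_right] <;> simp
    refine (Finset.sum_le_card_nsmul _ _ _ h1).trans ?_
    simpa using hI

/-- The vector `(e, f)` has coordinates `e b - a f` and `c f - e d` in the unimodular basis `(c,
d)`, `(a, b)`. Both are positive integers, so `f ≥ b + d`. -/
theorem farey_le {a b c d e f κ : ℤ} (hb : 0 < b) (hd : 0 < d) (hdet : b * c - a * d = 1)
    (hbd : κ < b + d) (h1 : a * f < e * b) (h2 : e * d < c * f) : κ < f := by
  have h3 : f = b * (c * f - e * d) + d * (e * b - a * f) := by
    have : f = (b * c - a * d) * f := by rw [hdet, one_mul]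
    linear_combination this
  have h4 : b * 1 ≤ b * (c * f - e * d) := mul_le_mul_of_nonneg_left (by omega) hb.le
  have h5 : d * 1 ≤ d * (e * b - a * f) := mul_le_mul_of_nonneg_left (by omega) hd.le
  omega

/-- The spectrum contains all or nothing of the interval between two consecutive fractions with
denominators at most `κ`. -/
theorem spec_between {a b c d : ℤ} (hb : 0 < b) (hd : 0 < d) (hdet : b * c - a * d = 1)
    (hbd : (kap m n : ℤ) < b + d) {lam lam' : ℝ} (hlam : lam ∈ spec A B) (h1 : (a : ℝ) < b * lam)
    (h2 : d * lam < c) (h3 : (a : ℝ) ≤ b * lam') (h4 : d * lam' ≤ c) : lam' ∈ spec A B := by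
  obtain ⟨W₁, hW₁⟩ := exists_entriesBounded A
  obtain ⟨W₂, hW₂⟩ := exists_entriesBounded B
  have hA : EntriesBounded A (max W₁ W₂) := fun i j z hz =>
    (hW₁ i j z hz).trans (by exact_mod_cast le_max_left _ _)
  have hB : EntriesBounded B (max W₁ W₂) := fun i j z hz =>
    (hW₂ i j z hz).trans (by exact_mod_cast le_max_right _ _)
  have hbR : (0 : ℝ) < b := by exact_mod_cast hb
  have hdR : (0 : ℝ) < d := by exact_mod_cast hd
  refine spec_transfer hA hB hlam fun e k _ hk h0 => ?_
  by_contra hneg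
  rw [not_le] at hneg
  rcases lt_trichotomy k 0 with hk0 | rfl | hk0
  · have hkR : (k : ℝ) < 0 := by exact_mod_cast hk0
    have e1 : (a : ℝ) * (-k) < e * b := by nlinarith
    have e2 : (e : ℝ) * d < c * (-k) := by nlinarith
    have := farey_le (e := e) (f := -k) hb hd hdet hbd (by exact_mod_cast e1)
      (by exact_mod_cast e2)
    rw [abs_of_neg hk0] at hk
    omega
  · simp only [Int.cast_zero, zero_mul, add_zero] at h0 hneg
    linarith
  · have hkR : (0 : ℝ) < k := by exact_mod_cast hk0
    have e1 : (a : ℝ) * k < -e * b := by nlinarith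
    have e2 : -(e : ℝ) * d < c * k := by nlinarith
    have := farey_le (e := -e) (f := k) hb hd hdet hbd (by exact_mod_cast e1)
      (by exact_mod_cast e2)
    rw [abs_of_pos hk0] at hk
    omega

/-- A zero of `a + k x` with `k ≠ 0` has modulus at most `|a| ≤ 2Mκ`, so no inequality changes its
truth value to the right of `2Mκ`. -/
theorem spec_above {M : ℕ} (hA : EntriesBounded A M) (hB : EntriesBounded B M) {lam lam' : ℝ}
    (hlam : lam ∈ spec A B) (h1 : ((2 * M * kap m n : ℕ) : ℝ) < lam)
    (h2 : ((2 * M * kap m n : ℕ) : ℝ) ≤ lam') : lam' ∈ spec A B := by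
  refine spec_transfer hA hB hlam fun a k ha _ h0 => ?_
  have ha' : |(a : ℝ)| ≤ ((2 * M * kap m n : ℕ) : ℝ) := by exact_mod_cast ha
  set H : ℝ := ((2 * M * kap m n : ℕ) : ℝ) with hH
  have hH0 : 0 ≤ H := by positivity
  obtain ⟨e1, e2⟩ := abs_le.1 ha'
  rcases lt_trichotomy k 0 with hk | rfl | hk
  · have hk' : (k : ℝ) ≤ -1 := by exact_mod_cast (by omega : k ≤ -1)
    nlinarith
  · simpa using h0
  · have hk' : (1 : ℝ) ≤ k := by exact_mod_cast (by omega : 1 ≤ k)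
    nlinarith

theorem spec_below {M : ℕ} (hA : EntriesBounded A M) (hB : EntriesBounded B M) {lam lam' : ℝ}
    (hlam : lam ∈ spec A B) (h1 : lam < -((2 * M * kap m n : ℕ) : ℝ))
    (h2 : lam' ≤ -((2 * M * kap m n : ℕ) : ℝ)) : lam' ∈ spec A B := by
  refine spec_transfer hA hB hlam fun a k ha _ h0 => ?_
  have ha' : |(a : ℝ)| ≤ ((2 * M * kap m n : ℕ) : ℝ) := by exact_mod_cast ha
  set H : ℝ := ((2 * M * kap m n : ℕ) : ℝ) with hH
  have hH0 : 0 ≤ H := by positivity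
  obtain ⟨e1, e2⟩ := abs_le.1 ha'
  rcases lt_trichotomy k 0 with hk | rfl | hk
  · have hk' : (k : ℝ) ≤ -1 := by exact_mod_cast (by omega : k ≤ -1)
    nlinarith
  · simpa using h0
  · have hk' : (1 : ℝ) ≤ k := by exact_mod_cast (by omega : 1 ≤ k)
    nlinarith

end Spectrum

/-! ### Output of a set from left to right -/

section Output

/-- The list `out` describes the part of `S` to the left of `v`; if `prev` holds, then the last
interval is still open, reaches `v`, and only its left end is in the list. -/
def PartialOutput (S : Set ℝ) (out : List ℤ) (prev : Prop) (v : ℝ) : Prop :=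
  ∃ L : List Interval,
    (∀ I ∈ L, 0 ≤ I.loDen ∧ 0 ≤ I.hiDen ∧ I.toSet.Nonempty) ∧
    L.Pairwise (fun I J => ∀ x ∈ I.toSet, ∀ y ∈ J.toSet, x < y) ∧
    (∀ I ∈ L, ∀ x ∈ I.toSet, x < v) ∧
    ((¬ prev ∧ out = L.flatMap Interval.code ∧ ∀ x < v, x ∈ S ↔ ∃ I ∈ L, x ∈ I.toSet) ∨
     (prev ∧ ∃ p q : ℤ, 0 ≤ q ∧ out = L.flatMap Interval.code ++ [p, q] ∧
      (∀ I ∈ L, ∀ x ∈ I.toSet, ∀ y : ℝ, (p : ℝ) ≤ q * y → x < y) ∧ (p : ℝ) ≤ q * v ∧ v ∈ S ∧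
      ∀ x < v, x ∈ S ↔ (∃ I ∈ L, x ∈ I.toSet) ∨ (p : ℝ) ≤ q * x))

variable {S : Set ℝ} {out : List ℤ} {prev mid : Prop} {v v' : ℝ}

theorem PartialOutput.mem (h : PartialOutput S out prev v) (hp : prev) : v ∈ S := by
  obtain ⟨L, -, -, -, ⟨h, -⟩ | ⟨-, p, q, -, -, -, -, h, -⟩⟩ := h
  · exact absurd hp h
  · exact h

theorem PartialOutput.of_disjoint (h : ∀ x < v, x ∉ S) : PartialOutput S [] False v :=
  ⟨[], by simp, by simp, by simp, Or.inl ⟨id, by simp, fun x hx => by simp [h x hx]⟩⟩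

/-- The pair `[0, 0]` encodes the end `-∞`, since `0 ≤ 0 * x` always holds. -/
theorem PartialOutput.of_subset (h : ∀ x ≤ v, x ∈ S) : PartialOutput S [0, 0] True v :=
  ⟨[], by simp, by simp, by simp, Or.inr ⟨trivial, 0, 0, le_rfl, by simp, by simp, by simp,
    h v le_rfl, fun x hx => by simp [h x hx.le]⟩⟩

/-- This and the next four lemmas are the possible moves of the frontier from `v` to `v'`. They are
distinguished by whether an interval arrives from the left (`prev`), whether `v` belongs to `S`, and
whether one leaves to the right (`mid`). If `v ∉ S`, only this move is possible, because all
intervals are closed. -/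
theorem PartialOutput.skip (h : PartialOutput S out prev v) (hv : v < v') (hp : ¬ prev)
    (hm : ¬ mid) (hS : ∀ x, v ≤ x → x < v' → x ∉ S) : PartialOutput S out mid v' := by
  obtain ⟨L, h1, h2, h3, ⟨-, h4, h5⟩ | ⟨h, -⟩⟩ := h
  · refine ⟨L, h1, h2, fun I hI x hx => (h3 I hI x hx).trans hv, Or.inl ⟨hm, h4, fun x hx => ?_⟩⟩
    rcases lt_or_ge x v with hxv | hxv
    · exact h5 x hxv
    · refine iff_of_false (hS x hxv hx) ?_
      rintro ⟨I, hI, hxI⟩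
      exact absurd (h3 I hI x hxI) (not_lt.2 hxv)
  · exact absurd h hp

theorem PartialOutput.extend (h : PartialOutput S out prev v) (hv : v < v') (hp : prev)
    (hm : mid) (hS : ∀ x, v ≤ x → x ≤ v' → x ∈ S) : PartialOutput S out mid v' := by
  obtain ⟨L, h1, h2, h3, ⟨h, -⟩ | ⟨-, p, q, hq, h4, h5, h6, -, h7⟩⟩ := h
  · exact absurd hp h
  · have hmono : ∀ x, v ≤ x → (p : ℝ) ≤ q * x := fun x hx =>
      h6.trans (mul_le_mul_of_nonneg_left hx (by exact_mod_cast hq))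
    refine ⟨L, h1, h2, fun I hI x hx => (h3 I hI x hx).trans hv, Or.inr ⟨hm, p, q, hq, h4, h5,
      hmono v' hv.le, hS v' hv.le le_rfl, fun x hx => ?_⟩⟩
    rcases lt_or_ge x v with hxv | hxv
    · exact h7 x hxv
    · exact iff_of_true (hS x hxv hx.le) (Or.inr (hmono x hxv))

theorem PartialOutput.start {a b : ℤ} (hb : 0 < b) (hab : v = a / b)
    (h : PartialOutput S out prev v) (hv : v < v') (hp : ¬ prev) (hm : mid)
    (hS : ∀ x, v ≤ x → x ≤ v' → x ∈ S) : PartialOutput S (out ++ [a, b]) mid v' := by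
  have hbR : (0 : ℝ) < b := by exact_mod_cast hb
  have hv_iff : ∀ x : ℝ, (a : ℝ) ≤ b * x ↔ v ≤ x := fun x => by
    rw [hab, div_le_iff₀ hbR, mul_comm]
  obtain ⟨L, h1, h2, h3, ⟨-, h4, h5⟩ | ⟨h, -⟩⟩ := h
  · refine ⟨L, h1, h2, fun I hI x hx => (h3 I hI x hx).trans hv, Or.inr ⟨hm, a, b, hb.le,
      by rw [h4], fun I hI x hx y hy => (h3 I hI x hx).trans_le ((hv_iff y).1 hy),
      (hv_iff v').2 hv.le, hS v' hv.le le_rfl, fun x hx => ?_⟩⟩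
    rcases lt_or_ge x v with hxv | hxv
    · rw [h5 x hxv, hv_iff, or_iff_left (not_le.2 hxv)]
    · exact iff_of_true (hS x hxv hx.le) (Or.inr ((hv_iff x).2 hxv))
  · exact absurd h hp

theorem PartialOutput.close {a b : ℤ} (hb : 0 < b) (hab : v = a / b)
    (h : PartialOutput S out prev v) (hv : v < v') (hp : prev) (hm : ¬ mid)
    (hS : ∀ x, v < x → x < v' → x ∉ S) : PartialOutput S (out ++ [a, b]) mid v' := by
  have hbR : (0 : ℝ) < b := by exact_mod_cast hb
  have hv_iff : ∀ x : ℝ, (b : ℝ) * x ≤ a ↔ x ≤ v := fun x => by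
    rw [hab, le_div_iff₀ hbR, mul_comm]
  obtain ⟨L, h1, h2, h3, ⟨h, -⟩ | ⟨-, p, q, hq, h4, h5, h6, hvS, h7⟩⟩ := h
  · exact absurd hp h
  · have hmem : ∀ x, x ∈ (Interval.mk p q a b).toSet ↔ (p : ℝ) ≤ q * x ∧ x ≤ v := fun x =>
      and_congr_right fun _ => hv_iff x
    refine ⟨L ++ [⟨p, q, a, b⟩], ?_, ?_, ?_, Or.inl ⟨hm, ?_, ?_⟩⟩
    · intro I hI
      -- The interval that was open now receives its right end and joins the completed list.
      rcases List.mem_append.1 hI with hI | hI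
      · exact h1 I hI
      · rw [List.mem_singleton] at hI
        subst hI
        exact ⟨hq, hb.le, v, (hmem v).2 ⟨h6, le_rfl⟩⟩
    · rw [List.pairwise_append]
      refine ⟨h2, List.pairwise_singleton _ _, fun I hI J hJ x hx y hy => ?_⟩
      rw [List.mem_singleton] at hJ
      subst hJ
      exact h5 I hI x hx y ((hmem y).1 hy).1
    · intro I hI x hx
      rcases List.mem_append.1 hI with hI | hI
      · exact (h3 I hI x hx).trans hv
      · rw [List.mem_singleton] at hI
        subst hI
        exact ((hmem x).1 hx).2.trans_lt hv
    · rw [h4, List.flatMap_append]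
      simp [Interval.code]
    · intro x hx
      simp only [List.mem_append, List.mem_singleton, or_and_right, exists_or, exists_eq_left,
        hmem]
      rcases lt_trichotomy x v with hxv | rfl | hxv
      · rw [h7 x hxv, and_iff_left hxv.le]
      · exact iff_of_true hvS (Or.inr ⟨h6, le_rfl⟩)
      · refine iff_of_false (hS x hxv hx) ?_
        rintro (⟨I, hI, hxI⟩ | ⟨-, h⟩)
        · exact absurd (h3 I hI x hxI) (not_lt.2 hxv.le)
        · exact absurd hxv (not_lt.2 h)

theorem PartialOutput.point {a b : ℤ} (hb : 0 < b) (hab : v = a / b)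
    (h : PartialOutput S out prev v) (hv : v < v') (hp : ¬ prev) (hm : ¬ mid) (hvS : v ∈ S)
    (hS : ∀ x, v < x → x < v' → x ∉ S) :
    PartialOutput S (out ++ [a, b] ++ [a, b]) mid v' := by
  have hbR : (0 : ℝ) < b := by exact_mod_cast hb
  have hv_iff : ∀ x : ℝ, (a : ℝ) ≤ b * x ∧ (b : ℝ) * x ≤ a ↔ x = v := fun x => by
    rw [hab, ← le_antisymm_iff, eq_div_iff hbR.ne', mul_comm x, eq_comm]
  obtain ⟨L, h1, h2, h3, ⟨-, h4, h5⟩ | ⟨h, -⟩⟩ := h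
  · have hmem : ∀ x, x ∈ (Interval.mk a b a b).toSet ↔ x = v := hv_iff
    refine ⟨L ++ [⟨a, b, a, b⟩], ?_, ?_, ?_, Or.inl ⟨hm, ?_, ?_⟩⟩
    · intro I hI
      rcases List.mem_append.1 hI with hI | hI
      · exact h1 I hI
      · rw [List.mem_singleton] at hI
        subst hI
        exact ⟨hb.le, hb.le, v, (hmem v).2 rfl⟩
    · rw [List.pairwise_append]
      refine ⟨h2, List.pairwise_singleton _ _, fun I hI J hJ x hx y hy => ?_⟩
      rw [List.mem_singleton] at hJ
      subst hJ
      rw [(hmem y).1 hy]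
      exact h3 I hI x hx
    · intro I hI x hx
      rcases List.mem_append.1 hI with hI | hI
      · exact (h3 I hI x hx).trans hv
      · rw [List.mem_singleton] at hI
        subst hI
        rw [(hmem x).1 hx]
        exact hv
    · rw [h4, List.flatMap_append]
      simp [Interval.code]
    · intro x hx
      simp only [List.mem_append, List.mem_singleton, or_and_right, exists_or, exists_eq_left,
        hmem]
      rcases lt_trichotomy x v with hxv | rfl | hxv
      · rw [h5 x hxv, or_iff_left hxv.ne]
      · exact iff_of_true hvS (Or.inr rfl)
      · refine iff_of_false (hS x hxv hx) ?_
        rintro (⟨I, hI, hxI⟩ | h)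
        · exact absurd (h3 I hI x hxI) (not_lt.2 hxv.le)
        · exact absurd h hxv.ne'
  · exact absurd h hp

theorem PartialOutput.identifies (h : PartialOutput S out prev v) (hp : ¬ prev)
    (hS : ∀ x, v ≤ x → x ∉ S) : Identifies out S := by
  obtain ⟨L, h1, h2, h3, ⟨-, h4, h5⟩ | ⟨h, -⟩⟩ := h
  · refine ⟨L, h4, h1, h2, Set.ext fun x => ?_⟩
    rcases lt_or_ge x v with hxv | hxv
    · exact h5 x hxv
    · refine iff_of_false (hS x hxv) ?_
      rintro ⟨I, hI, hxI⟩
      exact absurd (h3 I hI x hxI) (not_lt.2 hxv)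
  · exact absurd h hp

theorem PartialOutput.identifies_append (h : PartialOutput S out prev v) (hp : prev)
    (hS : ∀ x, v ≤ x → x ∈ S) : Identifies (out ++ [0, 0]) S := by
  obtain ⟨L, h1, h2, h3, ⟨h, -⟩ | ⟨-, p, q, hq, h4, h5, h6, -, h7⟩⟩ := h
  · exact absurd hp h
  · have hmem : ∀ x, x ∈ (Interval.mk p q 0 0).toSet ↔ (p : ℝ) ≤ q * x := fun x => by
      simp [Interval.toSet]
    refine ⟨L ++ [⟨p, q, 0, 0⟩], ?_, ?_, ?_, Set.ext fun x => ?_⟩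
    · rw [h4, List.flatMap_append]
      simp [Interval.code]
    · intro I hI
      rcases List.mem_append.1 hI with hI | hI
      · exact h1 I hI
      · rw [List.mem_singleton] at hI
        subst hI
        exact ⟨hq, le_rfl, v, (hmem v).2 h6⟩
    · rw [List.pairwise_append]
      refine ⟨h2, List.pairwise_singleton _ _, fun I hI J hJ x hx y hy => ?_⟩
      rw [List.mem_singleton] at hJ
      subst hJ
      exact h5 I hI x hx y ((hmem y).1 hy)
    · simp only [Set.mem_ofPred_eq, List.mem_append, List.mem_singleton, or_and_right, exists_or,
        exists_eq_left, hmem]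
      rcases lt_or_ge x v with hxv | hxv
      · exact h7 x hxv
      · exact iff_of_true (hS x hxv)
          (Or.inr (h6.trans (mul_le_mul_of_nonneg_left hxv (by exact_mod_cast hq))))

end Output

/-! ### Hoare logic with step counts -/

/-- A state of the machine without the step counter. -/
structure Mem where
  vars : ℕ → ℤ
  arr : ℕ → ℕ → ℕ → ℤ
  out : List ℤ
  calls : List Game

namespace Mem

def st (μ : Mem) (σ : ℕ) : State := ⟨μ.vars, μ.arr, μ.out, μ.calls, σ⟩

def setVar (μ : Mem) (x : ℕ) (v : ℤ) : Mem := { μ with vars := Function.update μ.vars x v }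

def setArr (μ : Mem) (a i j : ℕ) (v : ℤ) : Mem :=
  { μ with arr := fun a' i' j' => if a' = a ∧ i' = i ∧ j' = j then v else μ.arr a' i' j' }

def write (μ : Mem) (v : ℤ) : Mem := { μ with out := μ.out ++ [v] }

def ask (μ : Mem) (orc : GameOracle) (x : ℕ) (G : Game) : Mem :=
  { μ.setVar x (orc.answer G) with calls := μ.calls ++ [G] }

variable (μ : Mem) (x y a i j a' i' j' : ℕ) (v : ℤ)

@[simp] theorem setVar_vars : (μ.setVar x v).vars y = if y = x then v else μ.vars y :=
  Function.update_apply _ _ _ _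

@[simp] theorem setVar_arr : (μ.setVar x v).arr = μ.arr := rfl

@[simp] theorem setVar_out : (μ.setVar x v).out = μ.out := rfl

@[simp] theorem setVar_calls : (μ.setVar x v).calls = μ.calls := rfl

@[simp] theorem setArr_vars : (μ.setArr a i j v).vars = μ.vars := rfl

@[simp] theorem setArr_arr : (μ.setArr a i j v).arr a' i' j' =
    if a' = a ∧ i' = i ∧ j' = j then v else μ.arr a' i' j' := rfl

@[simp] theorem setArr_out : (μ.setArr a i j v).out = μ.out := rfl

@[simp] theorem setArr_calls : (μ.setArr a i j v).calls = μ.calls := rfl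

@[simp] theorem write_vars : (μ.write v).vars = μ.vars := rfl

@[simp] theorem write_arr : (μ.write v).arr = μ.arr := rfl

@[simp] theorem write_out : (μ.write v).out = μ.out ++ [v] := rfl

@[simp] theorem write_calls : (μ.write v).calls = μ.calls := rfl

end Mem

namespace Expr

/-- The value of an expression. -/
def ev (μ : Mem) (e : Expr) : ℤ := e.eval (μ.st 0)

theorem eval_st (μ : Mem) (σ : ℕ) (e : Expr) : e.eval (μ.st σ) = e.ev μ := by
  induction e with
  | const c => rfl
  | var x => rfl
  | get a i j hi hj =>
    simp only [ev, eval] at hi hj ⊢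
    rw [hi, hj]
    rfl
  | add e f he hf => simp only [ev, eval] at he hf ⊢; rw [he, hf]
  | sub e f he hf => simp only [ev, eval] at he hf ⊢; rw [he, hf]

variable (μ : Mem)

@[simp] theorem ev_const (c : ℤ) : (const c).ev μ = c := rfl

@[simp] theorem ev_var (x : ℕ) : (var x).ev μ = μ.vars x := rfl

@[simp] theorem ev_get (a : ℕ) (i j : Expr) :
    (get a i j).ev μ = μ.arr a (i.ev μ).toNat (j.ev μ).toNat := rfl

@[simp] theorem ev_add (e f : Expr) : (add e f).ev μ = e.ev μ + f.ev μ := rfl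

@[simp] theorem ev_sub (e f : Expr) : (sub e f).ev μ = e.ev μ - f.ev μ := rfl

end Expr

namespace Prog

/-- The variables that a program may change. -/
def modVars : Prog → List ℕ
  | skip => []
  | assign x _ => [x]
  | put _ _ _ _ => []
  | emit _ => []
  | query x _ _ _ _ _ _ => [x]
  | seq P Q => P.modVars ++ Q.modVars
  | ifle _ _ P Q => P.modVars ++ Q.modVars
  | whilele _ _ P => P.modVars

/-- The arrays that a program may change. -/
def modArrs : Prog → List ℕ
  | skip => []
  | assign _ _ => []
  | put a _ _ _ => [a]
  | emit _ => []
  | query _ _ _ _ _ _ _ => []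
  | seq P Q => P.modArrs ++ Q.modArrs
  | ifle _ _ P Q => P.modArrs ++ Q.modArrs
  | whilele _ _ P => P.modArrs

/-- The program does not write to the output. -/
def silent : Prog → Bool
  | emit _ => false
  | seq P Q => P.silent && Q.silent
  | ifle _ _ P Q => P.silent && Q.silent
  | whilele _ _ P => P.silent
  | _ => true

/-- The program does not call the oracle. -/
def oracleFree : Prog → Bool
  | query _ _ _ _ _ _ _ => false
  | seq P Q => P.oracleFree && Q.oracleFree
  | ifle _ _ P Q => P.oracleFree && Q.oracleFree
  | whilele _ _ P => P.oracleFree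
  | _ => true

end Prog

/-! ### The frame rule -/

/-- What a program leaves unchanged. -/
structure Frame (P : Prog) (μ ν : Mem) : Prop where
  vars : ∀ x, x ∉ P.modVars → ν.vars x = μ.vars x
  arr : ∀ a, a ∉ P.modArrs → ν.arr a = μ.arr a
  out : P.silent = true → ν.out = μ.out
  calls : P.oracleFree = true → ν.calls = μ.calls

theorem Frame.refl (P : Prog) (μ : Mem) : Frame P μ μ :=
  ⟨fun _ _ => rfl, fun _ _ => rfl, fun _ => rfl, fun _ => rfl⟩

theorem Frame.trans {P Q R : Prog} {μ ν ξ : Mem} (h₁ : Frame P μ ν) (h₂ : Frame Q ν ξ)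
    (hv : ∀ x, x ∉ R.modVars → x ∉ P.modVars ∧ x ∉ Q.modVars)
    (ha : ∀ x, x ∉ R.modArrs → x ∉ P.modArrs ∧ x ∉ Q.modArrs)
    (hs : R.silent = true → P.silent = true ∧ Q.silent = true)
    (ho : R.oracleFree = true → P.oracleFree = true ∧ Q.oracleFree = true) : Frame R μ ξ :=
  ⟨fun x hx => (h₂.vars x (hv x hx).2).trans (h₁.vars x (hv x hx).1),
    fun a hx => (h₂.arr a (ha a hx).2).trans (h₁.arr a (ha a hx).1),
    fun h => (h₂.out (hs h).2).trans (h₁.out (hs h).1),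
    fun h => (h₂.calls (ho h).2).trans (h₁.calls (ho h).1)⟩

theorem Frame.mono {P R : Prog} {μ ν : Mem} (h : Frame P μ ν)
    (hv : ∀ x, x ∉ R.modVars → x ∉ P.modVars) (ha : ∀ x, x ∉ R.modArrs → x ∉ P.modArrs)
    (hs : R.silent = true → P.silent = true)
    (ho : R.oracleFree = true → P.oracleFree = true) : Frame R μ ν :=
  ⟨fun x hx => h.vars x (hv x hx), fun a hx => h.arr a (ha a hx), fun h' => h.out (hs h'),
    fun h' => h.calls (ho h')⟩

/-- A state without its step counter. -/
def State.mem (s : State) : Mem := ⟨s.vars, s.arr, s.out, s.calls⟩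

/-- The sets of written cells are computed from the syntax alone. Hence preservation of a concrete
variable is a decidable check, and loop invariants need to mention only what the loop writes. -/
theorem Exec.frame {orc : GameOracle} {P : Prog} {s t : State} (h : Exec orc P s t) :
    Frame P s.mem t.mem := by
  induction h with
  | skip s => exact Frame.refl _ _
  | assign s x e =>
    refine ⟨fun y hy => ?_, fun _ _ => rfl, fun _ => rfl, fun _ => rfl⟩
    exact Function.update_of_ne (by simpa [Prog.modVars] using hy) _ _
  | put s a i j e =>
    refine ⟨fun _ _ => rfl, fun b hb => ?_, fun _ => rfl, fun _ => rfl⟩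
    have : b ≠ a := by simpa [Prog.modArrs] using hb
    funext i' j'
    exact if_neg fun h => this h.1
  | emit s e =>
    exact ⟨fun _ _ => rfl, fun _ _ => rfl, fun h => by simp [Prog.silent] at h, fun _ => rfl⟩
  | query s x rows cols valA maskA valB maskB =>
    refine ⟨fun y hy => ?_, fun _ _ => rfl, fun _ => rfl, fun h => by
      simp [Prog.oracleFree] at h⟩
    exact Function.update_of_ne (by simpa [Prog.modVars] using hy) _ _
  | seq _ _ ih₁ ih₂ =>
    refine ih₁.trans ih₂ ?_ ?_ ?_ ?_ <;>
      simp [Prog.modVars, Prog.modArrs, Prog.silent, Prog.oracleFree]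
  | @ifle_true _ _ _ _ s _ _ _ ih =>
    have ih' : Frame _ s.mem _ := ih
    refine ih'.mono ?_ ?_ ?_ ?_ <;>
      simp +contextual [Prog.modVars, Prog.modArrs, Prog.silent, Prog.oracleFree]
  | @ifle_false _ _ _ _ s _ _ _ ih =>
    have ih' : Frame _ s.mem _ := ih
    refine ih'.mono ?_ ?_ ?_ ?_ <;>
      simp +contextual [Prog.modVars, Prog.modArrs, Prog.silent, Prog.oracleFree]
  | @while_true _ _ _ s _ _ _ _ _ ih₁ ih₂ =>
    have ih' : Frame _ s.mem _ := ih₁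
    refine ih'.trans ih₂ ?_ ?_ ?_ ?_ <;>
      simp [Prog.modVars, Prog.modArrs, Prog.silent, Prog.oracleFree]
  | while_false _ => exact Frame.refl _ _

/-- Started in `μ`, the program halts within `K` steps in a state that satisfies `Q`. -/
def Runs (orc : GameOracle) (P : Prog) (μ : Mem) (K : ℕ) (Q : Mem → Prop) : Prop :=
  ∀ σ : ℕ, ∃ (ν : Mem) (τ : ℕ), Exec orc P (μ.st σ) (ν.st τ) ∧ τ ≤ σ + K ∧ Q ν

namespace Runs

variable {orc : GameOracle} {P P' : Prog} {μ : Mem} {K K' : ℕ} {Q Q' : Mem → Prop}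

theorem mono (h : Runs orc P μ K Q) (hK : K ≤ K') (hQ : ∀ ν, Q ν → Q' ν) :
    Runs orc P μ K' Q' := fun σ => by
  obtain ⟨ν, τ, h1, h2, h3⟩ := h σ
  exact ⟨ν, τ, h1, by omega, hQ ν h3⟩

theorem cost (h : Runs orc P μ K Q) (hK : K ≤ K') : Runs orc P μ K' Q := h.mono hK fun _ => id

theorem frame (h : Runs orc P μ K Q) : Runs orc P μ K fun ν => Frame P μ ν ∧ Q ν := fun σ => by
  obtain ⟨ν, τ, h1, h2, h3⟩ := h σ
  exact ⟨ν, τ, h1, h2, h1.frame, h3⟩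

theorem assign {x : ℕ} {e : Expr} (h : Q (μ.setVar x (e.ev μ))) :
    Runs orc (.assign x e) μ 1 Q := fun σ => by
  refine ⟨_, σ + 1, ?_, le_rfl, h⟩
  have := Exec.assign (orc := orc) (μ.st σ) x e
  rw [Expr.eval_st] at this
  exact this

theorem put {a : ℕ} {i j e : Expr} (h : Q (μ.setArr a (i.ev μ).toNat (j.ev μ).toNat (e.ev μ))) :
    Runs orc (.put a i j e) μ 1 Q := fun σ => by
  refine ⟨_, σ + 1, ?_, le_rfl, h⟩
  have := Exec.put (orc := orc) (μ.st σ) a i j e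
  rw [Expr.eval_st, Expr.eval_st, Expr.eval_st] at this
  exact this

theorem emit {e : Expr} (h : Q (μ.write (e.ev μ))) : Runs orc (.emit e) μ 1 Q := fun σ => by
  refine ⟨_, σ + 1, ?_, le_rfl, h⟩
  have := Exec.emit (orc := orc) (μ.st σ) e
  rw [Expr.eval_st] at this
  exact this

theorem skip (h : Q μ) : Runs orc .skip μ 1 Q := fun σ =>
  ⟨μ, σ + 1, Exec.skip _, le_rfl, h⟩

theorem query {x : ℕ} {rows cols : Expr} {valA maskA valB maskB : ℕ} {G : Game}
    (hG : (μ.st 0).readGame rows cols valA maskA valB maskB = G) (h : Q (μ.ask orc x G)) :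
    Runs orc (.query x rows cols valA maskA valB maskB) μ 1 Q := fun σ => by
  refine ⟨_, σ + 1, ?_, le_rfl, h⟩
  have := Exec.query (orc := orc) (μ.st σ) x rows cols valA maskA valB maskB
  have e : (μ.st σ).readGame rows cols valA maskA valB maskB = G := by
    rw [← hG]
    have hr : rows.eval (μ.st σ) = rows.eval (μ.st 0) := by rw [Expr.eval_st, Expr.eval_st]
    have hc : cols.eval (μ.st σ) = cols.eval (μ.st 0) := by rw [Expr.eval_st, Expr.eval_st]
    simp only [State.readGame]
    rw [hr, hc]
    rfl
  rw [e] at this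
  exact this

/-- The postcondition of the first program is itself a claim about the second one, so a proof
follows the program as a symbolic execution. -/
theorem seq (h : Runs orc P μ K fun ν => Runs orc P' ν K' Q) :
    Runs orc (.seq P P') μ (K + K') Q := fun σ => by
  obtain ⟨ν, τ, h1, h2, h3⟩ := h σ
  obtain ⟨ξ, υ, h4, h5, h6⟩ := h3 τ
  exact ⟨ξ, υ, Exec.seq h1 h4, by omega, h6⟩

theorem ifle {e f : Expr} (h₁ : e.ev μ ≤ f.ev μ → Runs orc P μ K Q)
    (h₂ : ¬ e.ev μ ≤ f.ev μ → Runs orc P' μ K Q) : Runs orc (.ifle e f P P') μ (K + 1) Q :=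
  fun σ => by
  by_cases h : e.ev μ ≤ f.ev μ
  · obtain ⟨ν, τ, h1, h2, h3⟩ := h₁ h (σ + 1)
    exact ⟨ν, τ, Exec.ifle_true (by rwa [Expr.eval_st, Expr.eval_st]) h1, by omega, h3⟩
  · obtain ⟨ν, τ, h1, h2, h3⟩ := h₂ h (σ + 1)
    exact ⟨ν, τ, Exec.ifle_false (by rwa [Expr.eval_st, Expr.eval_st]) h1, by omega, h3⟩

/-- The index of the invariant bounds the number of remaining rounds. It has to decrease strictly,
by any amount, and need not be a function of the state. -/
theorem whilele {e f : Expr} {c : ℕ} (I : ℕ → Mem → Prop)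
    (hbody : ∀ k ν, I k ν → e.ev ν ≤ f.ev ν → Runs orc P ν c fun ξ => ∃ k' < k, I k' ξ)
    (hexit : ∀ k ν, I k ν → ¬ e.ev ν ≤ f.ev ν → Q ν) {k : ℕ} (h : I k μ) :
    Runs orc (.whilele e f P) μ (k * (c + 1) + 1) Q := by
  induction k using Nat.strong_induction_on generalizing μ with
  | _ k ih =>
    intro σ
    by_cases hg : e.ev μ ≤ f.ev μ
    · obtain ⟨ν, τ, h1, h2, k', hk', h3⟩ := hbody k μ h hg (σ + 1)
      obtain ⟨ξ, υ, h4, h5, h6⟩ := ih k' hk' h3 τ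
      refine ⟨ξ, υ, Exec.while_true (by rwa [Expr.eval_st, Expr.eval_st]) h1 h4, ?_, h6⟩
      have : (k' + 1) * (c + 1) ≤ k * (c + 1) := Nat.mul_le_mul_right _ hk'
      rw [Nat.succ_mul] at this
      omega
    · exact ⟨μ, σ + 1, Exec.while_false (by rwa [Expr.eval_st, Expr.eval_st]), by omega,
        hexit k μ h hg⟩

end Runs

/-- `for i < N do P`. -/
def Prog.forLoop (i : ℕ) (N : Expr) (P : Prog) : Prog :=
  .seq (.assign i (.const 0)) (.whilele (.add (.var i) (.const 1)) N
    (.seq P (.assign i (.add (.var i) (.const 1)))))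

/-- The frame relates each intermediate state to the state before the loop, so `J` carries only the
progress of the body. It is stated after the increment of the counter, which the body itself must
not touch. -/
theorem Runs.forLoop {orc : GameOracle} {P : Prog} {μ : Mem} {i : ℕ} {N : Expr} {n c : ℕ}
    (J : ℕ → Mem → Prop) (hi : i ∉ P.modVars)
    (hN : ∀ ν, Frame (.forLoop i N P) μ ν → N.ev ν = n)
    (h0 : J 0 (μ.setVar i 0))
    (hstep : ∀ k < n, ∀ ν, Frame (.forLoop i N P) μ ν → ν.vars i = k → J k ν →
      Runs orc P ν c fun ξ => J (k + 1) (ξ.setVar i (k + 1))) :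
    Runs orc (.forLoop i N P) μ (n * (c + 2) + 2)
      fun ν => Frame (.forLoop i N P) μ ν ∧ ν.vars i = n ∧ J n ν := by
  have hF0 : Frame (.forLoop i N P) μ (μ.setVar i 0) := by
    refine ⟨fun x hx => ?_, fun _ _ => rfl, fun _ => rfl, fun _ => rfl⟩
    have : x ≠ i := by
      rintro rfl; simp [Prog.forLoop, Prog.modVars] at hx
    simp [this]
  have hwhile : Runs orc (.whilele (.add (.var i) (.const 1)) N
      (.seq P (.assign i (.add (.var i) (.const 1))))) (μ.setVar i 0) (n * (c + 1 + 1) + 1)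
      fun ν => Frame (.forLoop i N P) μ ν ∧ ν.vars i = n ∧ J n ν := by
    refine Runs.whilele (fun r ν => ∃ k, k + r = n ∧ Frame (.forLoop i N P) μ ν ∧
      ν.vars i = k ∧ J k ν) ?_ ?_ ⟨0, by simp, hF0, by simp, h0⟩
    · rintro r ν ⟨k, hk, hF, hνi, hJ⟩ hg
      rw [Expr.ev_add, Expr.ev_var, Expr.ev_const, hN ν hF, hνi] at hg
      have hkn : k < n := by omega
      refine Runs.seq ((hstep k hkn ν hF hνi hJ).frame.mono le_rfl ?_)
      rintro ξ ⟨hF', hJ'⟩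
      refine Runs.assign ?_
      have hξi : ξ.vars i = k := by rw [hF'.vars i hi, hνi]
      rw [Expr.ev_add, Expr.ev_var, Expr.ev_const, hξi]
      refine ⟨r - 1, by omega, k + 1, by omega, ?_, by simp, hJ'⟩
      refine ⟨fun x hx => ?_, fun a ha => ?_, fun h => ?_, fun h => ?_⟩
      · have h1 : x ≠ i ∧ x ∉ P.modVars := by
          simp only [Prog.forLoop, Prog.modVars, List.mem_append, List.mem_singleton, not_or] at hx
          exact ⟨hx.1, hx.2.1⟩
        rw [Mem.setVar_vars, if_neg h1.1, hF'.vars x h1.2, hF.vars x hx]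
      · have h1 : a ∉ P.modArrs := by simpa [Prog.forLoop, Prog.modArrs] using ha
        rw [Mem.setVar_arr, hF'.arr a h1, hF.arr a ha]
      · have h1 : P.silent = true := by simpa [Prog.forLoop, Prog.silent] using h
        rw [Mem.setVar_out, hF'.out h1, hF.out h]
      · have h1 : P.oracleFree = true := by simpa [Prog.forLoop, Prog.oracleFree] using h
        rw [Mem.setVar_calls, hF'.calls h1, hF.calls h]
    · rintro r ν ⟨k, hk, hF, hνi, hJ⟩ hg
      rw [Expr.ev_add, Expr.ev_var, Expr.ev_const, hN ν hF, hνi] at hg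
      obtain rfl : k = n := by omega
      exact ⟨hF, hνi, hJ⟩
  exact (Runs.seq (Runs.assign hwhile)).cost (by rw [add_assoc]; omega)

/-! ### The game of a fraction -/

/-- The memory holds the two matrices. -/
structure Holds {m n : ℕ} (A B : Matrix (Fin m) (Fin n) (WithBot ℤ)) (μ : Mem) : Prop where
  rows : μ.vars 0 = m
  cols : μ.vars 1 = n
  valA : μ.arr 0 = valArray A
  maskA : μ.arr 1 = maskArray A
  valB : μ.arr 2 = valArray B
  maskB : μ.arr 3 = maskArray B

/-- Write the game of the fraction with numerator in variable 20 and denominator in variable 21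
into the arrays 4 to 7. -/
def buildGame : Prog :=
  .forLoop 23 (.var 0) (.forLoop 24 (.var 1)
    (.seq (.assign 26 (.const 0)) (.seq (.assign 27 (.var 20)) (.seq
      (.forLoop 25 (.var 21)
        (.seq (.assign 26 (.add (.var 26) (.get 0 (.var 23) (.var 24))))
          (.assign 27 (.add (.var 27) (.get 2 (.var 23) (.var 24))))))
      (.seq (.put 4 (.var 23) (.var 24) (.var 26))
      (.seq (.put 5 (.var 23) (.var 24) (.get 1 (.var 23) (.var 24)))
      (.seq (.put 4 (.add (.var 0) (.var 23)) (.var 24) (.var 27))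
      (.seq (.put 5 (.add (.var 0) (.var 23)) (.var 24) (.get 3 (.var 23) (.var 24)))
      (.seq (.put 6 (.var 23) (.var 24) (.var 27))
      (.seq (.put 7 (.var 23) (.var 24) (.get 3 (.var 23) (.var 24)))
      (.seq (.put 6 (.add (.var 0) (.var 23)) (.var 24) (.var 26))
        (.put 7 (.add (.var 0) (.var 23)) (.var 24) (.get 1 (.var 23) (.var 24)))))))))))))) 

/-- The entries of the game that come from the position `(i, j)` are in the arrays 4 to 7. -/
def EntryBuilt (arr : ℕ → ℕ → ℕ → ℤ) (m : ℕ) (p q : ℤ) (ν : Mem) (i j : ℕ) : Prop :=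
  (ν.arr 4 i j = q * arr 0 i j ∧ ν.arr 4 (m + i) j = q * arr 2 i j + p) ∧
  (ν.arr 5 i j = arr 1 i j ∧ ν.arr 5 (m + i) j = arr 3 i j) ∧
  (ν.arr 6 i j = q * arr 2 i j + p ∧ ν.arr 6 (m + i) j = q * arr 0 i j) ∧
  (ν.arr 7 i j = arr 3 i j ∧ ν.arr 7 (m + i) j = arr 1 i j)

/-- The machine has no multiplication: the products by `q` are accumulated by `q` additions, which
is the term `q * 4` in the cost. Each position of the input is written twice, to row `i` and to row
`m + i`. -/
theorem buildGame_runs {orc : GameOracle} {μ : Mem} {m n q : ℕ} (hm : μ.vars 0 = m)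
    (hn : μ.vars 1 = n) (hq : μ.vars 21 = q) :
    Runs orc buildGame μ (m * (n * (q * 4 + 14) + 4) + 2)
      fun ν => ∀ i < m, ∀ j < n, EntryBuilt μ.arr m (μ.vars 20) q ν i j := by
  refine ((Runs.forLoop (n := m) (c := n * (q * 4 + 14) + 2)
    (fun i ν => ∀ i' < i, ∀ j < n, EntryBuilt μ.arr m (μ.vars 20) q ν i' j) (by decide) ?_
    ?_ ?_).mono ?_ fun ν h => h.2.2)
  · intro ν hF
    exact (hF.vars 0 (by decide)).trans hm
  · intro i' hi'; omega
  · intro i hi ν hF hνi hJ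
    refine ((Runs.forLoop (n := n) (c := q * 4 + 12)
      (fun j ξ => ∀ i' j', i' < m → j' < n → (i' < i ∨ i' = i ∧ j' < j) →
        EntryBuilt μ.arr m (μ.vars 20) q ξ i' j') (by decide) ?_ ?_ ?_).mono ?_ ?_)
    · intro ξ hG
      exact ((hG.vars 1 (by decide)).trans (hF.vars 1 (by decide))).trans hn
    · intro i' j' hi' hj' h
      exact hJ i' (by omega) j' hj'
    · intro j hj ξ hG hξj hJ'
      have v0 : ξ.vars 0 = m := ((hG.vars 0 (by decide)).trans (hF.vars 0 (by decide))).trans hm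
      have v20 : ξ.vars 20 = μ.vars 20 := (hG.vars 20 (by decide)).trans (hF.vars 20 (by decide))
      have v21 : ξ.vars 21 = q :=
        ((hG.vars 21 (by decide)).trans (hF.vars 21 (by decide))).trans hq
      have v23 : ξ.vars 23 = i := (hG.vars 23 (by decide)).trans hνi
      have a0 : ξ.arr 0 = μ.arr 0 := (hG.arr 0 (by decide)).trans (hF.arr 0 (by decide))
      have a1 : ξ.arr 1 = μ.arr 1 := (hG.arr 1 (by decide)).trans (hF.arr 1 (by decide))
      have a2 : ξ.arr 2 = μ.arr 2 := (hG.arr 2 (by decide)).trans (hF.arr 2 (by decide))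
      have a3 : ξ.arr 3 = μ.arr 3 := (hG.arr 3 (by decide)).trans (hF.arr 3 (by decide))
      refine (Runs.seq (Runs.assign (Runs.seq (Runs.assign (Runs.seq ((Runs.forLoop (n := q)
        (c := 2) (fun s ζ => ζ.vars 26 = s * μ.arr 0 i j ∧
          ζ.vars 27 = s * μ.arr 2 i j + μ.vars 20) (by decide) ?_ ?_ ?_).mono le_rfl
          (?_ : ∀ _, _ → Runs _ _ _ 8 _))))))).cost (by omega)
      · intro ζ hZ
        simpa using (hZ.vars 21 (by decide)).trans (by simpa using v21)
      · simp [v20]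
      · intro s hs ζ hZ hζs hJs
        have w23 : ζ.vars 23 = i := (hZ.vars 23 (by decide)).trans (by simpa using v23)
        have w24 : ζ.vars 24 = j := (hZ.vars 24 (by decide)).trans (by simpa using hξj)
        have b0 : ζ.arr 0 = μ.arr 0 := (hZ.arr 0 (by decide)).trans (by simpa using a0)
        have b2 : ζ.arr 2 = μ.arr 2 := (hZ.arr 2 (by decide)).trans (by simpa using a2)
        refine Runs.seq (Runs.assign (Runs.assign ?_))
        simp only [Expr.ev_add, Expr.ev_var, Expr.ev_get, Mem.setVar_vars, Mem.setVar_arr]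
        norm_num [w23, w24, b0, b2, hJs.1, hJs.2]
        constructor <;> ring
      · rintro ζ ⟨hZ, -, hJs⟩
        have w0 : ζ.vars 0 = m := (hZ.vars 0 (by decide)).trans (by simpa using v0)
        have w23 : ζ.vars 23 = i := (hZ.vars 23 (by decide)).trans (by simpa using v23)
        have w24 : ζ.vars 24 = j := (hZ.vars 24 (by decide)).trans (by simpa using hξj)
        have b1 : ζ.arr 1 = μ.arr 1 := (hZ.arr 1 (by decide)).trans (by simpa using a1)
        have b3 : ζ.arr 3 = μ.arr 3 := (hZ.arr 3 (by decide)).trans (by simpa using a3)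
        have b4 : ζ.arr 4 = ξ.arr 4 := hZ.arr 4 (by decide)
        have b5 : ζ.arr 5 = ξ.arr 5 := hZ.arr 5 (by decide)
        have b6 : ζ.arr 6 = ξ.arr 6 := hZ.arr 6 (by decide)
        have b7 : ζ.arr 7 = ξ.arr 7 := hZ.arr 7 (by decide)
        refine (Runs.seq (Runs.put (Runs.seq (Runs.put (Runs.seq (Runs.put (Runs.seq (Runs.put
          (Runs.seq (Runs.put (Runs.seq (Runs.put (Runs.seq (Runs.put (Runs.put ?_)))))))))))))))
        have e1 : ((m : ℤ) + i).toNat = m + i := by omega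
        intro i' j' hi' hj' hlt
        have hold : ¬ (i' = i ∧ j' = j) → EntryBuilt μ.arr m (μ.vars 20) q ξ i' j' := fun h =>
          hJ' i' j' hi' hj' (by omega)
        -- Since `i < m`, writes to the upper and to the lower half never collide.
        have c1 : ∀ k, ¬ (m + k = i) := fun k => by omega
        have c2 : ¬ (i' = m + i) := by omega
        unfold EntryBuilt at hold ⊢
        simp only [Expr.ev_add, Expr.ev_var, Expr.ev_get, Mem.setArr_vars, Mem.setVar_arr,
          Mem.setArr_arr, w0, w23, w24, Int.toNat_natCast, e1, b1, b3, b4, b5, b6, b7, hJs.1,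
          hJs.2, c2, c1, Nat.add_left_cancel_iff]
        norm_num
        by_cases h : i' = i ∧ j' = j
        · simp [h.1, h.2]
        · simpa [h, c1] using hold h
    · exact le_of_eq (by ring)
    · rintro ξ ⟨hG, -, hJ'⟩ i' hi' j' hj'
      have : EntryBuilt μ.arr m (μ.vars 20) q ξ i' j' := hJ' i' j' (by omega) hj' (by omega)
      exact this
  · exact le_of_eq (by ring)

/-- The game in the arrays 4 to 7. -/
def storedGame (μ : Mem) : Game :=
  (μ.st 0).readGame (.add (.var 0) (.var 0)) (.var 1) 4 5 6 7

section StoredGame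

variable {m n : ℕ} {A B : Matrix (Fin m) (Fin n) (WithBot ℤ)} {μ ν : Mem}

theorem storedGame_eq (hm : μ.vars 0 = m) (hn : μ.vars 1 = n) : storedGame μ =
    ⟨m + m, n, (μ.st 0).readMatrix 4 5 (m + m) n, (μ.st 0).readMatrix 6 7 (m + m) n⟩ := by
  have e1 : ((Expr.add (.var 0) (.var 0)).eval (μ.st 0)).toNat = m + m := by
    rw [Expr.eval_st, Expr.ev_add, Expr.ev_var, hm]; omega
  have e2 : ((Expr.var 1).eval (μ.st 0)).toNat = n := by
    rw [Expr.eval_st, Expr.ev_var, hn]; omega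
  simp only [storedGame, State.readGame]
  rw [e1, e2]

theorem valArray_apply (A : Matrix (Fin m) (Fin n) (WithBot ℤ)) (i : Fin m) (j : Fin n) :
    valArray A i j = (A i j).unbotD 0 := by
  simp [valArray, store]

theorem maskArray_apply (A : Matrix (Fin m) (Fin n) (WithBot ℤ)) (i : Fin m) (j : Fin n) :
    maskArray A i j = if A i j = ⊥ then 0 else 1 := by
  simp [maskArray, store]

theorem affine_eq_ite (A : Matrix (Fin m) (Fin n) (WithBot ℤ)) (p q : ℤ) (i : Fin m)
    (j : Fin n) : affine q p A i j = if maskArray A i j = 0 then ⊥ else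
      ((q * valArray A i j + p : ℤ) : WithBot ℤ) := by
  rw [maskArray_apply, valArray_apply, affine]
  cases A i j with
  | bot => simp
  | coe a =>
    rw [if_neg (WithBot.coe_ne_bot), if_neg one_ne_zero, WithBot.unbotD_coe, WithBot.map_coe]

theorem storedGame_eq_pairGame (hμ : Holds A B μ) (hm : ν.vars 0 = m) (hn : ν.vars 1 = n)
    {p q : ℤ} (h : ∀ i < m, ∀ j < n, EntryBuilt μ.arr m p q ν i j) :
    storedGame ν = pairGame A B p q := by
  have key : ∀ {v k : ℕ} {X Y : Matrix (Fin m) (Fin n) (WithBot ℤ)} {s t : ℤ},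
      (∀ (i : Fin m) (j : Fin n), ν.arr v i j = q * valArray X i j + s ∧
        ν.arr v (m + i) j = q * valArray Y i j + t ∧ ν.arr k i j = maskArray X i j ∧
        ν.arr k (m + i) j = maskArray Y i j) →
      (ν.st 0).readMatrix v k (m + m) n = stack (affine q s X) (affine q t Y) := by
    intro v k X Y s t hXY
    funext i j
    refine Fin.addCases (fun i => ?_) (fun i => ?_) i
    · rw [stack_castAdd, affine_eq_ite, ← (hXY i j).1, ← (hXY i j).2.2.1]
      rfl
    · rw [stack_natAdd, affine_eq_ite, ← (hXY i j).2.1, ← (hXY i j).2.2.2]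
      rfl
  rw [storedGame_eq hm hn, pairGame]
  congr 1
  · refine key fun i j => ?_
    obtain ⟨⟨h1, h2⟩, ⟨h3, h4⟩, -⟩ := h i i.2 j j.2
    rw [h1, h2, h3, h4, hμ.valA, hμ.valB, hμ.maskA, hμ.maskB]
    simp
  · refine key fun i j => ?_
    obtain ⟨-, -, ⟨h1, h2⟩, ⟨h3, h4⟩⟩ := h i i.2 j j.2
    rw [h1, h2, h3, h4, hμ.valA, hμ.valB, hμ.maskA, hμ.maskB]
    simp

end StoredGame

/-! ### Testing a fraction -/

/-- The program `T` decides whether the fraction with numerator in variable 20 and denominator in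
variable 21 belongs to `S`; the result in variable 22 is nonnegative in this case. -/
def Tests (orc : GameOracle) (T : Prog) (S : Set ℝ) (Env : Mem → Prop) (Adm : ℤ → ℤ → Prop)
    (K : ℕ) (Pr : Game → Prop) : Prop :=
  ∀ μ, Env μ → 0 < μ.vars 21 → Adm (μ.vars 20) (μ.vars 21) →
    Runs orc T μ K fun ν => (0 ≤ ν.vars 22 ↔ (μ.vars 20 / μ.vars 21 : ℝ) ∈ S) ∧
      ∃ l : List Game, ν.calls = μ.calls ++ l ∧ l.length ≤ 1 ∧ ∀ G ∈ l, Pr G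

/-- The test by a call to the oracle. -/
def oracleTest : Prog :=
  .seq buildGame (.query 22 (.add (.var 0) (.var 0)) (.var 1) 4 5 6 7)

theorem oracleTest_tests {orc : GameOracle} (horc : orc.Correct) {m n M W Q : ℕ}
    {A B : Matrix (Fin m) (Fin n) (WithBot ℤ)} (h : Admissible A B) (hA : EntriesBounded A M)
    (hB : EntriesBounded B M) :
    Tests orc oracleTest (spec A B) (Holds A B) (fun p q => q ≤ Q ∧ q * M + |p| ≤ W)
      (m * (n * (Q * 4 + 14) + 4) + 3) (fun G => G ∈ gameClass (2 * m) n W) := by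
  intro μ hμ hq0 ⟨hQ, hW⟩
  obtain ⟨q, hq⟩ := Int.eq_ofNat_of_zero_le hq0.le
  refine (Runs.seq ((buildGame_runs hμ.rows hμ.cols hq).frame.mono le_rfl
    fun ν hν => ?_)).cost (K := m * (n * (q * 4 + 14) + 4) + 2 + 1) ?_
  · obtain ⟨hF, hν⟩ := hν
    have hG := storedGame_eq_pairGame hμ ((hF.vars 0 (by decide)).trans hμ.rows)
      ((hF.vars 1 (by decide)).trans hμ.cols) hν
    refine Runs.query hG ⟨?_, [pairGame A B (μ.vars 20) q], ?_, by simp, ?_⟩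
    · have : (ν.ask orc 22 (pairGame A B (μ.vars 20) q)).vars 22 =
        orc.answer (pairGame A B (μ.vars 20) q) := by simp [Mem.ask]
      rw [this, horc _ (pairGame_valid h _ _), Game.value_nonneg_iff (pairGame_valid h _ _),
        solv_pairGame_iff (hq ▸ hq0), hq]
    · simp only [Mem.ask]
      rw [hF.calls (by decide)]
    · intro G hG
      rw [List.mem_singleton] at hG
      subst hG
      exact pairGame_mem_gameClass h hA hB (by omega) (by rw [hq] at hW; exact hW)
  · have : q ≤ Q := by rw [hq] at hQ; exact_mod_cast hQ
    have : m * (n * (q * 4 + 14) + 4) ≤ m * (n * (Q * 4 + 14) + 4) := by gcongr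
    omega

/-! ### Maxima -/

/-- The maximum of `val` over the indices `k < N` with positive `mask`; the index is variable 31,
the maximum is variable 29, and variable 30 tells whether there was an index with positive mask. -/
def maxLoop (N mask val : Expr) : Prog :=
  .seq (.assign 30 (.const 0)) (.seq (.assign 29 (.const 0)) (.forLoop 31 N
    (.ifle (.const 1) mask
      (.ifle (.const 1) (.var 30)
        (.ifle (.add (.var 29) (.const 1)) val (.assign 29 val) .skip)
        (.seq (.assign 29 val) (.assign 30 (.const 1)))) .skip)))

/-- No integer can serve as the initial value of a maximum, so a flag in variable 30 makes the first
admissible index initialize it. If there is no such index, nothing is claimed about the result. -/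
theorem maxLoop_runs {orc : GameOracle} {μ : Mem} {N mask val : Expr} {n : ℕ} {f g : ℕ → ℤ}
    (hN : ∀ ν, Frame (maxLoop N mask val) μ ν → N.ev ν = n)
    (hmask : ∀ k < n, ∀ ν, Frame (maxLoop N mask val) μ ν → ν.vars 31 = k → mask.ev ν = f k)
    (hval : ∀ k < n, ∀ ν, Frame (maxLoop N mask val) μ ν → ν.vars 31 = k → val.ev ν = g k) :
    Runs orc (maxLoop N mask val) μ (n * 7 + 4) fun ν =>
      (∀ k < n, 1 ≤ f k → g k ≤ ν.vars 29) ∧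
      ((∃ k < n, 1 ≤ f k) → ∃ k < n, 1 ≤ f k ∧ ν.vars 29 = g k) := by
  have hfr : ∀ {P : Prog} {μ' ν : Mem}, Frame P μ' ν → (∀ x ∈ P.modVars, x ∈ [29, 30, 31]) →
      P.modArrs = [] → P.silent = true → P.oracleFree = true →
      Frame (maxLoop N mask val) μ' ν := by
    intro P μ' ν h h1 h2 h3 h4
    refine h.mono (fun x hx hx' => hx ?_) (fun x _ => by rw [h2]; simp) (fun _ => h3) fun _ => h4
    have := h1 x hx'
    simp only [List.mem_cons, List.not_mem_nil, or_false] at this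
    simp only [maxLoop, Prog.forLoop, Prog.modVars, List.mem_append, List.mem_singleton,
      List.not_mem_nil]
    omega
  have h1 : Frame (maxLoop N mask val) μ ((μ.setVar 30 0).setVar 29 0) := by
    refine ⟨fun x hx => ?_, fun _ _ => rfl, fun _ => rfl, fun _ => rfl⟩
    simp only [maxLoop, Prog.forLoop, Prog.modVars, List.mem_append, List.mem_singleton,
      not_or] at hx
    simp [hx.1, hx.2.1]
  refine (Runs.seq (Runs.assign (Runs.seq (Runs.assign ((Runs.forLoop (n := n) (c := 5)
    (fun k ν => (ν.vars 30 = 0 ∧ ∀ k' < k, ¬ 1 ≤ f k') ∨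
      (1 ≤ ν.vars 30 ∧ (∀ k' < k, 1 ≤ f k' → g k' ≤ ν.vars 29) ∧
        ∃ k' < k, 1 ≤ f k' ∧ ν.vars 29 = g k')) (by simp [Prog.modVars]) ?_ ?_ ?_).mono le_rfl
      ?_))))).cost (by omega)
  · intro ν hF
    refine hN ν ?_
    exact h1.trans (hfr hF (by simp [Prog.forLoop, Prog.modVars]) rfl rfl rfl)
      (fun _ h => ⟨h, h⟩) (fun _ h => ⟨h, h⟩) (fun h => ⟨h, h⟩) (fun h => ⟨h, h⟩)
  · left; simp
  · intro k hk ν hF hνk hJ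
    have hF' : Frame (maxLoop N mask val) μ ν :=
      h1.trans (hfr hF (by simp [Prog.forLoop, Prog.modVars]) rfl rfl rfl)
        (fun _ h => ⟨h, h⟩) (fun _ h => ⟨h, h⟩) (fun h => ⟨h, h⟩) (fun h => ⟨h, h⟩)
    have hm := hmask k hk ν hF' hνk
    have hv := hval k hk ν hF' hνk
    refine (Runs.ifle (K := 4) (fun hg => ?_) fun hg => Runs.cost (Runs.skip ?_) (by omega))
    · rw [hm, Expr.ev_const] at hg
      refine (Runs.ifle (K := 3) (fun hg' => (Runs.ifle (K := 1) (fun hlt => Runs.assign ?_)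
        fun hlt => Runs.skip ?_).cost (by omega)) fun hg' => ?_)
      · right
        rw [Expr.ev_add, Expr.ev_var, Expr.ev_const, hv] at hlt
        rw [Expr.ev_const, Expr.ev_var] at hg'
        simp only [Mem.setVar_vars, hv]
        rcases hJ with ⟨h0, -⟩ | ⟨-, h2, h3⟩
        · omega
        · refine ⟨by simpa using hg', fun k' hk' hf => ?_, k, by omega, hg, by simp⟩
          have : g k' ≤ g k := by
            rcases Nat.lt_succ_iff_lt_or_eq.1 hk' with h | rfl
            · have := h2 k' h hf; omega
            · exact le_rfl
          simpa using this
      · right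
        rw [Expr.ev_add, Expr.ev_var, Expr.ev_const, hv] at hlt
        rw [Expr.ev_const, Expr.ev_var] at hg'
        rcases hJ with ⟨h0, -⟩ | ⟨-, h2, k₀, h3, h4, h5⟩
        · omega
        · refine ⟨by simpa using hg', fun k' hk' hf => ?_, k₀, by omega, h4, by simpa using h5⟩
          have : g k' ≤ ν.vars 29 := by
            rcases Nat.lt_succ_iff_lt_or_eq.1 hk' with h | rfl
            · exact h2 k' h hf
            · omega
          simpa using this
      · rw [Expr.ev_const, Expr.ev_var] at hg'
        refine (Runs.seq (Runs.assign (Runs.assign ?_))).cost (by omega)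
        right
        rcases hJ with ⟨-, h2⟩ | ⟨h0, -⟩
        · simp only [Mem.setVar_vars, hv, Expr.ev_const]
          refine ⟨by simp, fun k' hk' hf => ?_, k, by omega, hg, by simp⟩
          rcases Nat.lt_succ_iff_lt_or_eq.1 hk' with h | rfl
          · exact absurd hf (h2 k' h)
          · simp
        · exact absurd h0 hg'
    · rw [hm, Expr.ev_const] at hg
      rcases hJ with ⟨h0, h2⟩ | ⟨h0, h2, k₀, h3, h4, h5⟩
      · left
        refine ⟨by simpa using h0, fun k' hk' => ?_⟩
        rcases Nat.lt_succ_iff_lt_or_eq.1 hk' with h | rfl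
        · exact h2 k' h
        · exact hg
      · right
        refine ⟨by simpa using h0, fun k' hk' hf => ?_, k₀, by omega, h4, by simpa using h5⟩
        rcases Nat.lt_succ_iff_lt_or_eq.1 hk' with h | rfl
        · simpa using h2 k' h hf
        · exact absurd hf hg
  · rintro ν ⟨-, -, ⟨h0, h2⟩ | ⟨h0, h2, h3⟩⟩
    · exact ⟨fun k hk hf => absurd hf (h2 k hk), fun ⟨k, hk, hf⟩ => absurd hf (h2 k hk)⟩
    · exact ⟨h2, fun _ => h3⟩

/-! ### The alternating method -/

/-- Two-sided systems with integer matrices that are given by arrays of values and masks. -/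
structure Arrays where
  p : ℕ
  n : ℕ
  Cv : ℕ → ℕ → ℤ
  Cm : ℕ → ℕ → ℤ
  Dv : ℕ → ℕ → ℤ
  Dm : ℕ → ℕ → ℤ

namespace Arrays

variable (a : Arrays)

/-- The vector `x` with support `S` is a solution. -/
def IsSol (S : Set ℕ) (x : ℕ → ℝ) : Prop :=
  ∀ i < a.p, ∀ j < a.n, j ∈ S → 1 ≤ a.Cm i j →
    ∃ k < a.n, k ∈ S ∧ 1 ≤ a.Dm i k ∧ (a.Cv i j : ℝ) + x j ≤ a.Dv i k + x k

/-- The constraint of the row `i` and the column `j` holds, or `x j` is at the lower bound. -/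
def Stable (R : ℤ) (x : ℕ → ℤ) (i j : ℕ) : Prop :=
  1 ≤ a.Cm i j → -R < x j → ∃ k < a.n, 1 ≤ a.Dm i k ∧ a.Cv i j + x j ≤ a.Dv i k + x k

/-- The entry `x j` is at least the entry of any nonpositive solution. -/
def Dominates (x : ℕ → ℤ) : Prop :=
  ∀ S y, a.IsSol S y → (∀ j < a.n, j ∈ S → y j ≤ 0) → ∀ j < a.n, j ∈ S → y j ≤ x j

variable {a}

/-- Solutions are invariant under translation, so a solution can be shifted to have maximum `0`;
domination at the maximizing index is then the claim. -/
theorem Dominates.exists_nonneg {x : ℕ → ℤ} (hx : a.Dominates x) {S : Set ℕ} {y : ℕ → ℝ}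
    (hy : a.IsSol S y) (hS : ∃ j < a.n, j ∈ S) : ∃ j < a.n, 0 ≤ x j := by
  obtain ⟨j₀, ⟨hj₀, hj₀S⟩, hmax⟩ := Set.exists_max_image {j | j < a.n ∧ j ∈ S} y
    ((Set.finite_lt_nat a.n).subset fun j hj => hj.1) hS
  have h := hx S (fun j => y j - y j₀) (fun i hi j hj hjS hc => by
    obtain ⟨k, hk, hkS, hd, hle⟩ := hy i hi j hj hjS hc
    exact ⟨k, hk, hkS, hd, by linarith⟩)
    (fun j hj hjS => by linarith [hmax j ⟨hj, hjS⟩]) j₀ hj₀ hj₀S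
  simp only [sub_self] at h
  exact ⟨j₀, hj₀, by exact_mod_cast h⟩

/-- Some level set of a stable vector is the support of a solution. -/
theorem exists_isSol_of_stable {R : ℤ} {W : ℕ} {x : ℕ → ℤ}
    (hW : ∀ i < a.p, ∀ j < a.n, ∀ k < a.n, 1 ≤ a.Cm i j → 1 ≤ a.Dm i k →
      |a.Dv i k - a.Cv i j| ≤ W)
    (hR : W * a.n < R) (hst : ∀ i < a.p, ∀ j < a.n, a.Stable R x i j)
    (h0 : ∃ j < a.n, 0 ≤ x j) : ∃ S y, a.IsSol S y ∧ ∃ j < a.n, j ∈ S := by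
  let U : ℕ → Finset ℕ := fun t => (Finset.range a.n).filter fun j => -((W : ℤ) * t) ≤ x j
  have hU : ∀ {t j}, j ∈ U t ↔ j < a.n ∧ -((W : ℤ) * t) ≤ x j := by
    intro t j; simp [U]
  have hmono : ∀ t, U t ⊆ U (t + 1) := by
    intro t j hj
    rw [hU] at hj ⊢
    refine ⟨hj.1, le_trans ?_ hj.2⟩
    push_cast
    linarith [Int.natCast_nonneg W]
  -- The level sets increase with `t`, the first is nonempty and there are only `a.n` columns, so
  -- they cannot grow strictly `a.n` times.
  obtain ⟨t, ht, heq⟩ : ∃ t < a.n, U (t + 1) = U t := by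
    by_contra hcon
    push Not at hcon
    have hcard : ∀ t ≤ a.n, t + 1 ≤ (U t).card := by
      intro t ht
      induction t with
      | zero =>
        obtain ⟨j, hj, hj0⟩ := h0
        exact Finset.card_pos.2 ⟨j, hU.2 ⟨hj, by simpa using hj0⟩⟩
      | succ t ih =>
        have h1 := ih (by omega)
        have h2 := Finset.card_lt_card
          ((hmono t).ssubset_of_ne (hcon t (by omega)).symm)
        omega
    have h1 := hcard a.n le_rfl
    have h2 := Finset.card_le_card (Finset.filter_subset
      (fun j => -((W : ℤ) * a.n) ≤ x j) (Finset.range a.n))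
    rw [Finset.card_range] at h2
    have h3 : (U a.n).card ≤ a.n := h2
    omega
  refine ⟨{j | j ∈ U t}, fun j => x j, ?_, ?_⟩
  · intro i hi j hj hjU hc
    have hj2 := (hU.1 hjU).2
    have htn : (W : ℤ) * t ≤ W * a.n :=
      mul_le_mul_of_nonneg_left (by exact_mod_cast ht.le) (Int.natCast_nonneg W)
    -- From `t < a.n` and `W * a.n < R`, the entry lies above the floor `-R`, so stability provides
    -- `k`. It is at most `W` lower, hence in `U (t + 1) = U t`.
    obtain ⟨k, hk, hd, hle⟩ := hst i hi j hj hc (by linarith)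
    refine ⟨k, hk, ?_, hd, ?_⟩
    swap
    · simp only
      exact_mod_cast hle
    have h1 := abs_le.1 (hW i hi j hj k hk hc hd)
    have : k ∈ U (t + 1) := hU.2 ⟨hk, by push_cast; linarith⟩
    rwa [heq] at this
  · obtain ⟨j, hj, hj0⟩ := h0
    refine ⟨j, hj, hU.2 ⟨hj, le_trans ?_ hj0⟩⟩
    have : (0 : ℤ) ≤ (W : ℤ) * t := by positivity
    linarith

end Arrays

/-- The memory holds the system `a` and the lower bound `-R`. -/
structure HoldsArrays (a : Arrays) (m R : ℕ) (ν : Mem) : Prop where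
  rows : ν.vars 0 + ν.vars 0 = a.p
  cols : ν.vars 1 = a.n
  bound : ν.vars 5 = R
  Cv : ν.arr 4 = a.Cv
  Cm : ν.arr 5 = a.Cm
  Dv : ν.arr 6 = a.Dv
  Dm : ν.arr 7 = a.Dm

theorem HoldsArrays.of_frame {a : Arrays} {m R : ℕ} {P : Prog} {μ ν : Mem}
    (h : HoldsArrays a m R μ) (hF : Frame P μ ν)
    (hv : ∀ x ∈ [0, 1, 5], x ∉ P.modVars) (ha : ∀ x ∈ [4, 5, 6, 7], x ∉ P.modArrs) :
    HoldsArrays a m R ν := by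
  constructor
  · rw [hF.vars 0 (hv 0 (by simp))]; exact h.rows
  · rw [hF.vars 1 (hv 1 (by simp))]; exact h.cols
  · rw [hF.vars 5 (hv 5 (by simp))]; exact h.bound
  · rw [hF.arr 4 (ha 4 (by simp))]; exact h.Cv
  · rw [hF.arr 5 (ha 5 (by simp))]; exact h.Cm
  · rw [hF.arr 6 (ha 6 (by simp))]; exact h.Dv
  · rw [hF.arr 7 (ha 7 (by simp))]; exact h.Dm

/-- Decrease the entries of the vector that violate the constraints of the row in variable 23. -/
def sweepRow : Prog :=
  .seq (maxLoop (.var 1) (.get 7 (.var 23) (.var 31))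
      (.add (.get 6 (.var 23) (.var 31)) (.get 8 (.const 0) (.var 31))))
    (.forLoop 24 (.var 1)
      (.ifle (.const 1) (.get 5 (.var 23) (.var 24))
        (.ifle (.add (.var 29) (.const 1))
          (.add (.get 4 (.var 23) (.var 24)) (.get 8 (.const 0) (.var 24)))
          (.ifle (.sub (.const 1) (.var 5)) (.get 8 (.const 0) (.var 24))
            (.seq (.put 8 (.const 0) (.var 24) (.sub (.get 8 (.const 0) (.var 24)) (.const 1)))
              (.assign 28 (.const 1))) .skip) .skip) .skip))

/-- Sweep over all rows; variable 28 tells whether there was a change. -/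
def sweep : Prog :=
  .seq (.assign 28 (.const 0)) (.forLoop 23 (.add (.var 0) (.var 0)) sweepRow)

/-- The alternating method. -/
def alternate : Prog :=
  .seq (.forLoop 24 (.var 1) (.put 8 (.const 0) (.var 24) (.const 0)))
    (.seq (.assign 28 (.const 1)) (.seq (.whilele (.const 1) (.var 28) sweep)
      (.seq (.assign 22 (.const (-1)))
        (.forLoop 24 (.var 1)
          (.ifle (.const 0) (.get 8 (.const 0) (.var 24)) (.assign 22 (.const 0)) .skip)))))

/-! ### Invariants and termination of the alternating method -/

section Alternate

variable {orc : GameOracle} {a : Arrays} {m R : ℕ}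

/-- The height of a vector above the lower bound. -/
def height (a : Arrays) (R : ℕ) (x : ℕ → ℤ) : ℕ := ∑ j ∈ Finset.range a.n, (x j + R).toNat

/-- The state of a sweep that started with the vector `x₀`, when the vector is `x`. -/
def SweepInv (a : Arrays) (R : ℕ) (x₀ : ℕ → ℤ) (ν : Mem) (ok : ℕ → ℕ → Prop) : Prop :=
  (∀ j < a.n, -(R : ℤ) ≤ ν.arr 8 0 j) ∧ a.Dominates (ν.arr 8 0) ∧
    ((ν.vars 28 = 0 ∧ ν.arr 8 0 = x₀ ∧ ∀ i < a.p, ∀ j < a.n, ok i j → a.Stable R x₀ i j) ∨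
      (ν.vars 28 = 1 ∧ height a R (ν.arr 8 0) < height a R x₀))

/-- The row maximum is computed once and is not refreshed while entries of the vector decrease.
Domination is still sound, since the old vector also dominates all nonpositive solutions; stability
is claimed only if the flag shows that nothing has changed, and then the maximum is current. -/
theorem sweepRow_runs {μ : Mem} (hμ : HoldsArrays a m R μ) {x₀ : ℕ → ℤ} {i : ℕ} (hi : i < a.p)
    (hμi : μ.vars 23 = i) (hD : ∃ k < a.n, 1 ≤ a.Dm i k)
    (hinv : SweepInv a R x₀ μ fun i' _ => i' < i) :
    Runs orc sweepRow μ (a.n * 14 + 6) fun ν => SweepInv a R x₀ ν fun i' _ => i' < i + 1 := by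
  refine (Runs.seq ((maxLoop_runs (n := a.n) (f := a.Dm i)
    (g := fun k => a.Dv i k + μ.arr 8 0 k) ?_ ?_ ?_).frame.mono le_rfl ?_)).cost
    (K := a.n * 7 + 4 + (a.n * 7 + 2)) (by omega)
  · intro ν hF
    exact (hF.vars 1 (by decide)).trans hμ.cols
  · intro k hk ν hF hνk
    have h23 : ν.vars 23 = i := (hF.vars 23 (by decide)).trans hμi
    have h7 := (hF.arr 7 (by decide)).trans hμ.Dm
    simp [h23, h7, hνk]
  · intro k hk ν hF hνk
    have h23 : ν.vars 23 = i := (hF.vars 23 (by decide)).trans hμi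
    have h6 := (hF.arr 6 (by decide)).trans hμ.Dv
    have h8 := hF.arr 8 (by decide)
    simp [h23, h6, h8, hνk]
  rintro ν ⟨hF, hmax, hmax'⟩
  obtain ⟨k₀, hk₀, hDk₀, hmax'⟩ := hmax' hD
  have hν := hμ.of_frame hF (by decide) (by decide)
  have hν8 : ν.arr 8 = μ.arr 8 := hF.arr 8 (by decide)
  have hν28 : ν.vars 28 = μ.vars 28 := hF.vars 28 (by decide)
  have hν23 : ν.vars 23 = i := (hF.vars 23 (by decide)).trans hμi
  refine (Runs.forLoop (n := a.n) (c := 5) (fun j ξ =>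
    SweepInv a R x₀ ξ (fun i' j' => i' < i ∨ (i' = i ∧ j' < j)) ∧
      (ξ.vars 28 = 0 → ξ.arr 8 0 = μ.arr 8 0)) (by decide) ?_ ?_ ?_).mono le_rfl ?_
  · intro ξ hG
    exact (hG.vars 1 (by decide)).trans hν.cols
  · obtain ⟨h1, h2, h3⟩ := hinv
    refine ⟨⟨by simpa [hν8] using h1, by simpa [hν8] using h2, ?_⟩, by simp [hν8]⟩
    simpa [hν8, hν28] using h3
  · rintro j hj ξ hG hξj ⟨⟨h1, h2, h3⟩, hsame⟩
    have hξ := hν.of_frame hG (by decide) (by decide)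
    have hξ23 : ξ.vars 23 = i := (hG.vars 23 (by decide)).trans hν23
    have hξ29 : ξ.vars 29 = ν.vars 29 := hG.vars 29 (by decide)
    -- nothing is changed
    have hkeep : (ξ.vars 28 = 0 → a.Stable R (ξ.arr 8 0) i j) →
        SweepInv a R x₀ (ξ.setVar 24 (j + 1)) (fun i' j' => i' < i ∨ (i' = i ∧ j' < j + 1)) ∧
        ((ξ.setVar 24 (j + 1)).vars 28 = 0 → (ξ.setVar 24 (j + 1)).arr 8 0 = μ.arr 8 0) := by
      intro hst
      refine ⟨⟨by simpa using h1, by simpa using h2, ?_⟩, by simpa using hsame⟩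
      rcases h3 with ⟨h3, h4, h5⟩ | h3
      · left
        refine ⟨by simpa using h3, by simpa using h4, fun i' hi' j' hj' hok => ?_⟩
        by_cases hij : i' = i ∧ j' = j
        · rw [hij.1, hij.2, ← h4]; exact hst h3
        · exact h5 i' hi' j' hj' (by omega)
      · right; simpa using h3
    have hC : (Expr.get 5 (.var 23) (.var 24)).ev ξ = a.Cm i j := by
      simp [hξ23, hξj, hξ.Cm]
    have hV : (Expr.add (.get 4 (.var 23) (.var 24)) (.get 8 (.const 0) (.var 24))).ev ξ =
        a.Cv i j + ξ.arr 8 0 j := by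
      simp [hξ23, hξj, hξ.Cv]
    have hX : (Expr.get 8 (.const 0) (.var 24)).ev ξ = ξ.arr 8 0 j := by simp [hξj]
    refine Runs.ifle (K := 4) (fun hg1 => ?_) fun hg1 => Runs.cost (Runs.skip ?_) (by omega)
    · rw [hC, Expr.ev_const] at hg1
      refine Runs.ifle (K := 3) (fun hg2 => ?_) fun hg2 => Runs.cost (Runs.skip ?_) (by omega)
      · rw [hV, Expr.ev_add, Expr.ev_var, Expr.ev_const, hξ29] at hg2
        refine Runs.ifle (K := 2) (fun hg3 => ?_) fun hg3 => Runs.cost (Runs.skip ?_) (by omega)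
        · rw [hX, Expr.ev_sub, Expr.ev_var, Expr.ev_const, hξ.bound] at hg3
          refine Runs.seq (Runs.put (Runs.assign ?_))
          have harr : (((ξ.setArr 8 0 j (ξ.arr 8 0 j - 1)).setVar 28 1).setVar 24 (j + 1)).arr 8 0
              = Function.update (ξ.arr 8 0) j (ξ.arr 8 0 j - 1) := by
            funext j'
            simp [Function.update_apply]
          simp only [hX, Expr.ev_sub, Expr.ev_const, Expr.ev_var, hξj, Int.toNat_natCast,
            Int.toNat_zero]
          unfold SweepInv
          rw [harr]
          refine ⟨⟨fun j' hj' => ?_, fun S y hy hy0 j' hj' hjS => ?_, Or.inr ⟨by simp, ?_⟩⟩,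
            by simp⟩
          · by_cases hjj : j' = j
            · subst hjj; rw [Function.update_self]; omega
            · rw [Function.update_of_ne hjj]; exact h1 j' hj'
          · by_cases hjj : j' = j
            -- The solution satisfies `c + y j ≤ d + y k`, which is at most the row maximum, and by
            -- the guard this is at most `c + x j - 1`. So a decrement by one keeps `x` above the
            -- real vector `y`.
            · subst hjj
              rw [Function.update_self]
              obtain ⟨k, hk, hkS, hDk, hle⟩ := hy i hi j' hj hjS hg1
              have e1 : (a.Dv i k : ℝ) + y k ≤ ν.vars 29 := by
                have e2 := hmax k hk hDk
                have e3 : y k ≤ μ.arr 8 0 k := hinv.2.1 S y hy hy0 k hk hkS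
                have e4 : (a.Dv i k : ℝ) + μ.arr 8 0 k ≤ ν.vars 29 := by exact_mod_cast e2
                linarith
              have e5 : ((ν.vars 29 : ℝ) + 1) ≤ a.Cv i j' + ξ.arr 8 0 j' := by
                exact_mod_cast hg2
              push_cast
              linarith
            · rw [Function.update_of_ne hjj]; exact h2 S y hy hy0 j' hj' hjS
          · have hlt : height a R (Function.update (ξ.arr 8 0) j (ξ.arr 8 0 j - 1)) <
                height a R (ξ.arr 8 0) := by
              refine Finset.sum_lt_sum (fun j' _ => ?_) ⟨j, Finset.mem_range.2 hj, ?_⟩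
              · by_cases hjj : j' = j
                · subst hjj; rw [Function.update_self]; omega
                · rw [Function.update_of_ne hjj]
              · rw [Function.update_self]; omega
            rcases h3 with ⟨-, h4, -⟩ | ⟨-, h4⟩
            · rwa [← h4]
            · exact hlt.trans h4
        · rw [hX, Expr.ev_sub, Expr.ev_var, Expr.ev_const, hξ.bound] at hg3
          exact hkeep fun _ _ h => by omega
      · rw [hV, Expr.ev_add, Expr.ev_var, Expr.ev_const, hξ29] at hg2
        refine hkeep fun h0 _ _ => ⟨k₀, hk₀, hDk₀, ?_⟩
        rw [hsame h0] at hg2 ⊢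
        omega
    · rw [hC, Expr.ev_const] at hg1
      exact hkeep fun _ h => absurd h hg1
  · rintro ξ ⟨-, -, ⟨h1, h2, h3⟩, -⟩
    refine ⟨h1, h2, ?_⟩
    rcases h3 with ⟨h3, h4, h5⟩ | h3
    · exact Or.inl ⟨h3, h4, fun i' hi' j' hj' hok => h5 i' hi' j' hj' (by omega)⟩
    · exact Or.inr h3

theorem sweep_runs {μ : Mem} (hμ : HoldsArrays a m R μ)
    (hD : ∀ i < a.p, ∃ k < a.n, 1 ≤ a.Dm i k) (hlow : ∀ j < a.n, -(R : ℤ) ≤ μ.arr 8 0 j)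
    (hdom : a.Dominates (μ.arr 8 0)) :
    Runs orc sweep μ (a.p * (a.n * 14 + 8) + 3) fun ν =>
      SweepInv a R (μ.arr 8 0) ν fun _ _ => True := by
  refine (Runs.seq (Runs.assign ((Runs.forLoop (n := a.p) (c := a.n * 14 + 6)
    (fun i ν => SweepInv a R (μ.arr 8 0) ν fun i' _ => i' < i) (by decide) ?_ ?_ ?_).mono le_rfl
      ?_))).cost (K := 1 + (a.p * (a.n * 14 + 8) + 2)) (by omega)
  · intro ν hF
    have h0 : ν.vars 0 = μ.vars 0 := (hF.vars 0 (by decide)).trans (by simp)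
    rw [Expr.ev_add, Expr.ev_var, h0]
    exact hμ.rows
  · exact ⟨by simpa using hlow, by simpa using hdom, Or.inl ⟨by simp, by simp, by simp⟩⟩
  · intro i hi ν hF hνi hJ
    have hν : HoldsArrays a m R ν := by
      refine HoldsArrays.of_frame (μ := μ.setVar 28 (Expr.ev μ (.const 0))) ?_ hF (by decide)
        (by decide)
      exact ⟨by simpa using hμ.rows, by simpa using hμ.cols, by simpa using hμ.bound,
        hμ.Cv, hμ.Cm, hμ.Dv, hμ.Dm⟩
    refine (sweepRow_runs hν hi hνi (hD i hi) hJ).mono le_rfl ?_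
    rintro ξ ⟨h1, h2, h3⟩
    exact ⟨by simpa using h1, by simpa using h2, by simpa using h3⟩
  · rintro ν ⟨-, -, h1, h2, h3⟩
    refine ⟨h1, h2, ?_⟩
    rcases h3 with ⟨h3, h4, h5⟩ | h3
    · exact Or.inl ⟨h3, h4, fun i' hi' j' hj' _ => h5 i' hi' j' hj' hi'⟩
    · exact Or.inr h3

/-- Every sweep that changes something lowers the height, which is `n R` for the zero vector, so at
most `n R + 1` sweeps occur. The final vector is stable and dominates, and having an entry `≥ 0` is
then both necessary and sufficient for solvability. -/
theorem alternate_runs {μ : Mem} (hμ : HoldsArrays a m R μ)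
    (hD : ∀ i < a.p, ∃ k < a.n, 1 ≤ a.Dm i k) {W : ℕ}
    (hW : ∀ i < a.p, ∀ j < a.n, ∀ k < a.n, 1 ≤ a.Cm i j → 1 ≤ a.Dm i k →
      |a.Dv i k - a.Cv i j| ≤ W) (hR : W * a.n < R) :
    Runs orc alternate μ (a.n * 7 + 7 + (a.n * R + 1) * (a.p * (a.n * 14 + 8) + 4)) fun ν =>
      0 ≤ ν.vars 22 ↔ ∃ S y, a.IsSol S y ∧ ∃ j < a.n, j ∈ S := by
  have hR' : (W : ℤ) * a.n < R := by exact_mod_cast hR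
  refine (Runs.seq ((Runs.forLoop (n := a.n) (c := 1)
    (fun j ν => ∀ j' < j, ν.arr 8 0 j' = 0) (by decide) ?_ (by simp) ?_).mono le_rfl
    (?_ : ∀ _, _ → Runs _ _ _ ((a.n * R + 1) * (a.p * (a.n * 14 + 8) + 4) + 1 +
      (a.n * 4 + 4)) _))).cost (by ring_nf; omega)
  · intro ν hF
    exact (hF.vars 1 (by decide)).trans hμ.cols
  · intro j hj ν hF hνj hJ
    refine Runs.put ?_
    intro j' hj'
    by_cases hjj : j' = j
    · simp [hjj, hνj]
    · have := hJ j' (by omega)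
      simp [hjj, hνj, this]
  rintro ν ⟨hF, -, h0⟩
  have hν := hμ.of_frame hF (by decide) (by decide)
  refine (Runs.seq (Runs.assign (Runs.seq ((Runs.whilele
    (c := a.p * (a.n * 14 + 8) + 3) (k := a.n * R + 1)
    (Q := fun ξ => HoldsArrays a m R ξ ∧ a.Dominates (ξ.arr 8 0) ∧
      ∀ i < a.p, ∀ j < a.n, a.Stable R (ξ.arr 8 0) i j)
    (fun r ξ => HoldsArrays a m R ξ ∧ (∀ j < a.n, -(R : ℤ) ≤ ξ.arr 8 0 j) ∧
      a.Dominates (ξ.arr 8 0) ∧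
      ((ξ.vars 28 = 1 ∧ r = height a R (ξ.arr 8 0) + 1) ∨
        (ξ.vars 28 = 0 ∧ ∀ i < a.p, ∀ j < a.n, a.Stable R (ξ.arr 8 0) i j)))
      ?_ ?_ ?_).mono le_rfl (?_ : ∀ _, _ → Runs _ _ _ (a.n * 4 + 3) _))))).cost
      (by ring_nf; omega)
  · rintro r ξ ⟨hξ, hlow, hdom, h⟩ hg
    rw [Expr.ev_const, Expr.ev_var] at hg
    rcases h with ⟨-, rfl⟩ | ⟨h, -⟩
    · refine (sweep_runs hξ hD hlow hdom).frame.mono le_rfl ?_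
      rintro ζ ⟨hG, h1, h2, h3⟩
      have hζ := hξ.of_frame hG (by decide) (by decide)
      rcases h3 with ⟨h3, h4, h5⟩ | ⟨h3, h4⟩
      · exact ⟨0, by omega, hζ, h1, h2, Or.inr ⟨h3, fun i hi j hj => by
          rw [h4]; exact h5 i hi j hj trivial⟩⟩
      · exact ⟨_, by omega, hζ, h1, h2, Or.inl ⟨h3, rfl⟩⟩
    · omega
  · rintro r ξ ⟨hξ, hlow, hdom, h⟩ hg
    rw [Expr.ev_const, Expr.ev_var] at hg
    rcases h with ⟨h, -⟩ | ⟨-, h⟩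
    · omega
    · exact ⟨hξ, hdom, h⟩
  · refine ⟨⟨by simpa using hν.rows, by simpa using hν.cols, by simpa using hν.bound,
        hν.Cv, hν.Cm, hν.Dv, hν.Dm⟩, fun j hj => ?_, fun S y _ hy j hj hjS => ?_,
        Or.inl ⟨by simp, ?_⟩⟩
    · simp [h0 j hj]
    · simpa [h0 j hj] using hy j hj hjS
    · have : height a R ((ν.setVar 28 ((Expr.const 1).ev ν)).arr 8 0) =
          ∑ j ∈ Finset.range a.n, R := by
        refine Finset.sum_congr rfl fun j hj => ?_
        simp [h0 j (Finset.mem_range.1 hj)]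
      rw [this]
      simp
  · rintro ξ ⟨hξ, hdom, hst⟩
    refine (Runs.seq (Runs.assign ((Runs.forLoop (n := a.n) (c := 2)
      (fun j ζ => (ζ.vars 22 = -1 ∨ ζ.vars 22 = 0) ∧
        (ζ.vars 22 = 0 ↔ ∃ j' < j, 0 ≤ ξ.arr 8 0 j')) (by decide) ?_ (by simp) ?_).mono le_rfl
      ?_))).cost (by omega)
    · intro ζ hG
      exact (hG.vars 1 (by decide)).trans (by simpa using hξ.cols)
    · rintro j hj ζ hG hζj ⟨h1, h2⟩
      have h8 : ζ.arr 8 = ξ.arr 8 := hG.arr 8 (by decide)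
      have hX : (Expr.get 8 (.const 0) (.var 24)).ev ζ = ξ.arr 8 0 j := by simp [hζj, h8]
      refine Runs.ifle (K := 1) (fun hg => Runs.assign ?_) fun hg => Runs.skip ?_
      · rw [hX, Expr.ev_const] at hg
        refine ⟨by simp, iff_of_true (by simp) ⟨j, by omega, hg⟩⟩
      · rw [hX, Expr.ev_const] at hg
        refine ⟨by simpa using h1, ?_⟩
        have : (ζ.setVar 24 (j + 1)).vars 22 = ζ.vars 22 := by simp
        rw [this, h2]
        constructor
        · rintro ⟨j', hj', h⟩
          exact ⟨j', by omega, h⟩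
        · rintro ⟨j', hj', h⟩
          refine ⟨j', ?_, h⟩
          rcases Nat.lt_succ_iff_lt_or_eq.1 hj' with h' | rfl
          · exact h'
          · exact absurd h hg
    · rintro ζ ⟨-, -, h1, h2⟩
      have h3 : 0 ≤ ζ.vars 22 ↔ ζ.vars 22 = 0 := by omega
      rw [h3, h2]
      constructor
      · exact Arrays.exists_isSol_of_stable hW hR' hst
      · rintro ⟨S, y, hy, hS⟩
        exact hdom.exists_nonneg hy hS

end Alternate

/-! ### The test without an oracle -/

/-- The test by the alternating method. -/
def selfTest : Prog := .seq buildGame alternate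

theorem readMatrix_eq_coe_iff {s : State} {v k r c : ℕ} {i : Fin r} {j : Fin c} {z : ℤ} :
    s.readMatrix v k r c i j = z ↔ s.arr k i j ≠ 0 ∧ s.arr v i j = z := by
  simp only [State.readMatrix]
  by_cases h : s.arr k i j = 0 <;> simp [h, WithBot.coe_inj]

theorem maskArray_nonneg {m n : ℕ} (A : Matrix (Fin m) (Fin n) (WithBot ℤ)) (i j : ℕ) :
    0 ≤ maskArray A i j := by
  unfold maskArray store
  split_ifs
  · dsimp only
    split_ifs <;> simp
  · exact le_rfl

/-- The system in the arrays 4 to 7. -/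
def storedArrays (m n : ℕ) (ν : Mem) : Arrays := ⟨m + m, n, ν.arr 4, ν.arr 5, ν.arr 6, ν.arr 7⟩

section SelfTest

variable {m n : ℕ} {ν : Mem}

theorem solv_readMatrix_iff (h5 : ∀ i < m + m, ∀ j < n, 0 ≤ ν.arr 5 i j)
    (h7 : ∀ i < m + m, ∀ j < n, 0 ≤ ν.arr 7 i j) :
    Solv ((ν.st 0).readMatrix 4 5 (m + m) n) ((ν.st 0).readMatrix 6 7 (m + m) n) 0 ↔
      ∃ S y, (storedArrays m n ν).IsSol S y ∧ ∃ j < n, j ∈ S := by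
  have m5 : ∀ i < m + m, ∀ j < n, (ν.arr 5 i j ≠ 0 ↔ 1 ≤ ν.arr 5 i j) := fun i hi j hj => by
    have := h5 i hi j hj; omega
  have m7 : ∀ i < m + m, ∀ j < n, (ν.arr 7 i j ≠ 0 ↔ 1 ≤ ν.arr 7 i j) := fun i hi j hj => by
    have := h7 i hi j hj; omega
  constructor
  · rintro ⟨S, x, ⟨j₀, hj₀⟩, hx⟩
    refine ⟨{j | ∃ h : j < n, ⟨j, h⟩ ∈ S}, fun j => if h : j < n then x ⟨j, h⟩ else 0, ?_,
      j₀, j₀.2, j₀.2, hj₀⟩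
    rintro i hi j hj ⟨_, hjS⟩ hc
    obtain ⟨k, hk, d, hd, hle⟩ := hx ⟨i, hi⟩ ⟨j, hj⟩ hjS (ν.arr 4 i j)
      (readMatrix_eq_coe_iff.2 ⟨(m5 i hi j hj).2 hc, rfl⟩)
    obtain ⟨hd1, hd2⟩ := readMatrix_eq_coe_iff.1 hd
    refine ⟨k, k.2, ⟨k.2, hk⟩, (m7 i hi k k.2).1 hd1, ?_⟩
    have hd2' : ν.arr 6 i k = d := hd2
    have hj' : j < n := hj
    simp only [storedArrays, hd2', hj', k.2, dif_pos]
    simpa using hle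
  · rintro ⟨S, y, hy, j₀, hj₀, hj₀S⟩
    refine ⟨{j | (j : ℕ) ∈ S}, fun j => y j, ⟨⟨j₀, hj₀⟩, hj₀S⟩, fun i j hj c hc => ?_⟩
    obtain ⟨hc1, hc2⟩ := readMatrix_eq_coe_iff.1 hc
    obtain ⟨k, hk, hkS, hd, hle⟩ := hy i i.2 j j.2 hj ((m5 i i.2 j j.2).1 hc1)
    refine ⟨⟨k, hk⟩, hkS, ν.arr 6 i k, readMatrix_eq_coe_iff.2 ⟨(m7 i i.2 k hk).2 hd, rfl⟩, ?_⟩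
    have hc2' : ν.arr 4 i j = c := hc2
    simp only [storedArrays, hc2'] at hle
    simpa using hle

end SelfTest

theorem selfTest_tests {orc : GameOracle} {m n M W Q R : ℕ}
    {A B : Matrix (Fin m) (Fin n) (WithBot ℤ)} (h : Admissible A B) (hA : EntriesBounded A M)
    (hB : EntriesBounded B M) (hR : 2 * W * n < R) :
    Tests orc selfTest (spec A B) (fun μ => Holds A B μ ∧ μ.vars 5 = R)
      (fun p q => q ≤ Q ∧ q * M + |p| ≤ W)
      (m * (n * (Q * 4 + 14) + 4) + 2 +
        (n * 7 + 7 + (n * R + 1) * ((m + m) * (n * 14 + 8) + 4))) (fun _ => False) := by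
  rintro μ ⟨hμ, hμR⟩ hq0 ⟨hQ, hW⟩
  obtain ⟨q, hq⟩ := Int.eq_ofNat_of_zero_le hq0.le
  refine (Runs.seq ((buildGame_runs hμ.rows hμ.cols hq).frame.mono le_rfl
    fun ν hν => ?_)).cost (K := m * (n * (q * 4 + 14) + 4) + 2 +
      (n * 7 + 7 + (n * R + 1) * ((m + m) * (n * 14 + 8) + 4))) ?_
  · obtain ⟨hF, hν⟩ := hν
    have h0 : ν.vars 0 = m := (hF.vars 0 (by decide)).trans hμ.rows
    have h1 : ν.vars 1 = n := (hF.vars 1 (by decide)).trans hμ.cols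
    have hG := storedGame_eq_pairGame hμ h0 h1 hν
    rw [storedGame_eq h0 h1] at hG
    have hmask : ∀ i < m + m, ∀ j < n, 0 ≤ ν.arr 5 i j ∧ 0 ≤ ν.arr 7 i j := by
      intro i hi j hj
      rcases lt_or_ge i m with him | him
      · obtain ⟨-, ⟨e1, -⟩, -, e2, -⟩ := hν i him j hj
        rw [e1, e2, hμ.maskA, hμ.maskB]
        exact ⟨maskArray_nonneg _ _ _, maskArray_nonneg _ _ _⟩
      · obtain ⟨k, rfl⟩ := Nat.exists_eq_add_of_le him
        obtain ⟨-, ⟨-, e1⟩, -, -, e2⟩ := hν k (by omega) j hj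
        rw [e1, e2, hμ.maskA, hμ.maskB]
        exact ⟨maskArray_nonneg _ _ _, maskArray_nonneg _ _ _⟩
    have hsolv : Solv ((ν.st 0).readMatrix 4 5 (m + m) n) ((ν.st 0).readMatrix 6 7 (m + m) n) 0 ↔
        (μ.vars 20 / μ.vars 21 : ℝ) ∈ spec A B := by
      have e := congrArg (fun G : Game => Solv G.A G.B 0) hG
      rw [hq, ← solv_pairGame_iff (hq ▸ hq0)]
      exact iff_of_eq e
    have hclass := pairGame_mem_gameClass h hA hB (p := μ.vars 20) (q := q) (by omega)
      (by rw [hq] at hW; exact hW)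
    rw [← hG] at hclass
    obtain ⟨-, -, ⟨-, hrow⟩, hbA, hbB⟩ := hclass
    have harr : HoldsArrays (storedArrays m n ν) m R ν :=
      ⟨by rw [h0]; rfl, h1, (hF.vars 5 (by decide)).trans hμR, rfl, rfl, rfl, rfl⟩
    -- Entries have modulus at most `W`, so their differences have modulus at most `2 W`.
    refine (alternate_runs (W := 2 * W) harr ?_ ?_ hR).frame.mono le_rfl ?_
    · intro i hi
      obtain ⟨k, hk⟩ := hrow ⟨i, hi⟩
      obtain ⟨d, hd⟩ := WithBot.ne_bot_iff_exists.1 hk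
      have hd1 : ν.arr 7 i k ≠ 0 := (readMatrix_eq_coe_iff.1 hd.symm).1
      have := (hmask i hi k k.2).2
      exact ⟨k, k.2, by change 1 ≤ ν.arr 7 i k; omega⟩
    · intro i hi j hj k hk hc hd
      have hc' : ν.arr 5 i j ≠ 0 := by
        have : 1 ≤ ν.arr 5 i j := hc
        omega
      have hd' : ν.arr 7 i k ≠ 0 := by
        have : 1 ≤ ν.arr 7 i k := hd
        omega
      have e1 := hbA ⟨i, hi⟩ ⟨j, hj⟩ (ν.arr 4 i j) (readMatrix_eq_coe_iff.2 ⟨hc', rfl⟩)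
      have e2 := hbB ⟨i, hi⟩ ⟨k, hk⟩ (ν.arr 6 i k) (readMatrix_eq_coe_iff.2 ⟨hd', rfl⟩)
      refine (abs_sub _ _).trans ?_
      push_cast
      change |ν.arr 6 i k| + |ν.arr 4 i j| ≤ _
      linarith
    · rintro ξ ⟨hF', hξ⟩
      refine ⟨?_, [], ?_, by simp, by simp⟩
      · rw [hξ, ← hsolv, solv_readMatrix_iff (fun i hi j hj => (hmask i hi j hj).1)
          fun i hi j hj => (hmask i hi j hj).2]
        rfl
      · rw [hF'.calls (by decide), hF.calls (by decide), List.append_nil]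
  · have : q ≤ Q := by rw [hq] at hQ; exact_mod_cast hQ
    have : m * (n * (q * 4 + 14) + 4) ≤ m * (n * (Q * 4 + 14) + 4) := by gcongr
    omega

/-! ### The main loop -/

/-- Test the fraction `e / f` and put the result into the variable `x`. -/
def testInto (T : Prog) (x : ℕ) (e f : Expr) : Prog :=
  .seq (.assign 20 e) (.seq (.assign 21 f) (.seq T (.assign x (.var 22))))

/-- Write the ends of intervals at the fraction in the variables 8 and 9. -/
def emitEnds : Prog :=
  .seq (.ifle (.const 0) (.var 18)
    (.seq (.ifle (.var 17) (.const 0) (.seq (.emit (.var 8)) (.emit (.var 9))) .skip)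
      (.ifle (.const 0) (.var 19) .skip (.seq (.emit (.var 8)) (.emit (.var 9))))) .skip)
    (.ifle (.const 0) (.var 19) (.assign 17 (.const 1)) (.assign 17 (.const 0)))

/-- Pass to the next fraction with denominator at most `κ`. -/
def nextFraction : Prog :=
  .seq (.assign 14 (.sub (.const 0) (.var 8)))
  (.seq (.assign 15 (.sub (.const 0) (.var 9)))
  (.seq (.assign 16 (.sub (.const 0) (.var 10)))
  (.seq (.whilele (.add (.var 15) (.var 12)) (.var 2)
    (.seq (.assign 14 (.add (.var 14) (.var 11)))
    (.seq (.assign 15 (.add (.var 15) (.var 12)))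
      (.assign 16 (.add (.var 16) (.var 13))))))
  (.seq (.assign 8 (.var 11)) (.seq (.assign 9 (.var 12)) (.seq (.assign 10 (.var 13))
  (.seq (.assign 11 (.var 14)) (.seq (.assign 12 (.var 15)) (.assign 13 (.var 16))))))))))

/-- The first two fractions. -/
def firstFraction : Prog :=
  .seq (.assign 8 (.var 3)) (.seq (.assign 9 (.const 1)) (.seq (.assign 10 (.var 4))
  (.seq (.assign 11 (.const 1)) (.seq (.assign 12 (.var 2)) (.seq (.assign 13 (.const 0))
    (.forLoop 23 (.var 2) (.seq (.assign 11 (.add (.var 11) (.var 3)))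
      (.assign 13 (.add (.var 13) (.var 4)))))))))) 

/-- Each round tests the current fraction and its mediant with the next one; by `spec_between` the
mediant decides the whole open interval. The guard `a + 1 ≤ hi * b` means `a / b < hi`; the product
`hi * b` is kept in variable 10 because it cannot be computed directly. -/
def fractionLoop (T : Prog) : Prog :=
  .whilele (.add (.var 8) (.const 1)) (.var 10)
    (.seq (testInto T 18 (.var 8) (.var 9))
    (.seq (testInto T 19 (.add (.var 8) (.var 11)) (.add (.var 9) (.var 12)))
    (.seq emitEnds nextFraction)))

/-- The point `hi + 1` stands for the ray beyond `hi`; if variable 6 is `0`, that ray is treated as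
disjoint from the set without a test. A still open interval is completed with the code of `+∞`. -/
def lastFraction (T : Prog) : Prog :=
  .seq (testInto T 18 (.var 8) (.var 9))
  (.seq (.ifle (.const 1) (.var 6) (testInto T 19 (.add (.var 4) (.const 1)) (.const 1))
    (.assign 19 (.const (-1))))
  (.seq emitEnds (.ifle (.const 1) (.var 17) (.seq (.emit (.const 0)) (.emit (.const 0))) .skip)))

/-- Scan the fractions from the value of variable 3 to the value of variable 4. -/
def scan (T : Prog) : Prog := .seq firstFraction (.seq (fractionLoop T) (lastFraction T))

/-- The program changes only scratch memory and does not write to the output. -/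
structure IsLocal (T : Prog) : Prop where
  vars : ∀ x < 22, x ∉ T.modVars
  arrs : ∀ a < 4, a ∉ T.modArrs
  silent : T.silent = true

theorem isLocal_oracleTest : IsLocal oracleTest := ⟨by decide, by decide, by decide⟩

theorem isLocal_selfTest : IsLocal selfTest := ⟨by decide, by decide, by decide⟩

section Scan

variable {orc : GameOracle} {T : Prog} {S : Set ℝ} {Env : Mem → Prop} {Adm : ℤ → ℤ → Prop}
  {K : ℕ} {Pr : Game → Prop}

theorem testInto_runs (hT : Tests orc T S Env Adm K Pr) (hloc : IsLocal T) {x : ℕ} {e f : Expr}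
    {μ : Mem} {p q : ℤ} (he : e.ev μ = p) (hf : f.ev (μ.setVar 20 p) = q)
    (hEnv : Env ((μ.setVar 20 p).setVar 21 q)) (hq : 0 < q) (hA : Adm p q) :
    Runs orc (testInto T x e f) μ (K + 3) fun ν =>
      (0 ≤ ν.vars x ↔ (p / q : ℝ) ∈ S) ∧ (∀ y < 20, y ≠ x → ν.vars y = μ.vars y) ∧
      (∀ a < 4, ν.arr a = μ.arr a) ∧ ν.out = μ.out ∧
      ∃ l : List Game, ν.calls = μ.calls ++ l ∧ l.length ≤ 1 ∧ ∀ G ∈ l, Pr G := by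
  refine (Runs.seq (Runs.assign ?_)).cost (K := 1 + (1 + (K + 1))) (by omega)
  rw [he]
  refine Runs.seq (Runs.assign ?_)
  rw [hf]
  refine Runs.seq ((hT _ hEnv (by simpa using hq) (by simpa using hA)).frame.mono le_rfl ?_)
  rintro ν ⟨hF, hν, l, hl, hl1, hPr⟩
  refine Runs.assign ⟨by simpa using hν, fun y hy hyx => ?_, fun a ha => ?_, ?_, l, ?_, hl1, hPr⟩
  · have := hF.vars y (hloc.vars y (by omega))
    have h20 : y ≠ 20 := by omega
    have h21 : y ≠ 21 := by omega
    simp [hyx, this, h20, h21]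
  · exact hF.arr a (hloc.arrs a ha)
  · exact hF.out hloc.silent
  · simpa using hl

/-- The variables 17, 18 and 19 record membership just left of the fraction, at the fraction and
just right of it. They select the move of `PartialOutput`. -/
theorem emitEnds_runs {μ : Mem} {a b : ℤ} {v' : ℝ} (ha : μ.vars 8 = a) (hb : μ.vars 9 = b)
    (hb0 : 0 < b) (hP : PartialOutput S μ.out (1 ≤ μ.vars 17) (a / b : ℝ))
    (hcur : 0 ≤ μ.vars 18 ↔ (a / b : ℝ) ∈ S) (hv : (a / b : ℝ) < v')
    (hmid : 0 ≤ μ.vars 19 → ∀ x, (a / b : ℝ) ≤ x → x ≤ v' → x ∈ S)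
    (hmid' : ¬ 0 ≤ μ.vars 19 → ∀ x, (a / b : ℝ) < x → x < v' → x ∉ S) :
    Runs orc emitEnds μ 9 fun ν => PartialOutput S ν.out (1 ≤ ν.vars 17) v' ∧
      (1 ≤ ν.vars 17 ↔ 0 ≤ μ.vars 19) := by
  have hfin : ∀ ν : Mem, ν.vars 19 = μ.vars 19 → PartialOutput S ν.out (0 ≤ μ.vars 19) v' →
      Runs orc (.ifle (.const 0) (.var 19) (.assign 17 (.const 1)) (.assign 17 (.const 0))) ν 2
        fun ν => PartialOutput S ν.out (1 ≤ ν.vars 17) v' ∧ (1 ≤ ν.vars 17 ↔ 0 ≤ μ.vars 19) := by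
    intro ν hν hP'
    refine Runs.ifle (K := 1) (fun hg => Runs.assign ?_) fun hg => Runs.assign ?_
    · rw [Expr.ev_const, Expr.ev_var, hν] at hg
      exact ⟨by simpa [hg] using hP', by simp [hg]⟩
    · rw [Expr.ev_const, Expr.ev_var, hν] at hg
      exact ⟨by simpa [hg] using hP', by simp [hg]⟩
  refine (Runs.seq (K := 7) (K' := 2) ?_)
  refine Runs.ifle (K := 6) (fun hg => ?_) fun hg => Runs.cost (Runs.skip ?_) (by omega)
  · rw [Expr.ev_const, Expr.ev_var] at hg
    refine Runs.seq (K := 3) (K' := 3) ?_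
    refine Runs.ifle (K := 2) (fun h17 => Runs.seq (K := 1) (K' := 1) (Runs.emit (Runs.emit ?_)))
      fun h17 => Runs.cost (Runs.skip ?_) (by omega)
    · rw [Expr.ev_const, Expr.ev_var] at h17
      have h17' : ¬ 1 ≤ μ.vars 17 := by omega
      refine Runs.ifle (K := 2) (fun h19 => Runs.cost (Runs.skip ?_) (by omega)) fun h19 =>
        Runs.seq (K := 1) (K' := 1) (Runs.emit (Runs.emit ?_))
      · rw [Expr.ev_const, Expr.ev_var] at h19
        have h19' : 0 ≤ μ.vars 19 := h19
        refine hfin _ rfl ?_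
        simpa [ha, hb] using hP.start (mid := 0 ≤ μ.vars 19) hb0 rfl hv h17' h19' (hmid h19')
      · rw [Expr.ev_const, Expr.ev_var] at h19
        have h19' : ¬ 0 ≤ μ.vars 19 := h19
        refine hfin _ rfl ?_
        simpa [ha, hb] using hP.point (mid := 0 ≤ μ.vars 19) hb0 rfl hv h17' h19' (hcur.1 hg)
          (hmid' h19')
    · rw [Expr.ev_const, Expr.ev_var] at h17
      have h17' : 1 ≤ μ.vars 17 := by omega
      refine Runs.ifle (K := 2) (fun h19 => Runs.cost (Runs.skip ?_) (by omega)) fun h19 =>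
        Runs.seq (K := 1) (K' := 1) (Runs.emit (Runs.emit ?_))
      · rw [Expr.ev_const, Expr.ev_var] at h19
        exact hfin _ rfl (hP.extend hv h17' h19 (hmid h19))
      · rw [Expr.ev_const, Expr.ev_var] at h19
        refine hfin _ rfl ?_
        simpa [ha, hb] using hP.close (mid := 0 ≤ μ.vars 19) hb0 rfl hv h17' h19 (hmid' h19)
  · rw [Expr.ev_const, Expr.ev_var] at hg
    have hvS : (a / b : ℝ) ∉ S := fun h => hg (hcur.2 h)
    have h19 : ¬ 0 ≤ μ.vars 19 := fun h => hvS (hmid h _ le_rfl hv.le)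
    refine hfin _ rfl (hP.skip hv (fun h => hvS (hP.mem h)) h19 fun x hx hx' => ?_)
    rcases hx.eq_or_lt with rfl | hx
    · exact hvS
    · exact hmid' h19 x hx hx'

/-- The variables 8 to 13 hold two consecutive fractions `a / b < c / d` with denominators at most
`κ`, and the multiples `hi * b` and `hi * d`. -/
structure HoldsFractions (κ hi a b c d : ℤ) (μ : Mem) : Prop where
  ha : μ.vars 8 = a
  hb : μ.vars 9 = b
  he : μ.vars 10 = hi * b
  hc : μ.vars 11 = c
  hd : μ.vars 12 = d
  hg : μ.vars 13 = hi * d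
  b_pos : 0 < b
  d_pos : 0 < d
  b_le : b ≤ κ
  d_le : d ≤ κ
  det : b * c - a * d = 1
  lt_add : κ < b + d

/-- The Farey successor of `c/d` after `a/b` is `(k c - a)/(k d - b)` with the greatest `k` for
which the denominator is at most `κ`. Any `k` keeps the determinant equal to `1`, and maximality
gives `κ < d + (k d - b)`. Repeated addition starts at `k = 0`, where the denominator is `-b ≥ -κ`,
hence takes at most `2κ` rounds. -/
theorem nextFraction_runs {μ : Mem} {κ : ℕ} {hi a b c d : ℤ} (hκ : μ.vars 2 = κ)
    (h : HoldsFractions κ hi a b c d μ) :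
    Runs orc nextFraction μ (2 * κ * 4 + 10) fun ν =>
      ∃ a' b', HoldsFractions κ hi c d a' b' ν := by
  refine (Runs.seq (Runs.assign (Runs.seq (Runs.assign (Runs.seq (Runs.assign (Runs.seq
    ((Runs.whilele (c := 3) (k := 2 * κ)
    (Q := fun ν => Frame nextFraction μ ν ∧ κ < ν.vars 15 + d ∧ ∃ k : ℤ,
      ν.vars 8 = a ∧ ν.vars 9 = b ∧ ν.vars 10 = hi * b ∧
      ν.vars 11 = c ∧ ν.vars 12 = d ∧ ν.vars 13 = hi * d ∧
      ν.vars 14 = k * c - a ∧ ν.vars 15 = k * d - b ∧ ν.vars 16 = hi * (k * d - b) ∧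
        ν.vars 15 ≤ κ)
    (fun r ν => Frame nextFraction μ ν ∧ (κ - ν.vars 15 ≤ r) ∧ ∃ k : ℤ,
      ν.vars 8 = a ∧ ν.vars 9 = b ∧ ν.vars 10 = hi * b ∧
      ν.vars 11 = c ∧ ν.vars 12 = d ∧ ν.vars 13 = hi * d ∧
      ν.vars 14 = k * c - a ∧ ν.vars 15 = k * d - b ∧ ν.vars 16 = hi * (k * d - b) ∧
        ν.vars 15 ≤ κ) ?_ ?_ ?_).mono le_rfl (?_ : ∀ _, _ → Runs _ _ _ 6 _))))))))).cost
    (by omega)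
  · rintro r ν ⟨hF, hr, k, v8, v9, v10, v11, v12, v13, v14, v15, v16, hle⟩ hg
    have v2 : ν.vars 2 = κ := (hF.vars 2 (by decide)).trans hκ
    rw [Expr.ev_add, Expr.ev_var, Expr.ev_var, Expr.ev_var, v12, v2] at hg
    have hdp := h.d_pos
    refine Runs.seq (K := 1) (K' := 2) (Runs.assign (Runs.seq (K := 1) (K' := 1) (Runs.assign
      (Runs.assign ⟨r - 1, by omega, ⟨fun x hx => ?_, hF.arr, hF.out, hF.calls⟩, ?_, k + 1, ?_⟩))))
    · have hx' : x ≠ 14 ∧ x ≠ 15 ∧ x ≠ 16 := by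
        simp [nextFraction, Prog.modVars] at hx; omega
      simp [hx', hF.vars x hx]
    · simp [v12]; omega
    · simp [v8, v9, v10, v11, v12, v13, v14, v15, v16]
      refine ⟨by ring, by ring, by ring, by linarith⟩
  · rintro r ν ⟨hF, hr, k, v8, v9, v10, v11, v12, v13, hk⟩ hg
    have v2 : ν.vars 2 = κ := (hF.vars 2 (by decide)).trans hκ
    rw [Expr.ev_add, Expr.ev_var, Expr.ev_var, Expr.ev_var, v12, v2] at hg
    exact ⟨hF, by omega, k, v8, v9, v10, v11, v12, v13, hk⟩
  · have hbp := h.b_pos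
    have hbl := h.b_le
    refine ⟨⟨fun x hx => ?_, fun _ _ => rfl, fun _ => rfl, fun _ => rfl⟩, ?_, 0, ?_⟩
    · have hx' : x ≠ 14 ∧ x ≠ 15 ∧ x ≠ 16 := by
        simp [nextFraction, Prog.modVars] at hx; omega
      simp [hx']
    · simp [h.hb]; omega
    · simp [h.ha, h.hb, h.he, h.hc, h.hd, h.hg]; omega
  · rintro ν ⟨hF, hlt, k, v8, v9, v10, v11, v12, v13, v14, v15, v16, hle⟩
    refine (Runs.seq (K := 1) (K' := 5) (Runs.assign (Runs.seq (K := 1) (K' := 4) (Runs.assign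
      (Runs.seq (K := 1) (K' := 3) (Runs.assign (Runs.seq (K := 1) (K' := 2) (Runs.assign
      (Runs.seq (K := 1) (K' := 1) (Runs.assign (Runs.assign ?_)))))))))))
    have hdl := h.d_le
    have hdet := h.det
    rw [v15] at hlt hle
    refine ⟨k * c - a, k * d - b, ?_, ?_, ?_, ?_, ?_, ?_, h.d_pos, by omega, hdl, hle, ?_,
      by omega⟩
    · simp [v11]
    · simp [v12]
    · simp [v13]
    · simp [v14]
    · simp [v15]
    · simp [v16]
    · linear_combination hdet

/-- The successor of the integer `lo` among fractions of denominator at most `κ` is `lo + 1/κ`. -/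
theorem firstFraction_runs {μ : Mem} {κ : ℕ} {lo hi : ℤ} (hκ0 : 0 < κ) (hκ : μ.vars 2 = κ)
    (hlo : μ.vars 3 = lo) (hhi : μ.vars 4 = hi) :
    Runs orc firstFraction μ (κ * 4 + 8) fun ν =>
      HoldsFractions κ hi lo 1 (lo * κ + 1) κ ν := by
  refine (Runs.seq (Runs.assign (Runs.seq (Runs.assign (Runs.seq (Runs.assign (Runs.seq
    (Runs.assign (Runs.seq (Runs.assign (Runs.seq (Runs.assign ((Runs.forLoop (n := κ) (c := 2)
    (fun k ν => ν.vars 11 = lo * k + 1 ∧ ν.vars 13 = hi * k) (by decide) ?_ (by simp) ?_).mono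
      le_rfl ?_))))))))))))).cost (by omega)
  · intro ν hF
    exact (hF.vars 2 (by decide)).trans (by simp [hκ])
  · rintro k hk ν hF hνk ⟨h1, h2⟩
    have v3 : ν.vars 3 = lo := (hF.vars 3 (by decide)).trans (by simp [hlo])
    have v4 : ν.vars 4 = hi := (hF.vars 4 (by decide)).trans (by simp [hhi])
    refine Runs.seq (K := 1) (K' := 1) (Runs.assign (Runs.assign ?_))
    simp [v3, v4, h1, h2]
    constructor <;> ring
  · rintro ν ⟨hF, -, h1, h2⟩
    refine ⟨(hF.vars 8 (by decide)).trans (by simp [hlo]), (hF.vars 9 (by decide)).trans (by simp),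
      (hF.vars 10 (by decide)).trans (by simp [hhi]), h1, (hF.vars 12 (by decide)).trans
      (by simp [hκ]), h2, one_pos, by omega, by omega, le_rfl, by ring, by omega⟩

end Scan

/-! ### Correctness, number of calls and cost of the scan -/

section ScanSpec

variable {orc : GameOracle} {T : Prog} {Adm : ℤ → ℤ → Prop} {K : ℕ} {Pr : Game → Prop} {m n : ℕ}
  {A B : Matrix (Fin m) (Fin n) (WithBot ℤ)}

/-- The memory holds the matrices and the parameters of the scan. -/
structure HoldsScan (A B : Matrix (Fin m) (Fin n) (WithBot ℤ)) (lo hi : ℤ) (R : ℕ) (ray : Bool)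
    (μ : Mem) : Prop where
  mats : Holds A B μ
  kap : μ.vars 2 = kap m n
  lo : μ.vars 3 = lo
  hi : μ.vars 4 = hi
  bound : μ.vars 5 = R
  ray : μ.vars 6 = ray.toNat

theorem HoldsScan.of_agree {lo hi : ℤ} {R : ℕ} {ray : Bool} {μ ν : Mem}
    (h : HoldsScan A B lo hi R ray μ) (hv : ∀ x < 7, ν.vars x = μ.vars x)
    (ha : ∀ a < 4, ν.arr a = μ.arr a) : HoldsScan A B lo hi R ray ν where
  mats := ⟨(hv 0 (by omega)).trans h.mats.rows, (hv 1 (by omega)).trans h.mats.cols,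
    (ha 0 (by omega)).trans h.mats.valA, (ha 1 (by omega)).trans h.mats.maskA,
    (ha 2 (by omega)).trans h.mats.valB, (ha 3 (by omega)).trans h.mats.maskB⟩
  kap := (hv 2 (by omega)).trans h.kap
  lo := (hv 3 (by omega)).trans h.lo
  hi := (hv 4 (by omega)).trans h.hi
  bound := (hv 5 (by omega)).trans h.bound
  ray := (hv 6 (by omega)).trans h.ray

theorem HoldsScan.of_frame {lo hi : ℤ} {R : ℕ} {ray : Bool} {P : Prog} {μ ν : Mem}
    (h : HoldsScan A B lo hi R ray μ) (hF : Frame P μ ν) (hv : ∀ x < 7, x ∉ P.modVars)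
    (ha : ∀ a < 4, a ∉ P.modArrs) : HoldsScan A B lo hi R ray ν :=
  h.of_agree (fun x hx => hF.vars x (hv x hx)) fun a hx => hF.arr a (ha a hx)

theorem HoldsScan.setVar {lo hi : ℤ} {R : ℕ} {ray : Bool} {μ : Mem}
    (h : HoldsScan A B lo hi R ray μ) {x : ℕ} (hx : 7 ≤ x) (v : ℤ) :
    HoldsScan A B lo hi R ray (μ.setVar x v) :=
  h.of_agree (fun y hy => by have : y ≠ x := by omega
                             simp [this]) fun _ _ => rfl

/-- The calls to the oracle after those in `l₀` are at most `N` and satisfy `Pr`. -/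
def CallsAfter (l₀ : List Game) (N : ℕ) (Pr : Game → Prop) (l : List Game) : Prop :=
  ∃ l' : List Game, l = l₀ ++ l' ∧ l'.length ≤ N ∧ ∀ G ∈ l', Pr G

theorem CallsAfter.append {l₀ l l' : List Game} {N N' : ℕ} (h : CallsAfter l₀ N Pr l)
    (h' : CallsAfter l N' Pr l') : CallsAfter l₀ (N + N') Pr l' := by
  obtain ⟨k, rfl, h1, h2⟩ := h
  obtain ⟨k', rfl, h3, h4⟩ := h'
  refine ⟨k ++ k', by simp, by simp; omega, fun G hG => ?_⟩
  rcases List.mem_append.1 hG with hG | hG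
  · exact h2 G hG
  · exact h4 G hG

theorem CallsAfter.refl (l : List Game) : CallsAfter l 0 Pr l := ⟨[], by simp, by simp, by simp⟩

theorem CallsAfter.mono {l₀ l : List Game} {N N' : ℕ} (h : CallsAfter l₀ N Pr l) (hN : N ≤ N') :
    CallsAfter l₀ N' Pr l := by
  obtain ⟨k, h0, h1, h2⟩ := h
  exact ⟨k, h0, h1.trans hN, h2⟩

/-- The state of the scan between two rounds of the main loop. -/
structure ScanState (A B : Matrix (Fin m) (Fin n) (WithBot ℤ)) (lo hi : ℤ) (R : ℕ) (ray : Bool)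
    (a b c d : ℤ) (μ : Mem) : Prop where
  params : HoldsScan A B lo hi R ray μ
  fractions : HoldsFractions (MaxPlus.kap m n) hi a b c d μ
  output : PartialOutput (spec A B) μ.out (1 ≤ μ.vars 17) (a / b : ℝ)
  lo_le : lo * b ≤ a
  le_hi : a ≤ hi * b

theorem fractionRound_runs {lo hi : ℤ} {R : ℕ} {ray : Bool} {a b c d : ℤ} {μ : Mem}
    (hT : Tests orc T (spec A B) (HoldsScan A B lo hi R ray) Adm K Pr) (hloc : IsLocal T)
    (hAdm : ∀ p q : ℤ, 0 < q → q ≤ 2 * kap m n → lo * q ≤ p → p ≤ hi * q → Adm p q)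
    (hκ : 0 < kap m n) (h : ScanState A B lo hi R ray a b c d μ) (hlt : a < hi * b) :
    Runs orc (.seq (testInto T 18 (.var 8) (.var 9))
      (.seq (testInto T 19 (.add (.var 8) (.var 11)) (.add (.var 9) (.var 12)))
      (.seq emitEnds nextFraction))) μ (2 * K + 25 + 8 * kap m n) fun ν =>
        CallsAfter μ.calls 2 Pr ν.calls ∧ ∃ c' d', ScanState A B lo hi R ray c d c' d' ν := by
  have hF := h.fractions
  have hbp := hF.b_pos
  have hdp := hF.d_pos
  have hbl := hF.b_le
  have hdl := hF.d_le
  have hdet := hF.det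
  -- The walk cannot jump over `hi`: the integer `hi`, with denominator `1`, would lie strictly
  -- between consecutive fractions.
  have hch : c ≤ hi * d := by
    by_contra hcon
    have := farey_le (e := hi) (f := 1) hbp hdp hdet hF.lt_add (by linarith) (by linarith)
    omega
  have hbR : (0 : ℝ) < b := by exact_mod_cast hbp
  have hdR : (0 : ℝ) < d := by exact_mod_cast hdp
  have hdetR : (b : ℝ) * c - a * d = 1 := by exact_mod_cast hdet
  have hlod : lo * d ≤ c := by
    have h1 := h.lo_le
    have h2 : 0 < b * (c - lo * d) := by nlinarith
    have := (mul_pos_iff_of_pos_left hbp).1 h2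
    linarith
  have hlo : lo * (b + d) ≤ a + c := by linarith [h.lo_le]
  refine (Runs.seq ((testInto_runs (e := .var 8) (f := .var 9) (p := a) (q := b) hT hloc
    hF.ha (by simpa using hF.hb)
    ((h.params.setVar (by omega) _).setVar (by omega) _) hbp
    (hAdm a b hbp (by omega) h.lo_le h.le_hi)).mono le_rfl ?_)).cost
    (K := K + 3 + (K + 3 + (9 + (2 * kap m n * 4 + 10)))) (by omega)
  rintro ν ⟨hcur, hνv, hνa, hνo, hνc⟩
  have hν := h.params.of_agree (fun x hx => hνv x (by omega) (by omega)) hνa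
  have v8 := (hνv 8 (by omega) (by omega)).trans hF.ha
  have v9 := (hνv 9 (by omega) (by omega)).trans hF.hb
  have v10 := (hνv 10 (by omega) (by omega)).trans hF.he
  have v11 := (hνv 11 (by omega) (by omega)).trans hF.hc
  have v12 := (hνv 12 (by omega) (by omega)).trans hF.hd
  have v13 := (hνv 13 (by omega) (by omega)).trans hF.hg
  refine Runs.seq ((testInto_runs (p := a + c) (q := b + d) hT hloc (by simp [v8, v11])
    (by simp [v9, v12]) ((hν.setVar (by omega) _).setVar (by omega) _) (by omega)
    (hAdm _ _ (by omega) (by omega) hlo (by linarith))).mono le_rfl ?_)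
  rintro ξ ⟨hmid, hξv, hξa, hξo, hξc⟩
  have hξ := hν.of_agree (fun x hx => hξv x (by omega) (by omega)) hξa
  have w18 : ξ.vars 18 = ν.vars 18 := hξv 18 (by omega) (by omega)
  have w17 : ξ.vars 17 = μ.vars 17 :=
    (hξv 17 (by omega) (by omega)).trans (hνv 17 (by omega) (by omega))
  have hcd : (a / b : ℝ) < c / d := by
    rw [div_lt_div_iff₀ hbR hdR]; linarith
  -- The mediant lies strictly between the two fractions; its denominator is at most `2κ`, which is
  -- where the factor `2κ` in the payments comes from.
  have hm1 : (a : ℝ) < b * (((a + c : ℤ) : ℝ) / ((b + d : ℤ) : ℝ)) := by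
    push_cast
    rw [mul_div_assoc', lt_div_iff₀ (by linarith)]
    nlinarith
  have hm2 : (d : ℝ) * (((a + c : ℤ) : ℝ) / ((b + d : ℤ) : ℝ)) < c := by
    push_cast
    rw [mul_div_assoc', div_lt_iff₀ (by linarith)]
    nlinarith
  refine Runs.seq ((emitEnds_runs (S := spec A B) (v' := (c / d : ℝ))
    ((hξv 8 (by omega) (by omega)).trans v8) ((hξv 9 (by omega) (by omega)).trans v9) hbp
    (by rw [hξo, hνo, w17]; exact h.output) (by rw [w18]; exact hcur) hcd ?_ ?_).frame.mono
    le_rfl ?_)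
  · intro h19 x hx hx'
    refine spec_between hbp hdp hdet hF.lt_add (hmid.1 h19) hm1 hm2 ?_ ?_
    · rwa [div_le_iff₀ hbR, mul_comm] at hx
    · rwa [le_div_iff₀ hdR, mul_comm] at hx'
  · intro h19 x hx hx' hxS
    refine h19 (hmid.2 (spec_between hbp hdp hdet hF.lt_add hxS ?_ ?_ hm1.le hm2.le))
    · rwa [div_lt_iff₀ hbR, mul_comm] at hx
    · rwa [lt_div_iff₀ hdR, mul_comm] at hx'
  · rintro ζ ⟨hG, hζ, -⟩
    have hζs := hξ.of_frame hG (by decide) (by decide)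
    have hζF : HoldsFractions (kap m n) hi a b c d ζ := by
      refine ⟨?_, ?_, ?_, ?_, ?_, ?_, hbp, hdp, hbl, hdl, hdet, hF.lt_add⟩
      · exact (hG.vars 8 (by decide)).trans ((hξv 8 (by omega) (by omega)).trans v8)
      · exact (hG.vars 9 (by decide)).trans ((hξv 9 (by omega) (by omega)).trans v9)
      · exact (hG.vars 10 (by decide)).trans ((hξv 10 (by omega) (by omega)).trans v10)
      · exact (hG.vars 11 (by decide)).trans ((hξv 11 (by omega) (by omega)).trans v11)
      · exact (hG.vars 12 (by decide)).trans ((hξv 12 (by omega) (by omega)).trans v12)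
      · exact (hG.vars 13 (by decide)).trans ((hξv 13 (by omega) (by omega)).trans v13)
    refine (nextFraction_runs hζs.kap hζF).frame.mono le_rfl ?_
    rintro η ⟨hH, c', d', hη⟩
    refine ⟨?_, c', d', hζs.of_frame hH (by decide) (by decide), hη, ?_, by linarith, hch⟩
    · rw [hH.calls (by decide), hG.calls (by decide)]
      exact CallsAfter.append (N := 1) (N' := 1) hνc hξc
    · rw [hH.out (by decide), hH.vars 17 (by decide)]
      exact hζ

/-- The index `r` bounds `(hi - a/b) κ²`. Passing to the next fraction reduces the distance to `hi`
by `1/(b d) ≥ 1/κ²`, so `r` drops by one in each round. With two tests per round this gives the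
number of calls. -/
theorem fractionLoop_runs {lo hi : ℤ} {R N : ℕ} {ray : Bool} {μ : Mem} {c d : ℤ}
    (hT : Tests orc T (spec A B) (HoldsScan A B lo hi R ray) Adm K Pr) (hloc : IsLocal T)
    (hAdm : ∀ p q : ℤ, 0 < q → q ≤ 2 * kap m n → lo * q ≤ p → p ≤ hi * q → Adm p q)
    (hκ : 0 < kap m n) (h : ScanState A B lo hi R ray lo 1 c d μ)
    (hN : hi - lo = N) :
    Runs orc (fractionLoop T) μ (N * kap m n ^ 2 * (2 * K + 26 + 8 * kap m n) + 1) fun ν =>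
      CallsAfter μ.calls (2 * (N * kap m n ^ 2)) Pr ν.calls ∧
        ∃ b c d, ScanState A B lo hi R ray (hi * b) b c d ν := by
  set κ := kap m n with hκdef
  refine (Runs.whilele (c := 2 * K + 25 + 8 * κ) (k := N * κ ^ 2) (fun r ν => ∃ a b c d,
    r ≤ N * κ ^ 2 ∧ CallsAfter μ.calls (2 * (N * κ ^ 2 - r)) Pr ν.calls ∧
    ScanState A B lo hi R ray a b c d ν ∧ (hi * b - a) * κ ^ 2 ≤ r * b) ?_ ?_ ?_).cost
    (le_of_eq (by ring))
  · rintro r ν ⟨a, b, c, d, hrN, hcalls, hν, hr⟩ hg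
    have hF := hν.fractions
    rw [Expr.ev_add, Expr.ev_var, Expr.ev_var, Expr.ev_const, hF.ha, hF.he] at hg
    have hbp := hF.b_pos
    have hdp := hF.d_pos
    have hdet := hF.det
    have hκ1 : (1 : ℤ) ≤ (κ : ℤ) ^ 2 := by
      have : 0 < κ ^ 2 := by positivity
      exact_mod_cast this
    have hr1 : 0 < r := by
      rcases Nat.eq_zero_or_pos r with rfl | hr1
      · exfalso
        have : 0 < (hi * b - a) * (κ : ℤ) ^ 2 := mul_pos (by omega) (by omega)
        simp at hr
        omega
      · exact hr1
    refine (fractionRound_runs hT hloc hAdm hκ hν (by omega)).mono le_rfl ?_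
    rintro ξ ⟨hξc, c', d', hξ⟩
    refine ⟨r - 1, by omega, c, d, c', d', by omega, (hcalls.append hξc).mono (by omega), hξ, ?_⟩
    have e1 : (hi * d - c) * b = (hi * b - a) * d - 1 := by linear_combination -hdet
    have e2 : b * d ≤ (κ : ℤ) ^ 2 := by
      rw [sq]; exact mul_le_mul hF.b_le hF.d_le hdp.le (by positivity)
    have e3 : ((hi * d - c) * (κ : ℤ) ^ 2) * b ≤ (((r - 1 : ℕ) : ℤ) * d) * b := by
      have e4 : ((r - 1 : ℕ) : ℤ) = r - 1 := by omega
      rw [e4]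
      have e5 := mul_le_mul_of_nonneg_right hr hdp.le
      have e6 : (hi * d - c) * (κ : ℤ) ^ 2 * b = (hi * b - a) * (κ : ℤ) ^ 2 * d - (κ : ℤ) ^ 2 := by
        linear_combination (κ : ℤ) ^ 2 * e1
      rw [e6]
      linarith
    exact le_of_mul_le_mul_right e3 hbp
  · rintro r ν ⟨a, b, c, d, hrN, hcalls, hν, hr⟩ hg
    have hF := hν.fractions
    rw [Expr.ev_add, Expr.ev_var, Expr.ev_var, Expr.ev_const, hF.ha, hF.he] at hg
    have : a = hi * b := by have := hν.le_hi; omega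
    subst this
    exact ⟨hcalls.mono (by omega), b, c, d, hν⟩
  · refine ⟨lo, 1, c, d, le_rfl, by simpa using CallsAfter.refl _, h, ?_⟩
    rw [mul_one, mul_one, hN]
    push_cast
    exact le_rfl

theorem lastFraction_runs {lo hi : ℤ} {R : ℕ} {ray : Bool} {μ : Mem} {b c d : ℤ}
    (hT : Tests orc T (spec A B) (HoldsScan A B lo hi R ray) Adm K Pr) (hloc : IsLocal T)
    (hAdm : ∀ p q : ℤ, 0 < q → q ≤ 2 * kap m n → lo * q ≤ p → p ≤ hi * q → Adm p q)
    (h : ScanState A B lo hi R ray (hi * b) b c d μ)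
    (hray : ray = true → Adm (hi + 1) 1 ∧
      ∀ lam lam' : ℝ, lam ∈ spec A B → (hi : ℝ) < lam → (hi : ℝ) ≤ lam' → lam' ∈ spec A B)
    (hray' : ray = false → ∀ lam : ℝ, (hi : ℝ) < lam → lam ∉ spec A B) :
    Runs orc (lastFraction T) μ (2 * K + 19) fun ν =>
      CallsAfter μ.calls (1 + ray.toNat) Pr ν.calls ∧ Identifies ν.out (spec A B) := by
  have hF := h.fractions
  have hbp := hF.b_pos
  have hbR : (b : ℝ) ≠ 0 := by exact_mod_cast hbp.ne'
  have hdiv : ((hi * b : ℤ) : ℝ) / b = hi := by push_cast; field_simp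
  have hout := h.output
  refine (Runs.seq ((testInto_runs (e := .var 8) (f := .var 9) (p := hi * b) (q := b) hT hloc
    hF.ha (by simpa using hF.hb)
    ((h.params.setVar (by omega) _).setVar (by omega) _) hbp
    (hAdm _ b hbp (by have := hF.b_le; omega) h.lo_le h.le_hi)).mono le_rfl ?_)).cost
    (K := K + 3 + (K + 4 + (9 + 3))) (by omega)
  rintro ν ⟨hcur, hνv, hνa, hνo, hνc⟩
  have hν := h.params.of_agree (fun x hx => hνv x (by omega) (by omega)) hνa
  have v4 := hν.hi
  have v6 := hν.ray
  have hsecond : Runs orc (.ifle (.const 1) (.var 6)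
      (testInto T 19 (.add (.var 4) (.const 1)) (.const 1)) (.assign 19 (.const (-1)))) ν (K + 4)
      fun ξ => (0 ≤ ξ.vars 19 → ∀ x : ℝ, (hi : ℝ) ≤ x → x ∈ spec A B) ∧
        (¬ 0 ≤ ξ.vars 19 → ∀ x : ℝ, (hi : ℝ) < x → x ∉ spec A B) ∧
        (∀ y < 19, ξ.vars y = ν.vars y) ∧ ξ.out = ν.out ∧
        CallsAfter ν.calls ray.toNat Pr ξ.calls := by
    refine Runs.ifle (K := K + 3) (fun hg => ?_) fun hg => Runs.cost (Runs.assign ?_) (by omega)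
    · rw [Expr.ev_const, Expr.ev_var, v6] at hg
      have hr : ray = true := by
        cases ray
        · simp at hg
        · rfl
      obtain ⟨hA1, hup⟩ := hray hr
      refine (testInto_runs (p := hi + 1) (q := 1) hT hloc (by simp [v4]) (by simp)
        ((hν.setVar (by omega) _).setVar (by omega) _) one_pos hA1).mono le_rfl ?_
      rintro ξ ⟨hmid, hξv, -, hξo, hξc⟩
      have e1 : ((hi + 1 : ℤ) : ℝ) / ((1 : ℤ) : ℝ) = hi + 1 := by push_cast; ring
      rw [e1] at hmid
      refine ⟨fun h19 x hx => hup _ x (hmid.1 h19) (by linarith) hx, fun h19 x hx hxS =>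
        h19 (hmid.2 (hup x _ hxS hx (by linarith))), fun y hy => hξv y (by omega) (by omega), hξo,
        CallsAfter.mono (N := 1) hξc (by simp [hr])⟩
    · rw [Expr.ev_const, Expr.ev_var, v6] at hg
      have hr : ray = false := by
        cases ray
        · rfl
        · simp at hg
      refine ⟨by simp, fun _ => hray' hr, fun y hy => ?_, rfl, (CallsAfter.refl _).mono (by omega)⟩
      have : y ≠ 19 := by omega
      simp [this]
  refine Runs.seq (hsecond.mono le_rfl ?_)
  rintro ξ ⟨hmid, hmid', hξv, hξo, hξc⟩
  -- The frontier is moved to the arbitrary point `hi + 1`, because the partial output describes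
  -- only what lies strictly to its left.
  refine Runs.seq ((emitEnds_runs (S := spec A B) (a := hi * b) (b := b) (v' := (hi + 1 : ℝ))
    ?_ ?_ hbp ?_ ?_ ?_ ?_ ?_).frame.mono le_rfl ?_)
  · exact (hξv 8 (by omega)).trans ((hνv 8 (by omega) (by omega)).trans hF.ha)
  · exact (hξv 9 (by omega)).trans ((hνv 9 (by omega) (by omega)).trans hF.hb)
  · rw [hξo, hνo, hξv 17 (by omega), hνv 17 (by omega) (by omega)]
    exact hout
  · rw [hξv 18 (by omega)]
    exact hcur
  · rw [hdiv]; linarith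
  · rw [hdiv]
    exact fun h19 x hx _ => hmid h19 x hx
  · rw [hdiv]
    exact fun h19 x hx _ => hmid' h19 x hx
  rintro ζ ⟨hG, hζ, h17⟩
  have hcalls : CallsAfter μ.calls (1 + ray.toNat) Pr ζ.calls := by
    rw [hG.calls (by decide)]
    exact CallsAfter.append (N := 1) hνc hξc
  refine Runs.ifle (K := 2) (fun hg => Runs.seq (K := 1) (K' := 1) (Runs.emit (Runs.emit
    ⟨hcalls, ?_⟩))) fun hg => Runs.cost (Runs.skip ⟨hcalls, ?_⟩) (by omega)
  · rw [Expr.ev_const, Expr.ev_var] at hg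
    have := hζ.identifies_append hg fun x hx => hmid (h17.1 hg) x (by linarith)
    simpa using this
  · rw [Expr.ev_const, Expr.ev_var] at hg
    exact hζ.identifies hg fun x hx => hmid' (fun h => hg (h17.2 h)) x (by linarith)

theorem scan_runs {lo hi : ℤ} {R N : ℕ} {ray : Bool} {μ : Mem}
    (hT : Tests orc T (spec A B) (HoldsScan A B lo hi R ray) Adm K Pr) (hloc : IsLocal T)
    (hAdm : ∀ p q : ℤ, 0 < q → q ≤ 2 * kap m n → lo * q ≤ p → p ≤ hi * q → Adm p q)
    (hκ : 0 < kap m n) (hμ : HoldsScan A B lo hi R ray μ) (hN : hi - lo = N)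
    (hout : PartialOutput (spec A B) μ.out (1 ≤ μ.vars 17) lo)
    (hray : ray = true → Adm (hi + 1) 1 ∧
      ∀ lam lam' : ℝ, lam ∈ spec A B → (hi : ℝ) < lam → (hi : ℝ) ≤ lam' → lam' ∈ spec A B)
    (hray' : ray = false → ∀ lam : ℝ, (hi : ℝ) < lam → lam ∉ spec A B) :
    Runs orc (scan T) μ
      (4 * kap m n + N * kap m n ^ 2 * (2 * K + 26 + 8 * kap m n) + 2 * K + 28) fun ν =>
        CallsAfter μ.calls (2 * (N * kap m n ^ 2) + 1 + ray.toNat) Pr ν.calls ∧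
          Identifies ν.out (spec A B) := by
  refine (Runs.seq ((firstFraction_runs hκ hμ.kap hμ.lo hμ.hi).frame.mono le_rfl ?_)).cost
    (K := kap m n * 4 + 8 + (N * kap m n ^ 2 * (2 * K + 26 + 8 * kap m n) + 1 + (2 * K + 19)))
    (by omega)
  rintro ν ⟨hF, hν⟩
  have hs : ScanState A B lo hi R ray lo 1 (lo * kap m n + 1) (kap m n) ν := by
    refine ⟨hμ.of_frame hF (by decide) (by decide), hν, ?_, by omega, by omega⟩
    rw [hF.out (by decide), hF.vars 17 (by decide)]
    simpa using hout
  refine Runs.seq ((fractionLoop_runs hT hloc hAdm hκ hs hN).mono le_rfl ?_)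
  rintro ξ ⟨hξc, b, c, d, hξ⟩
  refine (lastFraction_runs hT hloc hAdm hξ hray hray').mono le_rfl ?_
  rintro ζ ⟨hζc, hζ⟩
  refine ⟨?_, hζ⟩
  have := hξc.append hζc
  rw [hF.calls (by decide)] at this
  exact this.mono (by omega)

end ScanSpec

/-! ### Parameters of the scan -/

/-- `x := y * z`. -/
def mulInto (x y z : ℕ) : Prog :=
  .seq (.assign x (.const 0)) (.forLoop 23 (.var z) (.assign x (.add (.var x) (.var y))))

theorem mulInto_runs {orc : GameOracle} {μ : Mem} {x y z k : ℕ} (hx : x ≠ 23) (hy : y ≠ 23)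
    (hz : z ≠ 23) (hxy : y ≠ x) (hxz : z ≠ x) (hk : μ.vars z = k) :
    Runs orc (mulInto x y z) μ (k * 3 + 3) fun ν => ν.vars x = μ.vars y * k := by
  have hmod : ∀ w, w ≠ 23 → w ≠ x →
      w ∉ (Prog.forLoop 23 (.var z) (.assign x (.add (.var x) (.var y)))).modVars := by
    intro w h1 h2
    simp [Prog.forLoop, Prog.modVars, h1, h2]
  refine (Runs.seq (Runs.assign ((Runs.forLoop (n := k) (c := 1)
    (fun s ν => ν.vars x = μ.vars y * s) (by simpa [Prog.modVars] using hx.symm) ?_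
    (by simp [hx]) ?_).mono le_rfl fun ν h => h.2.2))).cost (by omega)
  · intro ν hF
    have := hF.vars z (hmod z hz hxz)
    simp [this, hxz, hk]
  · intro s hs ν hF hνs hJ
    have h1 := hF.vars y (hmod y hy hxy)
    refine Runs.assign ?_
    simp [hx, hJ, h1, hxy]
    ring

/-- Compute `κ`. -/
def kapSetup : Prog :=
  .ifle (.add (.var 0) (.var 0)) (.var 1) (.assign 2 (.add (.var 0) (.var 0)))
    (.assign 2 (.var 1))

theorem kapSetup_runs {orc : GameOracle} {μ : Mem} {m n : ℕ} (hm : μ.vars 0 = m)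
    (hn : μ.vars 1 = n) : Runs orc kapSetup μ 2 fun ν => ν.vars 2 = kap m n := by
  refine Runs.ifle (K := 1) (fun hg => Runs.assign ?_) fun hg => Runs.assign ?_
  · simp [hm, hn] at hg
    simp [hm, kap]
    omega
  · simp [hm, hn] at hg
    simp [hn, kap]
    omega

/-- Raise variable 7 to the value of `e`. -/
def raise (e : Expr) : Prog := .ifle (.var 7) e (.assign 7 e) .skip

/-- Compute the greatest absolute value of an entry, or `1`. -/
def boundSetup : Prog :=
  .seq (.assign 7 (.const 1)) (.forLoop 23 (.var 0) (.forLoop 24 (.var 1)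
    (.seq (raise (.get 0 (.var 23) (.var 24)))
    (.seq (raise (.sub (.const 0) (.get 0 (.var 23) (.var 24))))
    (.seq (raise (.get 2 (.var 23) (.var 24)))
      (raise (.sub (.const 0) (.get 2 (.var 23) (.var 24)))))))))

section Bound

variable {orc : GameOracle} {m n M : ℕ} {A B : Matrix (Fin m) (Fin n) (WithBot ℤ)}

theorem raise_runs {e : Expr} {μ : Mem} {z : ℤ} (he : e.ev μ = z) :
    Runs orc (raise e) μ 2 fun ν => ν = μ.setVar 7 (max (μ.vars 7) z) := by
  refine Runs.ifle (K := 1) (fun hg => Runs.assign ?_) fun hg => Runs.skip ?_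
  · rw [he, Expr.ev_var] at hg
    rw [he, max_eq_right hg]
  · rw [he, Expr.ev_var] at hg
    rw [max_eq_left (by omega)]
    simp only [Mem.setVar, Function.update_eq_self]

/-- The bound `M` is not part of the input, so a bound `M' ≤ M` is computed from the entries.
Keeping `M' ≥ 1` ensures that the tests at distance one outside the scanned interval respect the
bound on the payments. -/
theorem boundSetup_runs {μ : Mem} (hμ : Holds A B μ) (hM : 1 ≤ M) (hA : EntriesBounded A M)
    (hB : EntriesBounded B M) :
    Runs orc boundSetup μ (m * (n * 10 + 4) + 3) fun ν => ∃ M' : ℕ, ν.vars 7 = M' ∧ 1 ≤ M' ∧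
      M' ≤ M ∧ EntriesBounded A M' ∧ EntriesBounded B M' := by
  have hle : ∀ {X : Matrix (Fin m) (Fin n) (WithBot ℤ)}, EntriesBounded X M →
      ∀ i j, |valArray X i j| ≤ M := by
    intro X hX i j
    unfold valArray store
    split_ifs with h
    · dsimp only
      cases hXi : X ⟨i, h.1⟩ ⟨j, h.2⟩ with
      | bot => simp
      | coe z => simpa using hX _ _ z hXi
    · simp
  let ok : ℤ → ℕ → ℕ → Prop := fun v i j => |valArray A i j| ≤ v ∧ |valArray B i j| ≤ v
  have hok : ∀ {v w : ℤ} {i j}, ok v i j → v ≤ w → ok w i j := fun h hvw =>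
    ⟨h.1.trans hvw, h.2.trans hvw⟩
  refine (Runs.seq (Runs.assign ((Runs.forLoop (n := m) (c := n * 10 + 2)
    (fun i ν => 1 ≤ ν.vars 7 ∧ ν.vars 7 ≤ M ∧ ∀ i' < i, ∀ j < n, ok (ν.vars 7) i' j)
    (by decide) ?_ (by simpa using hM) ?_).mono le_rfl ?_))).cost
    (K := 1 + (m * (n * 10 + 2 + 2) + 2)) (by ring_nf; omega)
  · intro ν hF
    exact (hF.vars 0 (by decide)).trans (by simpa using hμ.rows)
  · rintro i hi ν hF hνi ⟨h1, h2, h3⟩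
    refine (Runs.forLoop (n := n) (c := 8)
      (fun j ξ => 1 ≤ ξ.vars 7 ∧ ξ.vars 7 ≤ M ∧ (∀ i' < i, ∀ j' < n, ok (ξ.vars 7) i' j') ∧
        ∀ j' < j, ok (ξ.vars 7) i j') (by decide) ?_ (by simpa using ⟨h1, h2, h3⟩) ?_).mono
        le_rfl ?_
    · intro ξ hG
      refine (hG.vars 1 (by decide)).trans ((hF.vars 1 (by decide)).trans (by simpa using hμ.cols))
    · rintro j hj ξ hG hξj ⟨g1, g2, g3, g4⟩
      have w23 : ξ.vars 23 = i := (hG.vars 23 (by decide)).trans hνi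
      have a0 : ξ.arr 0 = valArray A :=
        (hG.arr 0 (by decide)).trans ((hF.arr 0 (by decide)).trans hμ.valA)
      have a2 : ξ.arr 2 = valArray B :=
        (hG.arr 2 (by decide)).trans ((hF.arr 2 (by decide)).trans hμ.valB)
      have eA := abs_le.1 (hle hA i j)
      have eB := abs_le.1 (hle hB i j)
      set x := valArray A i j with hx
      set y := valArray B i j with hy
      set v := ξ.vars 7 with hv
      set w := max (max (max (max v x) (-x)) y) (-y) with hw
      have hvw : v ≤ w := by simp [w]
      have hxw : |x| ≤ w := abs_le'.2 ⟨by simp [w], by simp [w]⟩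
      have hyw : |y| ≤ w := abs_le'.2 ⟨by simp [w], by simp [w]⟩
      have hwM : w ≤ M := max_le (max_le (max_le (max_le g2 eA.2) (by linarith [eA.1])) eB.2)
        (by linarith [eB.1])
      have key : ∀ η : Mem, η.vars 7 = w → 1 ≤ η.vars 7 ∧ η.vars 7 ≤ M ∧
          (∀ i' < i, ∀ j' < n, ok (η.vars 7) i' j') ∧ ∀ j' < j + 1, ok (η.vars 7) i j' := by
        intro η hη
        rw [hη]
        refine ⟨g1.trans hvw, hwM, fun i' hi' j' hj' => hok (g3 i' hi' j' hj') hvw,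
          fun j' hj' => ?_⟩
        rcases (by omega : j' < j ∨ j' = j) with h | rfl
        · exact hok (g4 j' h) hvw
        · exact ⟨hxw, hyw⟩
      refine Runs.cost (K := 2 + (2 + (2 + 2))) (Runs.seq ((raise_runs (z := x)
        (by simp [w23, hξj, a0, hx])).mono le_rfl ?_)) (by omega)
      rintro _ rfl
      refine Runs.seq ((raise_runs (z := -x) (by simp [w23, hξj, a0, hx])).mono le_rfl ?_)
      rintro _ rfl
      refine Runs.seq ((raise_runs (z := y) (by simp [w23, hξj, a2, hy])).mono le_rfl ?_)
      rintro _ rfl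
      refine (raise_runs (z := -y) (by simp [w23, hξj, a2, hy])).mono le_rfl ?_
      rintro _ rfl
      exact key _ (by simp [hw, hv])
    · rintro ξ ⟨hG, -, g1, g2, g3, g4⟩
      refine ⟨by simpa using g1, by simpa using g2, fun i' hi' j hj => ?_⟩
      have : (ξ.setVar 23 (i + 1)).vars 7 = ξ.vars 7 := by simp
      rw [this]
      rcases (by omega : i' < i ∨ i' = i) with h | rfl
      · exact g3 i' h j hj
      · exact g4 j hj
  · rintro ν ⟨-, -, h1, h2, h3⟩
    obtain ⟨M', hM'⟩ := Int.eq_ofNat_of_zero_le (by omega : 0 ≤ ν.vars 7)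
    refine ⟨M', hM', by omega, by omega, fun i j z hz => ?_, fun i j z hz => ?_⟩
    · have := (h3 i i.2 j j.2).1
      rwa [valArray_apply, hz, WithBot.unbotD_coe, hM'] at this
    · have := (h3 i i.2 j j.2).2
      rwa [valArray_apply, hz, WithBot.unbotD_coe, hM'] at this

/-- The bound on the payments of the games in the general case. -/
def payBound (m n M : ℕ) : ℕ := 2 * kap m n * (M + 2 * M * kap m n)

/-- Compute the parameters of the scan in the general case. -/
def generalSetup : Prog :=
  .seq kapSetup (.seq boundSetup
    (.seq (mulInto 8 7 2)
    (.seq (.assign 4 (.add (.var 8) (.var 8)))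
    (.seq (.assign 3 (.sub (.const 0) (.var 4)))
    (.seq (.assign 10 (.add (.var 7) (.var 4)))
    (.seq (mulInto 9 10 2)
    (.seq (.assign 9 (.add (.var 9) (.var 9)))
    (.seq (mulInto 5 9 1)
    (.seq (.assign 5 (.add (.add (.var 5) (.var 5)) (.const 1)))
      (.assign 6 (.const 1)))))))))))

theorem Holds.of_frame {P : Prog} {μ ν : Mem} (h : Holds A B μ) (hF : Frame P μ ν)
    (hv : ∀ x < 2, x ∉ P.modVars) (ha : ∀ a < 4, a ∉ P.modArrs) : Holds A B ν :=
  ⟨(hF.vars 0 (hv 0 (by omega))).trans h.rows, (hF.vars 1 (hv 1 (by omega))).trans h.cols,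
    (hF.arr 0 (ha 0 (by omega))).trans h.valA, (hF.arr 1 (ha 1 (by omega))).trans h.maskA,
    (hF.arr 2 (ha 2 (by omega))).trans h.valB, (hF.arr 3 (ha 3 (by omega))).trans h.maskB⟩

/-- Variable 5 is the depth for the alternating method: it exceeds `n` times the largest difference
of two payments, which is at most `2 * payBound`. The oracle test does not use it. -/
theorem generalSetup_runs {μ : Mem} (hμ : Holds A B μ) (hM : 1 ≤ M) (hA : EntriesBounded A M)
    (hB : EntriesBounded B M) :
    Runs orc generalSetup μ (m * (n * 10 + 4) + 6 * kap m n + 3 * n + 20) fun ν =>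
      ν.out = μ.out ∧ ν.calls = μ.calls ∧ ∃ M' : ℕ, 1 ≤ M' ∧ M' ≤ M ∧ EntriesBounded A M' ∧
        EntriesBounded B M' ∧ HoldsScan A B (-(2 * M' * kap m n : ℕ)) (2 * M' * kap m n : ℕ)
          (2 * payBound m n M' * n + 1) true ν := by
  set κ := kap m n with hκ
  have hfull : Runs orc generalSetup μ (m * (n * 10 + 4) + 6 * κ + 3 * n + 20) fun ν =>
      ∃ M' : ℕ, 1 ≤ M' ∧ M' ≤ M ∧ EntriesBounded A M' ∧
        EntriesBounded B M' ∧ ν.vars 2 = κ ∧ ν.vars 3 = -(2 * M' * κ : ℕ) ∧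
        ν.vars 4 = (2 * M' * κ : ℕ) ∧ ν.vars 5 = (2 * payBound m n M' * n + 1 : ℕ) ∧
        ν.vars 6 = 1 := by
    refine (Runs.seq ((kapSetup_runs hμ.rows hμ.cols).frame.mono le_rfl ?_)).cost
      (K := 2 + (m * (n * 10 + 4) + 3 + (κ * 3 + 3 + (1 + (1 + (1 + (κ * 3 + 3 +
        (1 + (n * 3 + 3 + (1 + 1)))))))))) (by omega)
    rintro ν₁ ⟨hF₁, h2⟩
    have hν₁ := hμ.of_frame hF₁ (by decide) (by decide)
    refine Runs.seq ((boundSetup_runs hν₁ hM hA hB).frame.mono le_rfl ?_)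
    rintro ν₂ ⟨hF₂, M', h7, hM1, hMM, hA', hB'⟩
    have h2' : ν₂.vars 2 = κ := (hF₂.vars 2 (by decide)).trans h2
    have hν₂ := hν₁.of_frame hF₂ (by decide) (by decide)
    refine Runs.seq ((mulInto_runs (x := 8) (y := 7) (z := 2) (by decide) (by decide)
      (by decide) (by decide) (by decide) h2').frame.mono le_rfl ?_)
    rintro ν₃ ⟨hF₃, h8⟩
    have h2₃ : ν₃.vars 2 = κ := (hF₃.vars 2 (by decide)).trans h2'
    have h7₃ : ν₃.vars 7 = M' := (hF₃.vars 7 (by decide)).trans h7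
    have hν₃ := hν₂.of_frame hF₃ (by decide) (by decide)
    rw [h7] at h8
    refine Runs.seq (Runs.assign (Runs.seq (Runs.assign (Runs.seq (Runs.assign
      (Runs.seq ((mulInto_runs (x := 9) (y := 10) (z := 2) (k := κ) (by decide) (by decide)
      (by decide) (by decide) (by decide)
      (by simpa using h2₃)).frame.mono le_rfl ?_)))))))
    rintro ν₄ ⟨hF₄, h9⟩
    have h2₄ := hF₄.vars 2 (by decide)
    have h3₄ := hF₄.vars 3 (by decide)
    have h4₄ := hF₄.vars 4 (by decide)
    have h1₄ := hF₄.vars 1 (by decide)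
    simp [h7₃, h8, h2₃, hν₃.cols] at h1₄ h2₄ h3₄ h4₄ h9
    refine Runs.seq (Runs.assign (Runs.seq ((mulInto_runs (x := 5) (y := 9) (z := 1) (k := n)
      (by decide)
      (by decide) (by decide) (by decide) (by decide) (by simpa using h1₄)).frame.mono le_rfl ?_)))
    rintro ν₅ ⟨hF₅, h5⟩
    have h2₅ := hF₅.vars 2 (by decide)
    have h3₅ := hF₅.vars 3 (by decide)
    have h4₅ := hF₅.vars 4 (by decide)
    simp [h2₄, h3₄, h4₄, h9] at h2₅ h3₅ h4₅ h5
    refine Runs.seq (Runs.assign (Runs.assign ⟨M', hM1, hMM, hA', hB', ?_⟩))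
    simp [h2₅, h3₅, h4₅, h5, payBound, ← hκ]
    refine ⟨by ring, by ring, by ring⟩
  refine hfull.frame.mono le_rfl ?_
  rintro ν ⟨hF, M', hM1, hMM, hA', hB', h2, h3, h4, h5, h6⟩
  exact ⟨hF.out (by decide), hF.calls (by decide), M', hM1, hMM, hA', hB',
    hμ.of_frame hF (by decide) (by decide), h2, h3, h4, h5, h6⟩

end Bound

/-- The algorithm for the general case. -/
def generalProg (T : Prog) : Prog :=
  .seq generalSetup (.seq (testInto T 18 (.sub (.var 3) (.const 1)) (.const 1))
    (.seq (.ifle (.const 0) (.var 18)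
      (.seq (.assign 17 (.const 1)) (.seq (.emit (.const 0)) (.emit (.const 0))))
      (.assign 17 (.const 0))) (scan T)))

section General

variable {orc : GameOracle} {T : Prog} {m n M : ℕ} {A B : Matrix (Fin m) (Fin n) (WithBot ℤ)}

theorem kap_pos (h : Admissible A B) : 0 < kap m n :=
  lt_min (by have := h.1; omega) h.2.1

/-- One test at `-H - 1`, with `H = 2M'κ`, settles the left ray and decides whether the output
begins with an infinite end. The scan of `[-H, H]`, of length `4M'κ`, and the right ray follow,
which gives `1 + 8M'κ³ + 2` calls at most. -/
theorem generalProg_runs {K : ℕ} {Pr : Game → Prop} (hloc : IsLocal T) (h : Admissible A B)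
    (hM : 1 ≤ M) (hA : EntriesBounded A M) (hB : EntriesBounded B M)
    (hT : ∀ M' ≤ M, EntriesBounded A M' → EntriesBounded B M' → Tests orc T (spec A B)
      (fun μ => Holds A B μ ∧ μ.vars 5 = (2 * payBound m n M' * n + 1 : ℕ))
      (fun p q => q ≤ (2 * kap m n : ℕ) ∧ q * M' + |p| ≤ payBound m n M') K Pr)
    {μ : Mem} (hμ : Holds A B μ) (hout : μ.out = []) (hcalls : μ.calls = []) :
    Runs orc (generalProg T) μ (m * (n * 10 + 4) + 10 * kap m n + 3 * n + 3 * K + 57 +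
      4 * M * kap m n ^ 3 * (2 * K + 26 + 8 * kap m n)) fun ν =>
        ν.calls.length ≤ 8 * M * kap m n ^ 3 + 3 ∧ (∀ G ∈ ν.calls, Pr G) ∧
        Identifies ν.out (spec A B) := by
  set κ := kap m n with hκ
  have hκ0 : 0 < κ := kap_pos h
  have hcost : ∀ M' ≤ M, m * (n * 10 + 4) + 6 * κ + 3 * n + 20 + (K + 3 + (4 + (4 * κ +
      4 * M' * κ * κ ^ 2 * (2 * K + 26 + 8 * κ) + 2 * K + 28))) ≤
      m * (n * 10 + 4) + 10 * κ + 3 * n + 3 * K + 57 + 4 * M * κ ^ 3 * (2 * K + 26 + 8 * κ) := by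
    intro M' hM'
    have : 4 * M' * κ * κ ^ 2 * (2 * K + 26 + 8 * κ) ≤ 4 * M * κ ^ 3 * (2 * K + 26 + 8 * κ) := by
      have e : 4 * M' * κ * κ ^ 2 = 4 * M' * κ ^ 3 := by ring
      rw [e]
      gcongr
    omega
  have hrest : ∀ ν : Mem, (ν.out = μ.out ∧ ν.calls = μ.calls ∧ ∃ M' : ℕ, 1 ≤ M' ∧ M' ≤ M ∧
      EntriesBounded A M' ∧ EntriesBounded B M' ∧ HoldsScan A B (-(2 * M' * κ : ℕ))
        (2 * M' * κ : ℕ) (2 * payBound m n M' * n + 1) true ν) →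
      Runs orc (.seq (testInto T 18 (.sub (.var 3) (.const 1)) (.const 1))
        (.seq (.ifle (.const 0) (.var 18)
          (.seq (.assign 17 (.const 1)) (.seq (.emit (.const 0)) (.emit (.const 0))))
          (.assign 17 (.const 0))) (scan T))) ν (K + 3 + (4 + (4 * κ +
            4 * M * κ * κ ^ 2 * (2 * K + 26 + 8 * κ) + 2 * K + 28))) fun ν =>
        ν.calls.length ≤ 8 * M * κ ^ 3 + 3 ∧ (∀ G ∈ ν.calls, Pr G) ∧
          Identifies ν.out (spec A B) := by
    rintro ν ⟨hνo, hνc, M', hM1, hMM, hA', hB', hν⟩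
    set H : ℕ := 2 * M' * κ with hH
    have hWeq : (payBound m n M' : ℤ) = 2 * κ * (M' + H) := by
      simp only [payBound, hH, ← hκ]; push_cast; ring
    have hT' : Tests orc T (spec A B)
        (HoldsScan A B (-(H : ℤ)) H (2 * payBound m n M' * n + 1) true)
        (fun p q => q ≤ (2 * κ : ℕ) ∧ q * M' + |p| ≤ payBound m n M') K Pr :=
      fun ξ hξ => hT M' hMM hA' hB' ξ ⟨hξ.mats, hξ.bound⟩
    have hκ1 : (1 : ℤ) ≤ κ := by exact_mod_cast hκ0
    have hM1' : (1 : ℤ) ≤ M' := by exact_mod_cast hM1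
    have hH0 : (0 : ℤ) ≤ H := Int.natCast_nonneg H
    have hray : ∀ p : ℤ, |p| = H + 1 → (1 : ℤ) ≤ (2 * κ : ℕ) ∧
        1 * (M' : ℤ) + |p| ≤ payBound m n M' := by
      intro p hp
      refine ⟨by push_cast; omega, ?_⟩
      rw [hp, hWeq]
      nlinarith
    -- All scanned fractions satisfy `|p| ≤ H q` and `q ≤ 2κ`, so the payments are bounded by `q (M'
    -- + H) ≤ 2κ (M' + 2M'κ)`.
    have hAdm : ∀ p q : ℤ, 0 < q → q ≤ 2 * κ → -(H : ℤ) * q ≤ p → p ≤ H * q →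
        q ≤ (2 * κ : ℕ) ∧ q * M' + |p| ≤ payBound m n M' := by
      intro p q hq hq2 hp1 hp2
      refine ⟨by push_cast; exact hq2, ?_⟩
      have : |p| ≤ H * q := abs_le.2 ⟨by linarith, hp2⟩
      rw [hWeq]
      have e : q * (M' + (H : ℤ)) ≤ 2 * κ * (M' + H) :=
        mul_le_mul_of_nonneg_right hq2 (by positivity)
      linarith
    have habove : ∀ lam lam' : ℝ, lam ∈ spec A B → ((H : ℤ) : ℝ) < lam → ((H : ℤ) : ℝ) ≤ lam' →
        lam' ∈ spec A B := fun lam lam' hl h1 h2 =>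
      spec_above hA' hB' hl (by exact_mod_cast h1) (by exact_mod_cast h2)
    have hbelow : ∀ lam lam' : ℝ, lam ∈ spec A B → lam < -(H : ℝ) → lam' ≤ -(H : ℝ) →
        lam' ∈ spec A B := fun lam lam' hl h1 h2 =>
      spec_below hA' hB' hl (by exact_mod_cast h1) (by exact_mod_cast h2)
    have habs : |-(H : ℤ) - 1| = H + 1 := by
      rw [show -(H : ℤ) - 1 = -(H + 1) by ring, abs_neg]
      exact abs_of_nonneg (by omega)
    refine Runs.seq ((testInto_runs (e := .sub (.var 3) (.const 1)) (f := .const 1)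
      (p := -(H : ℤ) - 1) (q := 1) hT' hloc (by simp [hν.lo])
      (by simp) ((hν.setVar (by omega) _).setVar (by omega) _) one_pos
      (hray _ habs)).mono le_rfl ?_)
    rintro ξ ⟨hξt, hξv, hξa, hξo, hξc⟩
    have hξ := hν.of_agree (fun x hx => hξv x (by omega) (by omega)) hξa
    have e1 : ((-(H : ℤ) - 1 : ℤ) : ℝ) / ((1 : ℤ) : ℝ) = -(H : ℝ) - 1 := by push_cast; ring
    rw [e1] at hξt
    have hscan : ∀ ζ : Mem, HoldsScan A B (-(H : ℤ)) H (2 * payBound m n M' * n + 1) true ζ →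
        ζ.calls = ξ.calls →
        PartialOutput (spec A B) ζ.out (1 ≤ ζ.vars 17) (-(H : ℤ) : ℤ) →
        Runs orc (scan T) ζ (4 * κ + 4 * M * κ * κ ^ 2 * (2 * K + 26 + 8 * κ) + 2 * K + 28)
          fun ν => ν.calls.length ≤ 8 * M * κ ^ 3 + 3 ∧ (∀ G ∈ ν.calls, Pr G) ∧
            Identifies ν.out (spec A B) := by
      intro ζ hζ hζc hζo
      refine (scan_runs (N := 4 * M' * κ) hT' hloc hAdm hκ0 hζ (by rw [hH]; push_cast; ring) hζo
        (fun _ => ⟨hray _ (abs_of_nonneg (by omega)), habove⟩) (by simp)).mono ?_ ?_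
      · have : 4 * M' * κ * κ ^ 2 * (2 * K + 26 + 8 * κ) ≤
            4 * M * κ * κ ^ 2 * (2 * K + 26 + 8 * κ) := by gcongr
        simp only [← hκ]
        omega
      · rintro η ⟨hηc, hη⟩
        have h1 : CallsAfter [] 1 Pr ξ.calls := by
          rw [← hcalls, ← hνc]; exact hξc
        rw [hζc] at hηc
        obtain ⟨l, hl, hl1, hl2⟩ := h1.append hηc
        rw [List.nil_append] at hl
        subst hl
        refine ⟨hl1.trans ?_, hl2, hη⟩
        have e2 : 4 * M' * κ * κ ^ 2 ≤ 4 * M * κ ^ 3 := by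
          have e : 4 * M' * κ * κ ^ 2 = 4 * M' * κ ^ 3 := by ring
          rw [e]
          gcongr
        simp only [Bool.toNat_true, ← hκ] at hl1 ⊢
        have e3 : 8 * M * κ ^ 3 = 2 * (4 * M * κ ^ 3) := by ring
        omega
    have hξo' : ξ.out = [] := by rw [hξo, hνo, hout]
    have ecast : ((-(H : ℤ) : ℤ) : ℝ) = -(H : ℝ) := by push_cast; ring
    refine Runs.seq (Runs.ifle (K := 3) (fun hg => Runs.seq (K := 1) (K' := 2) (Runs.assign
      (Runs.seq (K := 1) (K' := 1) (Runs.emit (Runs.emit ?_))))) fun hg =>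
        Runs.cost (Runs.assign ?_) (by omega))
    · rw [Expr.ev_const, Expr.ev_var] at hg
      refine hscan _ ((hξ.setVar (x := 17) (by omega) 1).of_agree (fun _ _ => rfl)
        fun _ _ => rfl) rfl ?_
      rw [ecast]
      have := PartialOutput.of_subset (S := spec A B) (v := -(H : ℝ)) fun x hx =>
        hbelow _ x (hξt.1 hg) (by linarith) hx
      simpa [hξo'] using this
    · rw [Expr.ev_const, Expr.ev_var] at hg
      refine hscan _ (hξ.setVar (x := 17) (by omega) 0) rfl ?_
      rw [ecast]
      have := PartialOutput.of_disjoint (S := spec A B) (v := -(H : ℝ)) fun x hx hxS =>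
        hg (hξt.2 (hbelow x _ hxS hx (by linarith)))
      simpa [hξo'] using this
  exact (Runs.seq ((generalSetup_runs hμ hM hA hB).mono le_rfl hrest)).cost (hcost M le_rfl)

end General

/-! ### Bounds on the spectrum without `-∞` columns -/

/-- `v` is the maximum of the coordinates of `B♯ A 0`. -/
def IsResidMax {m n : ℕ} (A B : Matrix (Fin m) (Fin n) (WithBot ℤ)) (v : ℤ) : Prop :=
  (∀ j, ∃ i, ∃ c : ℤ, B i j = c ∧ ∀ k, ∀ a : ℤ, A i k = a → a - c ≤ v) ∧
    ∃ j, ∀ i, ∀ c : ℤ, B i j = c → ∃ k, ∃ a : ℤ, A i k = a ∧ v ≤ a - c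

section ResidMax

variable {orc : GameOracle} {m n M : ℕ} {A B : Matrix (Fin m) (Fin n) (WithBot ℤ)}

theorem IsResidMax.iSup_eq {v : ℤ} (h : IsResidMax A B v) :
    ⨆ j, resid B (mulVec A 0) j = ((v : ℝ) : EReal) := by
  refine le_antisymm (iSup_le fun j => ?_) ?_
  · refine le_of_not_gt fun hlt => ?_
    obtain ⟨r, hr1, hr2⟩ := EReal.lt_iff_exists_real_btwn.1 hlt
    obtain ⟨i, c, hc, hic⟩ := h.1 j
    obtain ⟨k, a, ha, hle⟩ := (coe_le_resid_mulVec_iff _ _ _).1 hr2.le i c hc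
    have e1 : (a : ℝ) - c ≤ v := by exact_mod_cast hic k a ha
    have e2 : (c : ℝ) + r - a ≤ 0 := by
      rw [Pi.zero_apply] at hle
      exact_mod_cast hle
    have e3 : (v : ℝ) < r := by exact_mod_cast hr1
    linarith
  · obtain ⟨j, hj⟩ := h.2
    refine le_iSup_of_le j ((coe_le_resid_mulVec_iff _ _ _).2 fun i c hc => ?_)
    obtain ⟨k, a, ha, hle⟩ := hj i c hc
    have e1 : (v : ℝ) ≤ a - c := by exact_mod_cast hle
    refine ⟨k, a, ha, ?_⟩
    rw [Pi.zero_apply]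
    exact_mod_cast (by linarith : (c : ℝ) + v - a ≤ 0)

theorem IsResidMax.abs_le {v : ℤ} (h : IsResidMax A B v) (hn : 0 < n) (hA : EntriesBounded A M)
    (hB : EntriesBounded B M) (hrow : NoBotRow A) (hcol : NoBotCol B) : |v| ≤ 2 * M := by
  refine _root_.abs_le.2 ⟨?_, ?_⟩
  · obtain ⟨i, c, hc, hic⟩ := h.1 ⟨0, hn⟩
    obtain ⟨k, hk⟩ := hrow i
    obtain ⟨a, ha⟩ := WithBot.ne_bot_iff_exists.1 hk
    have e1 := hic k a ha.symm
    have e2 := _root_.abs_le.1 (hA i k a ha.symm)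
    have e3 := _root_.abs_le.1 (hB _ _ c hc)
    omega
  · obtain ⟨j, hj⟩ := h.2
    obtain ⟨i, hi⟩ := hcol j
    obtain ⟨c, hc⟩ := WithBot.ne_bot_iff_exists.1 hi
    obtain ⟨k, a, ha, hle⟩ := hj i c hc.symm
    have e2 := _root_.abs_le.1 (hA i k a ha)
    have e3 := _root_.abs_le.1 (hB _ _ c hc.symm)
    omega

/-- Take a column `j` where the eigenvector is largest and a row in which the `j`-th residual of the
zero vector is attained. The constraint of this row can only lose when `x k` is replaced by the
maximum `x j`, which then cancels. -/
theorem IsResidMax.le_of_mem_spec {v w : ℤ} (hv : IsResidMax A B v) (hw : IsResidMax B A w)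
    {lam : ℝ} (h : lam ∈ spec A B) : -(w : ℝ) ≤ lam ∧ lam ≤ v := by
  rw [mem_spec_iff, plusMinus, solv_stack_iff] at h
  obtain ⟨S, x, hS, h₁, h₂⟩ := h
  obtain ⟨j, hj, hmax⟩ := Set.exists_max_image S x (Set.toFinite S) hS
  constructor
  · obtain ⟨i, c, hc, hic⟩ := hw.1 j
    obtain ⟨k, hk, d, hd, hle⟩ := h₁ i j hj c hc
    have e1 : (d : ℝ) - c ≤ w := by exact_mod_cast hic k d hd
    have e2 := hmax k hk
    linarith
  · obtain ⟨i, c, hc, hic⟩ := hv.1 j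
    obtain ⟨k, hk, d, hd, hle⟩ := h₂ i j hj c hc
    have e1 : (d : ℝ) - c ≤ v := by exact_mod_cast hic k d hd
    have e2 := hmax k hk
    linarith

/-- Compute the maximum of the coordinates of `B♯ A 0` for the matrices `A` and `B` in the arrays
`a` and `b`, with masks `ma` and `mb`. -/
def residMax (a ma b mb : ℕ) : Prog :=
  .seq (.forLoop 23 (.var 0) (.seq
    (maxLoop (.var 1) (.get ma (.var 23) (.var 31)) (.get a (.var 23) (.var 31)))
    (.put 9 (.const 0) (.var 23) (.var 29))))
  (.seq (.forLoop 24 (.var 1) (.seq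
    (maxLoop (.var 0) (.get mb (.var 31) (.var 24))
      (.sub (.get b (.var 31) (.var 24)) (.get 9 (.const 0) (.var 31))))
    (.put 11 (.const 0) (.var 24) (.sub (.const 0) (.var 29)))))
  (maxLoop (.var 1) (.const 1) (.get 11 (.const 0) (.var 31))))

theorem one_le_maskArray (i : Fin m) (j : Fin n) : 1 ≤ maskArray A i j ↔ A i j ≠ ⊥ := by
  rw [maskArray_apply]
  split_ifs with h <;> simp [h]

/-- Row maxima of `A` go into array 9. The minimum over the rows in each column is computed as a
negated maximum into array 11, so that one loop for maxima serves all three stages. -/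
theorem residMax_runs {a ma b mb : ℕ} (ha : a < 9) (hma : ma < 9) (hb : b < 9) (hmb : mb < 9)
    {μ : Mem} (h0 : μ.vars 0 = m) (h1 : μ.vars 1 = n) (hva : μ.arr a = valArray A)
    (hvma : μ.arr ma = maskArray A) (hvb : μ.arr b = valArray B) (hvmb : μ.arr mb = maskArray B)
    (hn : 0 < n) (hrow : NoBotRow A) (hcol : NoBotCol B) :
    Runs orc (residMax a ma b mb) μ (m * (n * 7 + 7) + n * (m * 7 + 7) + n * 7 + 8) fun ν =>
      IsResidMax A B (ν.vars 29) := by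
  let rowOk : Fin m → ℤ → Prop := fun i v =>
    (∀ k, ∀ z : ℤ, A i k = z → z ≤ v) ∧ ∃ k, A i k = v
  let colOk : (Fin m → ℤ) → Fin n → ℤ → Prop := fun r j v =>
    (∀ i, ∀ c : ℤ, B i j = c → v ≤ r i - c) ∧ ∃ i, ∃ c : ℤ, B i j = c ∧ v = r i - c
  refine (Runs.seq ((Runs.forLoop (n := m) (c := n * 7 + 5)
    (fun i ν => ∀ i' : Fin m, (i' : ℕ) < i → rowOk i' (ν.arr 9 0 i'))
    (by simp [Prog.forLoop, Prog.modVars, maxLoop]) ?_ (by simp)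
    ?_).mono le_rfl ?_)).cost
      (K := m * (n * 7 + 5 + 2) + 2 + (n * (m * 7 + 5 + 2) + 2 + (n * 7 + 4))) (by ring_nf; omega)
  · intro ν hF
    exact (hF.vars 0 (by simp [Prog.forLoop, Prog.modVars, maxLoop])).trans h0
  · intro i hi ν hF hνi hJ
    have e1 := (hF.vars 1 (by simp [Prog.forLoop, Prog.modVars, maxLoop])).trans h1
    have ea := (hF.arr a (by simp [Prog.forLoop, Prog.modArrs, maxLoop]; omega)).trans hva
    have ema := (hF.arr ma (by simp [Prog.forLoop, Prog.modArrs, maxLoop]; omega)).trans hvma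
    refine Runs.seq (K := n * 7 + 4) (K' := 1) ((maxLoop_runs (n := n) (f := maskArray A i)
      (g := valArray A i) ?_ ?_ ?_).frame.mono le_rfl ?_)
    · intro ξ hG
      exact (hG.vars 1 (by simp [Prog.forLoop, Prog.modVars, maxLoop])).trans e1
    · intro k hk ξ hG hξ
      have g1 := hG.vars 23 (by simp [Prog.forLoop, Prog.modVars, maxLoop])
      have g2 := hG.arr ma (by simp [Prog.forLoop, Prog.modArrs, maxLoop])
      simp [hξ, g1, g2, hνi, ema]
    · intro k hk ξ hG hξ
      have g1 := hG.vars 23 (by simp [Prog.forLoop, Prog.modVars, maxLoop])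
      have g2 := hG.arr a (by simp [Prog.forLoop, Prog.modArrs, maxLoop])
      simp [hξ, g1, g2, hνi, ea]
    · rintro ξ ⟨hG, hge, hex⟩
      have g1 := (hG.vars 23 (by simp [Prog.forLoop, Prog.modVars, maxLoop])).trans hνi
      have g2 := hG.arr 9 (by simp [Prog.forLoop, Prog.modArrs, maxLoop])
      refine Runs.put fun i' hi' => ?_
      rcases (by omega : (i' : ℕ) < i ∨ (i' : ℕ) = i) with h | h
      · have : (i' : ℕ) ≠ i := h.ne
        simpa [g1, g2, this] using hJ i' h
      · subst h
        simp only [Mem.setVar_arr, Mem.setArr_arr, Expr.ev_const, Expr.ev_var, g1]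
        simp only [Int.toNat_zero, Int.toNat_natCast, and_self, if_true]
        refine ⟨fun k z hz => ?_, ?_⟩
        · have := hge k k.2 ((one_le_maskArray i' k).2 (by simp [hz]))
          simpa [valArray_apply, hz] using this
        · obtain ⟨k₀, hk₀⟩ := hrow i'
          obtain ⟨k, hk, hk1, hk2⟩ := hex ⟨k₀, k₀.2, (one_le_maskArray i' k₀).2 hk₀⟩
          obtain ⟨z, hz⟩ := WithBot.ne_bot_iff_exists.1 ((one_le_maskArray i' ⟨k, hk⟩).1 hk1)
          refine ⟨⟨k, hk⟩, ?_⟩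
          have := valArray_apply A i' ⟨k, hk⟩
          rw [← hz, WithBot.unbotD_coe] at this
          rw [hk2, this, ← hz]
  rintro ν ⟨hF, -, hν⟩
  have e0 := (hF.vars 0 (by simp [Prog.forLoop, Prog.modVars, maxLoop])).trans h0
  have e1 := (hF.vars 1 (by simp [Prog.forLoop, Prog.modVars, maxLoop])).trans h1
  have eb := (hF.arr b (by simp [Prog.forLoop, Prog.modArrs, maxLoop]; omega)).trans hvb
  have emb := (hF.arr mb (by simp [Prog.forLoop, Prog.modArrs, maxLoop]; omega)).trans hvmb
  replace hν : ∀ i : Fin m, rowOk i (ν.arr 9 0 i) := fun i => hν i i.2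
  generalize hr : ν.arr 9 0 = r at hν
  refine Runs.seq ((Runs.forLoop (n := n) (c := m * 7 + 5)
    (fun j ν => ∀ j' : Fin n, (j' : ℕ) < j → colOk (fun i => r i) j' (ν.arr 11 0 j'))
    (by simp [Prog.forLoop, Prog.modVars, maxLoop]) ?_ (by simp) ?_).mono le_rfl ?_)
  · intro ξ hG
    exact (hG.vars 1 (by simp [Prog.forLoop, Prog.modVars, maxLoop])).trans e1
  · intro j hj ξ hG hξj hJ
    have f0 := (hG.vars 0 (by simp [Prog.forLoop, Prog.modVars, maxLoop])).trans e0
    have fb := (hG.arr b (by simp [Prog.forLoop, Prog.modArrs, maxLoop]; omega)).trans eb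
    have fmb := (hG.arr mb (by simp [Prog.forLoop, Prog.modArrs, maxLoop]; omega)).trans emb
    have f9 := hG.arr 9 (by simp [Prog.forLoop, Prog.modArrs, maxLoop])
    refine Runs.seq (K := m * 7 + 4) (K' := 1) ((maxLoop_runs (n := m)
      (f := fun i => maskArray B i j) (g := fun i => valArray B i j - r i) ?_ ?_ ?_).frame.mono
      le_rfl ?_)
    · intro ζ hH
      exact (hH.vars 0 (by simp [Prog.forLoop, Prog.modVars, maxLoop])).trans f0
    · intro k hk ζ hH hζ
      have g1 := hH.vars 24 (by simp [Prog.forLoop, Prog.modVars, maxLoop])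
      have g2 := hH.arr mb (by simp [Prog.forLoop, Prog.modArrs, maxLoop])
      simp [hζ, g1, g2, hξj, fmb]
    · intro k hk ζ hH hζ
      have g1 := hH.vars 24 (by simp [Prog.forLoop, Prog.modVars, maxLoop])
      have g2 := hH.arr b (by simp [Prog.forLoop, Prog.modArrs, maxLoop])
      have g3 := hH.arr 9 (by simp [Prog.forLoop, Prog.modArrs, maxLoop])
      simp [hζ, g1, g2, g3, hξj, fb, f9, hr]
    · rintro ζ ⟨hH, hge, hex⟩
      have g1 := (hH.vars 24 (by simp [Prog.forLoop, Prog.modVars, maxLoop])).trans hξj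
      have g2 := hH.arr 11 (by simp [Prog.forLoop, Prog.modArrs, maxLoop])
      refine Runs.put fun j' hj' => ?_
      rcases (by omega : (j' : ℕ) < j ∨ (j' : ℕ) = j) with h | h
      · have : (j' : ℕ) ≠ j := h.ne
        simpa [g1, g2, this] using hJ j' h
      · subst h
        simp only [Mem.setVar_arr, Mem.setArr_arr, Expr.ev_const, Expr.ev_var, Expr.ev_sub, g1]
        simp only [Int.toNat_zero, Int.toNat_natCast, and_self, if_true]
        refine ⟨fun i c hc => ?_, ?_⟩
        · have := hge i i.2 ((one_le_maskArray i j').2 (by simp [hc]))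
          simp only [valArray_apply, hc, WithBot.unbotD_coe] at this
          simp only
          omega
        · obtain ⟨i₀, hi₀⟩ := hcol j'
          obtain ⟨i, hi, hi1, hi2⟩ := hex ⟨i₀, i₀.2, (one_le_maskArray i₀ j').2 hi₀⟩
          obtain ⟨z, hz⟩ := WithBot.ne_bot_iff_exists.1 ((one_le_maskArray ⟨i, hi⟩ j').1 hi1)
          refine ⟨⟨i, hi⟩, z, hz.symm, ?_⟩
          have := valArray_apply B ⟨i, hi⟩ j'
          rw [← hz, WithBot.unbotD_coe] at this
          simp only at this ⊢
          omega
  rintro ξ ⟨hG, -, hξ⟩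
  have f1 := (hG.vars 1 (by simp [Prog.forLoop, Prog.modVars, maxLoop])).trans e1
  replace hξ : ∀ j : Fin n, colOk (fun i => r i) j (ξ.arr 11 0 j) := fun j => hξ j j.2
  refine (maxLoop_runs (n := n) (f := fun _ => 1) (g := ξ.arr 11 0) ?_ ?_ ?_).mono le_rfl ?_
  · intro ζ hH
    exact (hH.vars 1 (by simp [Prog.forLoop, Prog.modVars, maxLoop])).trans f1
  · intro k hk ζ hH hζ
    simp
  · intro k hk ζ hH hζ
    have g2 := hH.arr 11 (by simp [Prog.forLoop, Prog.modArrs, maxLoop])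
    simp [hζ, g2]
  · rintro ζ ⟨hge, hex⟩
    refine ⟨fun j => ?_, ?_⟩
    · obtain ⟨i, c, hc, hv⟩ := (hξ j).2
      refine ⟨i, c, hc, fun k a ha => ?_⟩
      have e2 := (hν i).1 k a ha
      have e3 := hge j j.2 le_rfl
      simp only at hv
      omega
    · obtain ⟨j, hj, -, hv⟩ := hex ⟨0, hn, le_rfl⟩
      refine ⟨⟨j, hj⟩, fun i c hc => ?_⟩
      obtain ⟨k, hk⟩ := (hν i).2
      exact ⟨k, r i, hk, hv.trans_le ((hξ ⟨j, hj⟩).1 i c hc)⟩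

theorem IsResidMax.unique {v w : ℤ} (hv : IsResidMax A B v) (hw : IsResidMax A B w) : v = w := by
  have h := hv.iSup_eq.symm.trans hw.iSup_eq
  exact_mod_cast h

/-- The existence is read off from the verified program: it is run with an arbitrary oracle, and its
postcondition provides the maximum. -/
theorem exists_isResidMax (hn : 0 < n) (hrow : NoBotRow A) (hcol : NoBotCol B) :
    ∃ v, IsResidMax A B v := by
  let orc : GameOracle := ⟨fun _ => 0, fun _ => 0⟩
  let arr : ℕ → ℕ → ℕ → ℤ := fun a => match a with
    | 0 => valArray A
    | 1 => maskArray A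
    | 2 => valArray B
    | _ => maskArray B
  obtain ⟨ν, -, -, -, h⟩ := residMax_runs (orc := orc) (a := 0) (ma := 1) (b := 2) (mb := 3)
    (by decide) (by decide) (by decide) (by decide)
    (μ := ⟨fun x => if x = 0 then m else n, arr, [], []⟩) rfl rfl rfl rfl rfl rfl hn hrow hcol 0
  exact ⟨_, h⟩

/-- Compute the parameters of the scan in the case without `-∞` columns. -/
def boundedSetup : Prog :=
  .seq kapSetup (.seq (residMax 0 1 2 3) (.seq (.assign 4 (.var 29))
    (.seq (residMax 2 3 0 1) (.assign 3 (.sub (.const 0) (.var 29))))))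

/-- The algorithm for the case without `-∞` columns. -/
def boundedProg (T : Prog) : Prog :=
  .seq boundedSetup (.ifle (.var 3) (.var 4) (scan T) .skip)

theorem boundedSetup_runs {μ : Mem} {v w : ℤ} (hμ : Holds A B μ) (h : Admissible A B)
    (hA : NoBotCol A) (hB : NoBotCol B) (hv : IsResidMax A B v) (hw : IsResidMax B A w) :
    Runs orc boundedSetup μ (2 * (m * (n * 7 + 7) + n * (m * 7 + 7) + n * 7) + 20) fun ν =>
      ν.vars 2 = kap m n ∧ ν.vars 3 = -w ∧ ν.vars 4 = v := by
  obtain ⟨-, hn, hAr, hBr, -⟩ := h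
  refine (Runs.seq ((kapSetup_runs hμ.rows hμ.cols).frame.mono le_rfl ?_)).cost
    (K := 2 + ((m * (n * 7 + 7) + n * (m * 7 + 7) + n * 7 + 8) + (1 +
      ((m * (n * 7 + 7) + n * (m * 7 + 7) + n * 7 + 8) + 1)))) (by omega)
  rintro ν₁ ⟨hF₁, h2⟩
  have hν₁ := hμ.of_frame hF₁ (by decide) (by decide)
  refine Runs.seq ((residMax_runs (A := A) (B := B) (by decide) (by decide) (by decide)
    (by decide) hν₁.rows hν₁.cols hν₁.valA hν₁.maskA hν₁.valB hν₁.maskB hn hAr hB).frame.mono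
    le_rfl ?_)
  rintro ν₂ ⟨hF₂, h4⟩
  have h4' := h4.unique hv
  have h2₂ : ν₂.vars 2 = kap m n := (hF₂.vars 2 (by decide)).trans h2
  have hν₂ := hν₁.of_frame hF₂ (by decide) (by decide)
  refine Runs.seq (Runs.assign (Runs.seq ((residMax_runs (A := B) (B := A)
    (μ := ν₂.setVar 4 (Expr.ev ν₂ (.var 29))) (by decide)
    (by decide) (by decide) (by decide) (by simpa using hν₂.rows) (by simpa using hν₂.cols)
    hν₂.valB hν₂.maskB hν₂.valA hν₂.maskA hn hBr hA).frame.mono le_rfl ?_)))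
  rintro ν₃ ⟨hF₃, h3⟩
  have h3' := h3.unique hw
  have h2₃ := hF₃.vars 2 (by decide)
  have h4₃ := hF₃.vars 4 (by decide)
  refine Runs.assign ?_
  simp [h2₃, h4₃, h4', h3', h2₂]

/-- The spectrum lies in `[-w, v]`, so the rays need no test and only the `2(v + w)κ² + 1` tests of
the scan remain. -/
theorem boundedProg_runs {T : Prog} {K : ℕ} {Pr : Game → Prop} (hloc : IsLocal T)
    (h : Admissible A B) (hA : NoBotCol A) (hB : NoBotCol B) (hAM : EntriesBounded A M)
    (hBM : EntriesBounded B M) {v w : ℤ} (hv : IsResidMax A B v) (hw : IsResidMax B A w)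
    (hT : Tests orc T (spec A B) (Holds A B)
      (fun p q => q ≤ (2 * kap m n : ℕ) ∧ q * M + |p| ≤ (6 * M * kap m n : ℕ)) K Pr)
    {μ : Mem} (hμ : Holds A B μ) (h5 : μ.vars 5 = 0) (h6 : μ.vars 6 = 0) (h17 : μ.vars 17 = 0)
    (hout : μ.out = []) (hcalls : μ.calls = []) :
    Runs orc (boundedProg T) μ (2 * (m * (n * 7 + 7) + n * (m * 7 + 7) + n * 7) + 4 * kap m n +
      (v + w).toNat * kap m n ^ 2 * (2 * K + 26 + 8 * kap m n) + 2 * K + 49) fun ν =>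
        ν.calls.length ≤ 2 * ((v + w).toNat * kap m n ^ 2) + 1 ∧ (∀ G ∈ ν.calls, Pr G) ∧
        Identifies ν.out (spec A B) := by
  refine (Runs.seq ((boundedSetup_runs hμ h hA hB hv hw).frame.mono le_rfl ?_)).cost
    (K := 2 * (m * (n * 7 + 7) + n * (m * 7 + 7) + n * 7) + 20 + (4 * kap m n +
      (v + w).toNat * kap m n ^ 2 * (2 * K + 26 + 8 * kap m n) + 2 * K + 28 + 1)) (by omega)
  rintro ν ⟨hF, h2, h3, h4⟩
  have hνo : ν.out = [] := (hF.out (by decide)).trans hout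
  have hνc : ν.calls = [] := (hF.calls (by decide)).trans hcalls
  have hν17 : ν.vars 17 = 0 := (hF.vars 17 (by decide)).trans h17
  have hν : HoldsScan A B (-w) v 0 false ν :=
    ⟨hμ.of_frame hF (by decide) (by decide), h2, h3, h4, (hF.vars 5 (by decide)).trans h5,
      (hF.vars 6 (by decide)).trans h6⟩
  refine Runs.ifle (fun hg => ?_) fun hg => Runs.cost (Runs.skip ?_) (by omega)
  · simp only [Expr.ev_var, h3, h4] at hg
    have hva := abs_le.1 (hv.abs_le h.2.1 hAM hBM h.2.2.1 hB)
    have hwa := abs_le.1 (hw.abs_le h.2.1 hBM hAM h.2.2.2.1 hA)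
    have hT' : Tests orc T (spec A B) (HoldsScan A B (-w) v 0 false)
        (fun p q => q ≤ (2 * kap m n : ℕ) ∧ q * M + |p| ≤ (6 * M * kap m n : ℕ)) K Pr :=
      fun ξ hξ => hT ξ hξ.mats
    refine (scan_runs (N := (v + w).toNat) hT' hloc ?_ (kap_pos h) hν
      (by omega) ?_ (by simp) fun _ lam hlam hmem => ?_).mono le_rfl ?_
    · intro p q hq hq2 hp1 hp2
      refine ⟨by push_cast; exact hq2, ?_⟩
      -- The ends `-w` and `v` have modulus at most `2M`, so the payments are at most `3 M q`, and
      -- `q ≤ 2κ`.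
      have e1 : |p| ≤ 2 * M * q := abs_le.2 ⟨by nlinarith, by nlinarith⟩
      push_cast
      nlinarith [Int.natCast_nonneg M]
    · have := PartialOutput.of_disjoint (S := spec A B) (v := ((-w : ℤ) : ℝ)) fun x hx hxS => by
        have := (hv.le_of_mem_spec hw hxS).1
        push_cast at hx
        linarith
      simpa [hνo, hν17] using this
    · exact absurd (hv.le_of_mem_spec hw hmem).2 (not_le.2 hlam)
    · rintro ξ ⟨⟨l, hl, hl1, hl2⟩, hξ⟩
      rw [hνc, List.nil_append] at hl
      subst hl
      exact ⟨by simpa using hl1, hl2, hξ⟩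
  -- Here `v < -w`: the bounds contradict each other, so the spectrum is empty and so is the output.
  · simp only [Expr.ev_var, h3, h4] at hg
    rw [hνc, hνo]
    refine ⟨by simp, by simp, [], by simp, by simp, by simp, ?_⟩
    ext lam
    simp only [List.not_mem_nil, false_and, exists_false, Set.mem_ofPred_eq, iff_false]
    intro hmem
    obtain ⟨e1, e2⟩ := hv.le_of_mem_spec hw hmem
    exact hg (by exact_mod_cast (by push_cast; linarith : ((-w : ℤ) : ℝ) ≤ v))

end ResidMax

/-! ### The algorithms -/

section Costs

variable {m n : ℕ}

theorem kap_le (m n : ℕ) : kap m n ≤ n := min_le_right _ _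

theorem oracleTest_cost_le (hm : 0 < m) : m * (n * (2 * kap m n * 4 + 14) + 4) + 3 ≤
    29 * (m + n) ^ 3 := by
  set s := m + n with hs
  have hs1 : 1 ≤ s := by omega
  calc m * (n * (2 * kap m n * 4 + 14) + 4) + 3 ≤ s * (s * (2 * s * 4 + 14 * s) + 4 * s ^ 2)
        + 3 * s ^ 3 := by
        have := (kap_le m n).trans (by omega : n ≤ s)
        gcongr
        · omega
        · omega
        · omega
        · exact Nat.le_mul_of_pos_right _ (by positivity)
        · exact Nat.le_mul_of_pos_right _ (by positivity)
    _ = 29 * s ^ 3 := by ring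

/-- The size `s` and the exponent `e` are left free to serve both tests: `s = m + n`, `e = 3` with
the oracle, and `s = m + n + M`, `e = 7` with the alternating method. -/
theorem generalProg_cost_le {M K L s e : ℕ} (hs : 1 ≤ s) (he : 3 ≤ e) (hms : m ≤ s) (hns : n ≤ s)
    (hM : 1 ≤ M) (hL : 1 ≤ L) (hK : K ≤ L * s ^ e) :
    m * (n * 10 + 4) + 10 * kap m n + 3 * n + 3 * K + 57 +
      4 * M * kap m n ^ 3 * (2 * K + 26 + 8 * kap m n) ≤ (231 * L) * M * s ^ (e + 3) := by
  have hκ : kap m n ≤ s := (kap_le m n).trans hns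
  have h1 : s ≤ s ^ e := Nat.le_self_pow (by omega) s
  have h0 : 1 ≤ s ^ e := Nat.one_le_pow _ _ hs
  have h2 : s * s ≤ s ^ e := by
    rw [← sq]; exact Nat.pow_le_pow_right hs (by omega)
  have e1 : m * (n * 10 + 4) ≤ 14 * s ^ e := by
    calc m * (n * 10 + 4) ≤ s * (s * 10 + 4 * s) := by gcongr; omega
      _ = 14 * (s * s) := by ring
      _ ≤ 14 * s ^ e := by gcongr
  have e2 : 2 * K + 26 + 8 * kap m n ≤ (2 * L + 34) * s ^ e := by
    rw [add_mul]
    nlinarith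
  have e3 : 4 * M * kap m n ^ 3 * (2 * K + 26 + 8 * kap m n) ≤
      4 * M * s ^ 3 * ((2 * L + 34) * s ^ e) := by gcongr
  have e4 : 4 * M * s ^ 3 * ((2 * L + 34) * s ^ e) = (8 * L + 136) * (M * s ^ (e + 3)) := by ring
  have e5 : s ^ e ≤ M * s ^ (e + 3) :=
    (Nat.pow_le_pow_right hs (by omega)).trans (Nat.le_mul_of_pos_left _ hM)
  have e6 : m * (n * 10 + 4) + 10 * kap m n + 3 * n + 3 * K + 57 ≤ (84 + 3 * L) * s ^ e := by
    rw [add_mul, mul_assoc 3 L]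
    omega
  have e7 : (84 + 3 * L) * s ^ e ≤ (84 + 3 * L) * (M * s ^ (e + 3)) := by gcongr
  calc _ ≤ (84 + 3 * L) * (M * s ^ (e + 3)) + (8 * L + 136) * (M * s ^ (e + 3)) := by omega
    _ = (220 + 11 * L) * (M * s ^ (e + 3)) := by ring
    _ ≤ (231 * L) * (M * s ^ (e + 3)) := Nat.mul_le_mul_right _ (by omega)
    _ = _ := by ring

theorem selfTest_cost_le {M u : ℕ} (hu : 1 ≤ u) (hm : m ≤ u) (hn : n ≤ u) (hM : M ≤ u) :
    m * (n * (2 * kap m n * 4 + 14) + 4) + 2 + (n * 7 + 7 +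
      (n * (2 * payBound m n M * n + 1) + 1) * ((m + m) * (n * 14 + 8) + 4)) ≤ 714 * u ^ 7 := by
  have hκ : kap m n ≤ u := (kap_le m n).trans hn
  have p : ∀ k, 1 ≤ u ^ k := fun k => Nat.one_le_pow _ _ hu
  have e1 : payBound m n M ≤ 6 * u ^ 3 := by
    calc payBound m n M ≤ 2 * u * (u * u + 2 * u * u) := by
          unfold payBound; gcongr; exact hM.trans (Nat.le_mul_of_pos_right _ hu)
      _ = 6 * u ^ 3 := by ring
  have e2 : n * (2 * payBound m n M * n + 1) + 1 ≤ 14 * u ^ 5 := by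
    calc n * (2 * payBound m n M * n + 1) + 1 ≤ u * (2 * (6 * u ^ 3) * u + u ^ 4) + u ^ 5 := by
          gcongr
          · exact p 4
          · exact p 5
      _ = 14 * u ^ 5 := by ring
  have e3 : (m + m) * (n * 14 + 8) + 4 ≤ 48 * u ^ 2 := by
    calc (m + m) * (n * 14 + 8) + 4 ≤ (u + u) * (u * 14 + 8 * u) + 4 * u ^ 2 := by
          gcongr
          · omega
          · have := p 2
            omega
      _ = 48 * u ^ 2 := by ring
  have e4 : m * (n * (2 * kap m n * 4 + 14) + 4) ≤ 26 * u ^ 3 := by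
    calc m * (n * (2 * kap m n * 4 + 14) + 4) ≤ u * (u * (2 * u * 4 + 14 * u) + 4 * u ^ 2) := by
          gcongr
          · omega
          · have := p 2
            omega
      _ = 26 * u ^ 3 := by ring
  have e5 : u ^ 3 ≤ u ^ 7 := Nat.pow_le_pow_right hu (by omega)
  have e6 : u ≤ u ^ 7 := Nat.le_self_pow (by omega) u
  have e7 := p 7
  have e8 := Nat.mul_le_mul e2 e3
  have e9 : 14 * u ^ 5 * (48 * u ^ 2) = 672 * u ^ 7 := by ring
  omega

theorem boundedProg_cost_le {N K : ℕ} (hm : 0 < m) (hK : K ≤ 29 * (m + n) ^ 3) :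
    2 * (m * (n * 7 + 7) + n * (m * 7 + 7) + n * 7) + 4 * kap m n +
      N * kap m n ^ 2 * (2 * K + 26 + 8 * kap m n) + 2 * K + 49 ≤
        181 * (N + 1) * (m + n) ^ 5 := by
  set s := m + n with hs
  have hs1 : 1 ≤ s := by omega
  have hκ : kap m n ≤ s := (kap_le m n).trans (by omega)
  have p : ∀ k, 1 ≤ s ^ k := fun k => Nat.one_le_pow _ _ hs1
  have e1 : m * (n * 7 + 7) + n * (m * 7 + 7) + n * 7 ≤ 35 * s ^ 2 := by
    calc m * (n * 7 + 7) + n * (m * 7 + 7) + n * 7 ≤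
          s * (s * 7 + 7 * s) + s * (s * 7 + 7 * s) + s * (7 * s) := by
          gcongr <;> omega
      _ = 35 * s ^ 2 := by ring
  have e2 : s ≤ s ^ 3 := Nat.le_self_pow (by omega) s
  have e3 : 2 * K + 26 + 8 * kap m n ≤ 92 * s ^ 3 := by
    have := p 3
    omega
  have e4 : N * kap m n ^ 2 * (2 * K + 26 + 8 * kap m n) ≤ N * s ^ 2 * (92 * s ^ 3) := by gcongr
  have e5 : N * s ^ 2 * (92 * s ^ 3) = 92 * (N * s ^ 5) := by ring
  have e6 : s ^ 3 ≤ s ^ 5 := Nat.pow_le_pow_right hs1 (by omega)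
  have e7 : s ^ 2 ≤ s ^ 5 := Nat.pow_le_pow_right hs1 (by omega)
  have e8 := p 5
  have e9 : 181 * (N + 1) * s ^ 5 = 181 * (N * s ^ 5) + 181 * s ^ 5 := by ring
  omega

end Costs

section Input

variable {orc : GameOracle} {m n : ℕ} (A B : Matrix (Fin m) (Fin n) (WithBot ℤ))

/-- The memory of the initial state. -/
def inputMem : Mem := ⟨(input A B).vars, (input A B).arr, [], []⟩

theorem holds_inputMem : Holds A B (inputMem A B) := ⟨rfl, rfl, rfl, rfl, rfl, rfl⟩

variable {A B}

theorem Runs.exec_input {P : Prog} {K : ℕ} {Q : Mem → Prop} (h : Runs orc P (inputMem A B) K Q) :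
    ∃ (ν : Mem) (τ : ℕ), Exec orc P (input A B) (ν.st τ) ∧ τ ≤ K ∧ Q ν := by
  obtain ⟨ν, τ, h1, h2, h3⟩ := h 0
  exact ⟨ν, τ, h1, by omega, h3⟩

theorem Tests.cost {T : Prog} {S : Set ℝ} {Env : Mem → Prop} {Adm : ℤ → ℤ → Prop}
    {K K' : ℕ} {Pr : Game → Prop} (h : Tests orc T S Env Adm K Pr) (hK : K ≤ K') :
    Tests orc T S Env Adm K' Pr := fun μ h1 h2 h3 => (h μ h1 h2 h3).cost hK

theorem time_le_MPG {G : Game} {W : ℕ} (h : G ∈ gameClass m n W) :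
    (orc.time G : ℕ∞) ≤ MPG orc m n W :=
  le_iSup₂ (f := fun (G : Game) (_ : G ∈ gameClass m n W) => (orc.time G : ℕ∞)) G h

theorem gameClass_mono {W W' : ℕ} (h : W ≤ W') : gameClass m n W ⊆ gameClass m n W' := by
  rintro G ⟨h1, h2, h3, h4, h5⟩
  exact ⟨h1, h2, h3, fun i j z hz => (h4 i j z hz).trans (by exact_mod_cast h),
    fun i j z hz => (h5 i j z hz).trans (by exact_mod_cast h)⟩

theorem payBound_mono {M M' : ℕ} (h : M' ≤ M) : payBound m n M' ≤ payBound m n M := by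
  unfold payBound
  gcongr

end Input

/-- The spectrum is identified by pseudo-polynomially many calls to a mean payoff game oracle. -/
theorem exists_identification :
    ∃ (P : Prog) (C d : ℕ), ∀ orc : GameOracle, orc.Correct →
      ∀ (m n : ℕ) (A B : Matrix (Fin m) (Fin n) (WithBot ℤ)) (M : ℕ),
        Admissible A B → 1 ≤ M →
        EntriesBounded A M → EntriesBounded B M →
        ∃ t : State, Exec orc P (input A B) t ∧
          Identifies t.out (spec A B) ∧
          t.calls.length ≤ C * M * kap m n ^ 3 ∧
          (∀ G ∈ t.calls,
            G ∈ gameClass (2 * m) n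
              (2 * kap m n * (M + 2 * M * kap m n)) ∧
            (orc.time G : ℕ∞) ≤ MPG orc (2 * m) n
              (2 * kap m n * (M + 2 * M * kap m n))) ∧
          t.steps ≤ C * M * (m + n) ^ d := by
  refine ⟨generalProg oracleTest, 231 * 29, 6, fun orc horc m n A B M h hM hA hB => ?_⟩
  have hT : ∀ M' ≤ M, EntriesBounded A M' → EntriesBounded B M' → Tests orc oracleTest (spec A B)
      (fun μ => Holds A B μ ∧ μ.vars 5 = (2 * payBound m n M' * n + 1 : ℕ))
      (fun p q => q ≤ (2 * kap m n : ℕ) ∧ q * M' + |p| ≤ payBound m n M')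
      (m * (n * (2 * kap m n * 4 + 14) + 4) + 3)
      (fun G => G ∈ gameClass (2 * m) n (payBound m n M)) := by
    intro M' hM' hA' hB' μ hμ h1 h2
    refine (oracleTest_tests horc h hA' hB' μ hμ.1 h1 h2).mono le_rfl ?_
    rintro ν ⟨h3, l, h4, h5, h6⟩
    exact ⟨h3, l, h4, h5, fun G hG => gameClass_mono (payBound_mono hM') (h6 G hG)⟩
  obtain ⟨ν, τ, hE, hτ, hc, hG, hI⟩ := (generalProg_runs isLocal_oracleTest h hM hA hB hT
    (holds_inputMem A B) rfl rfl).exec_input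
  refine ⟨_, hE, hI, hc.trans ?_, fun G hGc => ⟨hG G hGc, time_le_MPG (hG G hGc)⟩,
    hτ.trans (generalProg_cost_le (by have := h.1; omega) le_rfl (by omega) (by omega) hM
      (by omega) (oracleTest_cost_le h.1))⟩
  -- The three additional calls are absorbed by the constant, because `M κ³ ≥ 1`.
  have := Nat.one_le_pow 3 _ (kap_pos h)
  have := Nat.mul_le_mul hM this
  rw [mul_assoc, mul_assoc]
  omega

/-- The spectrum is identified in pseudo-polynomial time. -/
theorem exists_pseudoPolynomial_identification :
    ∃ (P : Prog) (C d : ℕ), ∀ orc : GameOracle,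
      ∀ (m n : ℕ) (A B : Matrix (Fin m) (Fin n) (WithBot ℤ)) (M : ℕ),
        Admissible A B → 1 ≤ M →
        EntriesBounded A M → EntriesBounded B M →
        ∃ t : State, Exec orc P (input A B) t ∧
          Identifies t.out (spec A B) ∧
          t.calls = [] ∧
          t.steps ≤ C * (m + n + M) ^ d := by
  refine ⟨generalProg selfTest, 231 * 714, 11, fun orc m n A B M h hM hA hB => ?_⟩
  have hT : ∀ M' ≤ M, EntriesBounded A M' → EntriesBounded B M' → Tests orc selfTest (spec A B)
      (fun μ => Holds A B μ ∧ μ.vars 5 = (2 * payBound m n M' * n + 1 : ℕ))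
      (fun p q => q ≤ (2 * kap m n : ℕ) ∧ q * M' + |p| ≤ payBound m n M')
      (m * (n * (2 * kap m n * 4 + 14) + 4) + 2 + (n * 7 + 7 +
        (n * (2 * payBound m n M * n + 1) + 1) * ((m + m) * (n * 14 + 8) + 4)))
      (fun _ => False) := by
    intro M' hM' hA' hB'
    refine (selfTest_tests h hA' hB' (by omega)).cost ?_
    have := payBound_mono (m := m) (n := n) hM'
    gcongr
  obtain ⟨ν, τ, hE, hτ, -, hG, hI⟩ := (generalProg_runs isLocal_selfTest h hM hA hB hT
    (holds_inputMem A B) rfl rfl).exec_input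
  -- Every submitted game would satisfy `False`, so none was submitted.
  refine ⟨_, hE, hI, List.eq_nil_iff_forall_not_mem.2 hG, hτ.trans
    ((generalProg_cost_le (s := m + n + M) (e := 7) (L := 714) (by omega) (by omega) (by omega)
      (by omega) hM (by omega) (selfTest_cost_le (by omega) (by omega) (by omega)
        (by omega))).trans ?_)⟩
  calc 231 * 714 * M * (m + n + M) ^ (7 + 3) ≤ 231 * 714 * (m + n + M) * (m + n + M) ^ (7 + 3) := by
        gcongr
        omega
    _ = 231 * 714 * (m + n + M) ^ 11 := by ring

/-- Without `-∞` columns, the number of calls is governed by the width of an interval that contains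
the spectrum. -/
theorem exists_identification_of_noBotCol :
    ∃ (P : Prog) (C d : ℕ), ∀ orc : GameOracle, orc.Correct →
      ∀ (m n : ℕ) (A B : Matrix (Fin m) (Fin n) (WithBot ℤ)) (M : ℕ),
        Admissible A B → NoBotCol A → NoBotCol B → 1 ≤ M →
        EntriesBounded A M → EntriesBounded B M →
        ∃ t : State, Exec orc P (input A B) t ∧
          Identifies t.out (spec A B) ∧
          (t.calls.length : ℝ) ≤
            C * max (width A B) 0 * (kap m n : ℝ) ^ 2 + 1 ∧
          (∀ G ∈ t.calls,
            G ∈ gameClass (2 * m) n (6 * M * kap m n) ∧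
            (orc.time G : ℕ∞) ≤ MPG orc (2 * m) n (6 * M * kap m n)) ∧
          (t.steps : ℝ) ≤ C * (max (width A B) 0 + 1) * ((m : ℝ) + n) ^ d := by
  refine ⟨boundedProg oracleTest, 181, 5, fun orc horc m n A B M h hA hB hM hAM hBM => ?_⟩
  obtain ⟨v, hv⟩ := exists_isResidMax h.2.1 h.2.2.1 hB
  obtain ⟨w, hw⟩ := exists_isResidMax h.2.1 h.2.2.2.1 hA
  -- Both maxima are integers, so `ℓ` is the natural number `(v + w).toNat` and the integer bounds
  -- of the scan apply to it.
  have hwidth : ((v + w).toNat : ℝ) = max (width A B) 0 := by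
    rw [width, hv.iSup_eq, hw.iSup_eq, EReal.toReal_coe, EReal.toReal_coe]
    have : (((v + w).toNat : ℤ) : ℝ) = ((max (v + w) 0 : ℤ) : ℝ) := by rw [Int.toNat_eq_max]
    push_cast at this
    exact this
  obtain ⟨ν, τ, hE, hτ, hc, hG, hI⟩ := (boundedProg_runs isLocal_oracleTest h hA hB hAM hBM hv hw
    (oracleTest_tests horc h hAM hBM) (holds_inputMem A B) rfl rfl rfl rfl rfl).exec_input
  refine ⟨_, hE, hI, ?_, fun G hGc => ⟨hG G hGc, time_le_MPG (hG G hGc)⟩, ?_⟩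
  · rw [← hwidth]
    have : ν.calls.length ≤ 181 * (v + w).toNat * kap m n ^ 2 + 1 := by
      rw [mul_assoc]
      omega
    exact_mod_cast this
  · rw [← hwidth]
    exact_mod_cast hτ.trans (boundedProg_cost_le h.1 (oracleTest_cost_le h.1))

end MaxPlus

end

theorem theorem8 :
    -- Part 1: the general case
    (∃ (P : MaxPlus.Prog) (C d : ℕ), ∀ orc : MaxPlus.GameOracle, orc.Correct →
      ∀ (m n : ℕ) (A B : Matrix (Fin m) (Fin n) (WithBot ℤ)) (M : ℕ),
        MaxPlus.Admissible A B → 1 ≤ M →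
        MaxPlus.EntriesBounded A M → MaxPlus.EntriesBounded B M →
        ∃ t : MaxPlus.State, MaxPlus.Exec orc P (MaxPlus.input A B) t ∧
          MaxPlus.Identifies t.out (MaxPlus.spec A B) ∧
          t.calls.length ≤ C * M * MaxPlus.kap m n ^ 3 ∧
          (∀ G ∈ t.calls,
            G ∈ MaxPlus.gameClass (2 * m) n
              (2 * MaxPlus.kap m n * (M + 2 * M * MaxPlus.kap m n)) ∧
            (orc.time G : ℕ∞) ≤ MaxPlus.MPG orc (2 * m) n
              (2 * MaxPlus.kap m n * (M + 2 * M * MaxPlus.kap m n))) ∧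
          t.steps ≤ C * M * (m + n) ^ d) ∧
    -- Part 1, pseudo-polynomial time: without any call to the oracle
    (∃ (P : MaxPlus.Prog) (C d : ℕ), ∀ orc : MaxPlus.GameOracle,
      ∀ (m n : ℕ) (A B : Matrix (Fin m) (Fin n) (WithBot ℤ)) (M : ℕ),
        MaxPlus.Admissible A B → 1 ≤ M →
        MaxPlus.EntriesBounded A M → MaxPlus.EntriesBounded B M →
        ∃ t : MaxPlus.State, MaxPlus.Exec orc P (MaxPlus.input A B) t ∧
          MaxPlus.Identifies t.out (MaxPlus.spec A B) ∧
          t.calls = [] ∧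
          t.steps ≤ C * (m + n + M) ^ d) ∧
    -- Part 2: no `-∞` columns
    (∃ (P : MaxPlus.Prog) (C d : ℕ), ∀ orc : MaxPlus.GameOracle, orc.Correct →
      ∀ (m n : ℕ) (A B : Matrix (Fin m) (Fin n) (WithBot ℤ)) (M : ℕ),
        MaxPlus.Admissible A B → MaxPlus.NoBotCol A → MaxPlus.NoBotCol B → 1 ≤ M →
        MaxPlus.EntriesBounded A M → MaxPlus.EntriesBounded B M →
        ∃ t : MaxPlus.State, MaxPlus.Exec orc P (MaxPlus.input A B) t ∧
          MaxPlus.Identifies t.out (MaxPlus.spec A B) ∧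
          (t.calls.length : ℝ) ≤
            C * max (MaxPlus.width A B) 0 * (MaxPlus.kap m n : ℝ) ^ 2 + 1 ∧
          (∀ G ∈ t.calls,
            G ∈ MaxPlus.gameClass (2 * m) n (6 * M * MaxPlus.kap m n) ∧
            (orc.time G : ℕ∞) ≤ MaxPlus.MPG orc (2 * m) n (6 * M * MaxPlus.kap m n)) ∧
          (t.steps : ℝ) ≤ C * (max (MaxPlus.width A B) 0 + 1) * ((m : ℝ) + n) ^ d) :=
  ⟨MaxPlus.exists_identification, MaxPlus.exists_pseudoPolynomial_identification,
    MaxPlus.exists_identification_of_noBotCol⟩
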